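/- **Setting.** Let $(G,H,\alpha,\tau)$ and $(H,J,\alpha',\tau')$ be Lie crossed modules such that $\tau(H)$, $\tau'(J)$ and $\tau\tau'(J)$ are closed. In $H\rtimes_\alpha G$ the element $(h,g)$ has source $g$ and target $\tau(h)g$, and $(h_2,g_2)\circ(h_1,g_1)=(h_2h_1,g_1)$ when $g_2=\tau(h_1)g_1$. Put $J_H=\{(\tau'(j),\tau\tau'(j')) : j,j'\in J\}\subset H\rtimes_\alpha G$. If $\tau(H)=G$, then $\overline{\mathbf G}$ denotes the categorical group with object group $G/\tau\tau'(J)$, morphism group $(H\rtimes_\alpha G)/J_H$, and source, target and composition induced from $H\rtimes_\alpha G$. In general, $\overline{\mathbf G}_\tau$ is the same construction with $G$ replaced by $\tau(H)$: object group $\tau(H)/\tau\tau'(J)$, morphism group $(H\rtimes_\alpha\tau(H))/J_H$. Let $B$ be a smooth manifold with an open cover $\{U_i\}_{i\in\mathcal I}$, and let $\mathbf B$ be the category whose objects are the points of $B$ and whose morphisms are the piecewise smooth paths $[a,b]\to B$ (continuous, and $C^\infty$ on each closed interval of a finite subdivision), identified up to translation of the parameter, with concatenation as composition and paths of length $0$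 as identities. For finite nonempty $I\subset\mathcal I$ let $U_I=\bigcap_{i\in I}U_i$, and let $\mathbf U_I$ be the category of points of $U_I$ and paths inside $U_I$. Let smooth functions $h_{ik}:U_i\cap U_k\to H$ and $j_{ikm}:U_i\cap U_k\cap U_m\to J$ with $$h_{im}=\tau'(j_{ikm})\,h_{ik}h_{km}\quad\text{on }U_i\cap U_k\cap U_m$$ be given (a gerbal cocycle). Let $\overline g_{ik}(u)$ be the class of $\tau(h_{ik}(u))$ and, for a path $\gamma$ from $\gamma_0$ to $\gamma_1$ in $U_i\cap U_k$, let $\overline\theta_{ik}(\gamma)$ be the class of $\bigl(h_{ik}(\gamma_1)h_{ik}(\gamma_0)^{-1},\tau(h_{ik}(\gamma_0))\bigr)$. **Construction.** Assume first $\tau(H)=G$, and write $\overline G$ for the object group of $\overline{\mathbf G}$. Let $X$ be the set of classes $[i,u,\overline g]$ with $u\in U_i$ and $\overline g\in\overline G$, where $[i,u,\overline g]=[j,v,\overline g']$ iff $v=u$ and $\overline g'=\overline g_{ji}(u)\overline g$. Let $Q$ be the quiver with vertex set $X$ and edges $(i,I,\gamma,\phi)$, with $i\in I$, $\gamma\in\mathrm{Mor}(\mathbf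 U_I)$, $\phi\in\mathrm{Mor}(\overline{\mathbf G})$, source $[i,s(\gamma),s(\phi)]$ and target $[i,t(\gamma),t(\phi)]$. Let $\mathcal A_Q$ be its real quiver algebra: it is spanned by the nonempty sequences of consecutive edges, and products are concatenations, or $0$ if target and source do not match. Let $N$ be the two-sided ideal generated by all $$(i,I,\gamma,\phi)-(j,J,\gamma,\overline\theta_{ji}(\gamma)\phi)\quad\text{with }\gamma\text{ inside }U_I\cap U_J,$$ and all $$(k,K,\gamma_k,\phi_k)-(i,I,\gamma_i,\phi_i)\cdot(j,J,\gamma_j,\phi_j)$$ with $K\subset I\cap J$, $\gamma_k=\gamma_j\circ\gamma_i$ and $\phi_k=(\overline\theta_{kj}(\gamma_j)\phi_j)\circ(\overline\theta_{ki}(\gamma_i)\phi_i)$ (the compositions being defined). The category $\mathbf X$ has object set $X$; its morphisms $x\to y$ are the classes in $\mathcal A_Q/N$ of the nonempty sequences of edges leading from $x$ to $y$; composition is induced by the multiplication; the identity at $[i,u,\overline g]$ is the class $[i,\{i\},1_u,1_{\overline g}]$. **Theorem.** Source and target of a class of nonempty edge sequences in $\mathcal A_Q/N$ are well defined. There are functors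 $\pi:\mathbf X\to\mathbf B$ with $[i,u,\overline g]\mapsto u$, $[i,I,\gamma,\phi]\mapsto\gamma$, and $\mathbf X\times\overline{\mathbf G}\to\mathbf X$ with $[i,u,\overline g]\cdot\overline a=[i,u,\overline g\,\overline a]$, $[i,I,\gamma,\phi]\cdot\psi=[i,I,\gamma,\phi\psi]$, such that: 1. $\pi$ is a categorical principal $\overline{\mathbf G}$-bundle: $\pi$ is surjective on objects and on morphisms, and $\overline{\mathbf G}$ acts on the right, freely on objects and on morphisms, and preserves the fibres of $\pi$ on objects and on morphisms. 2. $\pi$ is locally trivial: for $i\in I$, $(u,\overline g)\mapsto[i,u,\overline g]$, $(\gamma,\phi)\mapsto[i,I,\gamma,\phi]$ is an isomorphism of categories from $\mathbf U_I\times\overline{\mathbf G}$ onto the subcategory $\mathbf X_I$ of the objects over $U_I$ and the morphisms over $\mathrm{Mor}(\mathbf U_I)$; it respects projections and actions. 3. On objects this is an ordinary principal $\overline G$-bundle. For the quotient topology on $X$ of $\bigsqcup_i U_i\times\overline G$, the maps $(u,\overline g)\mapsto[i,u,\overline g]$ are homeomorphisms of $U_i\times\overline G$ onto the open sets $\pi^{-1}(U_i)$,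 projection and action are continuous, and $X$ is Hausdorff and second countable. With respect to the quotient Lie group structure of $\overline G$ (a Lie group structure on the topological group $\overline G$ for which $H\to\overline G$, $h\mapsto[\tau(h)]$, is smooth), $X$ has a smooth manifold structure for which these maps are diffeomorphisms onto open sets and projection and action are smooth. Without the assumption $\tau(H)=G$, the same construction and the same assertions hold with $\overline{\mathbf G}_\tau$ in place of $\overline{\mathbf G}$, that is, with $\tau(H)$ in place of $G$. -/

import Mathlib

open CategoryTheory Manifold ContDiff

noncomputable section

namespace CatBundle

/-! ### Small categories: morphism sets, subcategories -/

/-- The set of all morphisms of a category. -/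
abbrev Mor (C : Type*) [Category C] := Quiver.Total C

/-- The action of a functor on the set of all morphisms. -/
def onMor {C D : Type*} [Category C] [Category D] (F : C ⥤ D) (f : Mor C) : Mor D :=
  ⟨F.obj f.left, F.obj f.right, F.map f.hom⟩

/-- A pair of morphisms, as a morphism of the product category. -/
def pairMor {C D : Type*} [Category C] [Category D] (f : Mor C) (g : Mor D) : Mor (C × D) :=
  ⟨(f.left, g.left), (f.right, g.right), Prod.mkHom f.hom g.hom⟩

/-- A (not necessarily full, not necessarily wide) subcategory. -/
structure Subcat (C : Type*) [Category C] where
  obj : C → Prop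
  hom : ∀ {x y : C}, (x ⟶ y) → Prop
  id_mem : ∀ x, obj x → hom (𝟙 x)
  comp_mem : ∀ {x y z : C} (f : x ⟶ y) (g : y ⟶ z), hom f → hom g → hom (f ≫ g)

namespace Subcat

variable {C D : Type*} [Category C] [Category D]

/-- The objects of a subcategory. -/
def Carrier (S : Subcat C) := {x : C // S.obj x}

instance (S : Subcat C) : Category S.Carrier where
  Hom x y := {f : x.1 ⟶ y.1 // S.hom f}
  id x := ⟨𝟙 x.1, S.id_mem x.1 x.2⟩
  comp f g := ⟨f.1 ≫ g.1, S.comp_mem f.1 g.1 f.2 g.2⟩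
  id_comp f := Subtype.ext (Category.id_comp f.1)
  comp_id f := Subtype.ext (Category.comp_id f.1)
  assoc f g h := Subtype.ext (Category.assoc f.1 g.1 h.1)

/-- The inclusion functor. -/
def incl (S : Subcat C) : S.Carrier ⥤ C where
  obj x := x.1
  map f := f.1

/-- The preimage of a subcategory under a functor: the objects and the morphisms that the
functor sends into the subcategory. -/
def comap (F : C ⥤ D) (S : Subcat D) : Subcat C where
  obj x := S.obj (F.obj x)
  hom f := S.hom (F.map f)
  id_mem x hx := by rw [F.map_id]; exact S.id_mem _ hx
  comp_mem f g hf hg := by rw [F.map_comp]; exact S.comp_mem _ _ hf hg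

end Subcat

/-! ### Categorical groups and categorical principal bundles -/

/-- A categorical group: the objects and the morphisms form groups, and the two multiplications
are the object part and the morphism part of one functor `K × K ⥤ K`. -/
class CategoricalGroup (K : Type*) [Category K] extends Group K where
  morGroup : Group (Mor K)
  mulFunctor : K × K ⥤ K
  mulFunctor_obj : ∀ a b : K, mulFunctor.obj (a, b) = a * b
  mulFunctor_mor : ∀ f g : Mor K, onMor mulFunctor (pairMor f g) = f * g

instance (K : Type*) [Category K] [CategoricalGroup K] : Group (Mor K) :=
  CategoricalGroup.morGroup

/-- A categorical principal bundle with structure categorical group `K`: a functor `π : P ⥤ B`,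
surjective on objects and on morphisms, with a functor `P × K ⥤ P` that is a free right action on
objects and on morphisms and preserves the fibres of `π` on objects and on morphisms. -/
structure IsCategoricalPrincipalBundle {P B K : Type*} [Category P] [Category B] [Category K]
    [CategoricalGroup K] (π : P ⥤ B) (act : P × K ⥤ P) : Prop where
  surjective_obj : Function.Surjective π.obj
  surjective_mor : Function.Surjective (onMor π)
  obj_one : ∀ p : P, act.obj (p, 1) = p
  obj_mul : ∀ (p : P) (a b : K), act.obj (p, a * b) = act.obj (act.obj (p, a), b)
  mor_one : ∀ f : Mor P, onMor act (pairMor f 1) = f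
  mor_mul : ∀ (f : Mor P) (φ ψ : Mor K),
    onMor act (pairMor f (φ * ψ)) = onMor act (pairMor (onMor act (pairMor f φ)) ψ)
  obj_free : ∀ (p : P) (a : K), act.obj (p, a) = p → a = 1
  mor_free : ∀ (f : Mor P) (φ : Mor K), onMor act (pairMor f φ) = f → φ = 1
  obj_fibre : ∀ (p : P) (a : K), π.obj (act.obj (p, a)) = π.obj p
  mor_fibre : ∀ (f : Mor P) (φ : Mor K), onMor π (onMor act (pairMor f φ)) = onMor π f

/-! ### The category of points and piecewise smooth paths -/

section Paths

variable (E : Type*) [NormedAddCommGroup E] [NormedSpace ℝ E]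
variable (B : Type*) [TopologicalSpace B] [ChartedSpace E B]

/-- A piecewise smooth path in `B`, up to translation of its parameter interval. Each class has
exactly one representative that is defined on an interval `[0, len]`, and this is recorded as a map
`ℝ → B` that is constant on `(-∞, 0]` and on `[len, ∞)`. Piecewise smooth: there is a finite set of
break points such that the path is `C^∞` on every closed subinterval of `[0, len]` with no
break point in its interior. Length zero is allowed and gives the identity morphisms. -/
@[ext]
structure PSPath where
  len : ℝ
  toFun : ℝ → B
  len_nonneg : 0 ≤ len
  left_const : ∀ t, t ≤ 0 → toFun t = toFun 0
  right_const : ∀ t, len ≤ t → toFun t = toFun len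
  smooth : ∃ T : Finset ℝ, ∀ a b : ℝ, 0 ≤ a → b ≤ len → (∀ t ∈ T, t ∉ Set.Ioo a b) →
    ContMDiffOn 𝓘(ℝ, ℝ) 𝓘(ℝ, E) ∞ toFun (Set.Icc a b)

variable {E B}

namespace PSPath

/-- The initial point. -/
def src (γ : PSPath E B) : B := γ.toFun 0

/-- The terminal point. -/
def tgt (γ : PSPath E B) : B := γ.toFun γ.len

/-- The path lies entirely inside `S`. -/
def Inside (γ : PSPath E B) (S : Set B) : Prop := ∀ t, γ.toFun t ∈ S

/-- The path of length zero at `u`. -/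
def const (u : B) : PSPath E B where
  len := 0
  toFun _ := u
  len_nonneg := le_rfl
  left_const _ _ := rfl
  right_const _ _ := rfl
  smooth := ⟨∅, fun _ _ _ _ _ => contMDiffOn_const⟩

/-- The concatenation `γ₂ ∘ γ₁` (first `γ₁`, then `γ₂`). -/
def concat (γ₁ γ₂ : PSPath E B) (h : γ₁.tgt = γ₂.src) : PSPath E B where
  len := γ₁.len + γ₂.len
  toFun t := if t ≤ γ₁.len then γ₁.toFun t else γ₂.toFun (t - γ₁.len)
  len_nonneg := add_nonneg γ₁.len_nonneg γ₂.len_nonneg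
  left_const t ht := by
    have h1 : t ≤ γ₁.len := ht.trans γ₁.len_nonneg
    simp only [h1, γ₁.len_nonneg, if_true]
    exact γ₁.left_const t ht
  right_const t ht := by
    have h0 := γ₂.len_nonneg
    by_cases h1 : t ≤ γ₁.len
    · have h2 : γ₂.len = 0 := by linarith
      have h3 : t = γ₁.len := by linarith
      simp [h2, h3]
    · rw [if_neg h1, γ₂.right_const (t - γ₁.len) (by linarith)]
      by_cases h2 : γ₁.len + γ₂.len ≤ γ₁.len
      · have h3 : γ₂.len = 0 := by linarith
        rw [if_pos h2, h3, add_zero]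
        exact h.symm
      · rw [if_neg h2, add_sub_cancel_left]
  smooth := by
    obtain ⟨T₁, h₁⟩ := γ₁.smooth
    obtain ⟨T₂, h₂⟩ := γ₂.smooth
    classical
    refine ⟨T₁ ∪ {γ₁.len} ∪ T₂.image (fun t => t + γ₁.len), fun a b ha hb hT => ?_⟩
    have hlen : γ₁.len ∉ Set.Ioo a b := hT _ (by simp)
    by_cases hb1 : b ≤ γ₁.len
    · refine (h₁ a b ha hb1 fun t ht => hT t (by simp [ht])).congr fun t ht => ?_
      rw [if_pos (ht.2.trans hb1)]
    · have ha1 : γ₁.len ≤ a := by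
        by_contra hc
        exact hlen ⟨not_le.mp hc, not_le.mp hb1⟩
      have key := h₂ (a - γ₁.len) (b - γ₁.len) (by linarith) (by linarith) (fun t ht hm => by
        refine hT (t + γ₁.len) (by simp [ht]) ⟨?_, ?_⟩
        · linarith [hm.1]
        · linarith [hm.2])
      have hsub : ContMDiffOn 𝓘(ℝ, ℝ) 𝓘(ℝ, ℝ) ∞ (fun t : ℝ => t - γ₁.len) (Set.Icc a b) :=
        (contDiff_id.sub contDiff_const).contMDiff.contMDiffOn
      refine (key.comp hsub fun t ht => ⟨by linarith [ht.1], by linarith [ht.2]⟩).congr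
        fun t ht => ?_
      by_cases h3 : t ≤ γ₁.len
      · have h4 : t = γ₁.len := le_antisymm h3 (ha1.trans ht.1)
        rw [if_pos h3, h4]
        simpa [src, tgt] using h
      · rw [if_neg h3]; rfl

@[simp] lemma src_const (u : B) : (const u : PSPath E B).src = u := rfl

@[simp] lemma tgt_const (u : B) : (const u : PSPath E B).tgt = u := rfl

@[simp] lemma src_concat (γ₁ γ₂ : PSPath E B) (h : γ₁.tgt = γ₂.src) :
    (γ₁.concat γ₂ h).src = γ₁.src := by
  simp [src, concat, γ₁.len_nonneg]

@[simp] lemma tgt_concat (γ₁ γ₂ : PSPath E B) (h : γ₁.tgt = γ₂.src) :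
    (γ₁.concat γ₂ h).tgt = γ₂.tgt := by
  have h0 := γ₂.len_nonneg
  simp only [tgt, concat]
  split_ifs with h1
  · have h2 : γ₂.len = 0 := by linarith
    rw [h2, add_zero]; exact h
  · rw [add_sub_cancel_left]

lemma concat_inside {γ₁ γ₂ : PSPath E B} (h : γ₁.tgt = γ₂.src) {S : Set B}
    (h₁ : γ₁.Inside S) (h₂ : γ₂.Inside S) : (γ₁.concat γ₂ h).Inside S := by
  intro t
  simp only [concat]
  split_ifs
  · exact h₁ _
  · exact h₂ _

lemma const_concat (u : B) (γ : PSPath E B) (h : (const u : PSPath E B).tgt = γ.src) :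
    (const u).concat γ h = γ := by
  refine PSPath.ext ?_ ?_
  · simp [concat, const]
  · funext t
    simp only [concat, const, sub_zero]
    split_ifs with h1
    · rw [γ.left_const t h1]; exact h
    · rfl

lemma concat_const (u : B) (γ : PSPath E B) (h : γ.tgt = (const u : PSPath E B).src) :
    γ.concat (const u) h = γ := by
  refine PSPath.ext ?_ ?_
  · simp [concat, const]
  · funext t
    simp only [concat, const]
    split_ifs with h1
    · rfl
    · rw [γ.right_const t (not_le.mp h1).le]; exact h.symm

lemma concat_assoc (γ₁ γ₂ γ₃ : PSPath E B) (h : γ₁.tgt = γ₂.src) (h' : γ₂.tgt = γ₃.src) :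
    (γ₁.concat γ₂ h).concat γ₃ (by simpa using h') =
      γ₁.concat (γ₂.concat γ₃ h') (by simpa using h) := by
  refine PSPath.ext (add_assoc _ _ _) ?_
  funext t
  have h0 := γ₂.len_nonneg
  by_cases h1 : t ≤ γ₁.len
  · have h2 : t ≤ γ₁.len + γ₂.len := by linarith
    simp [concat, h1, h2]
  · by_cases h2 : t ≤ γ₁.len + γ₂.len
    · have h3 : t - γ₁.len ≤ γ₂.len := by linarith
      simp only [concat, h1, h2, h3, if_true, if_false]
    · have h3 : ¬ t - γ₁.len ≤ γ₂.len := by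
        intro h4; exact h2 (by linarith)
      simp only [concat, h1, h2, h3, if_false]
      congr 1; ring

end PSPath

variable (E B)

/-- The category whose objects are the points of `B` and whose morphisms are the piecewise smooth
paths in `B`, composed by concatenation. -/
def PathCat (_E : Type*) (B : Type*) := B

instance : Category (PathCat E B) where
  Hom u v := {γ : PSPath E B // γ.src = u ∧ γ.tgt = v}
  id u := ⟨PSPath.const u, rfl, rfl⟩
  comp f g := ⟨f.1.concat g.1 (f.2.2.trans g.2.1.symm), (PSPath.src_concat _ _ _).trans f.2.1,
    (PSPath.tgt_concat _ _ _).trans g.2.2⟩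
  id_comp f := Subtype.ext (PSPath.const_concat _ f.1 f.2.1.symm)
  comp_id f := Subtype.ext (PSPath.concat_const _ f.1 f.2.2)
  assoc f g h := Subtype.ext (PSPath.concat_assoc f.1 g.1 h.1 (f.2.2.trans g.2.1.symm)
    (g.2.2.trans h.2.1.symm))

variable {E B}

/-- A path, as a morphism of the path category. -/
def pathMor (γ : PSPath E B) : Mor (PathCat E B) := ⟨γ.src, γ.tgt, ⟨γ, rfl, rfl⟩⟩

variable (E)

/-- The subcategory of the points of `S` and of the paths that lie entirely inside `S`. -/
def pathSub (S : Set B) : Subcat (PathCat E B) where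
  obj u := (show B from u) ∈ S
  hom γ := γ.1.Inside S
  id_mem _ hu := fun _ => hu
  comp_mem f g hf hg := PSPath.concat_inside (f.2.2.trans g.2.1.symm) hf hg

end Paths

/-! ### Crossed modules and the categorical group obtained from a pair of them -/

/-- A crossed module `(G, H, α, τ)`. -/
structure CrossedModule (G H : Type*) [Group G] [Group H] where
  τ : H →* G
  α : G →* MulAut H
  τ_α : ∀ g h, τ (α g h) = g * τ h * g⁻¹
  α_τ : ∀ h h', α (τ h) h' = h * h' * h⁻¹

/-- The crossed module is a Lie crossed module: `τ` and `(g, h) ↦ α_g(h)` are smooth. -/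
structure CrossedModule.IsLie {G H : Type*} [Group G] [Group H]
    (EG EH : Type*) [NormedAddCommGroup EG] [NormedSpace ℝ EG]
    [NormedAddCommGroup EH] [NormedSpace ℝ EH]
    [TopologicalSpace G] [ChartedSpace EG G] [TopologicalSpace H] [ChartedSpace EH H]
    (C : CrossedModule G H) : Prop where
  smooth_τ : ContMDiff 𝓘(ℝ, EH) 𝓘(ℝ, EG) ∞ C.τ
  smooth_α : ContMDiff (𝓘(ℝ, EG).prod 𝓘(ℝ, EH)) 𝓘(ℝ, EH) ∞ fun p : G × H => C.α p.1 p.2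

/-- The condition `τ(H) = G`. -/
class CrossedModule.TauSurj {G H : Type*} [Group G] [Group H] (C : CrossedModule G H) : Prop where
  surj : Function.Surjective C.τ

/-- The crossed module `(τ(H), H, α, τ)`, whose categorical group is the subcategory of that of
`(G, H, α, τ)` on the objects in `τ(H)` and the morphisms with source in `τ(H)`. -/
def CrossedModule.restrict {G H : Type*} [Group G] [Group H] (C : CrossedModule G H) :
    CrossedModule C.τ.range H where
  τ := C.τ.rangeRestrict
  α := C.α.comp C.τ.range.subtype
  τ_α g h := Subtype.ext (C.τ_α g h)
  α_τ h h' := C.α_τ h h'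

instance {G H : Type*} [Group G] [Group H] (C : CrossedModule G H) : C.restrict.TauSurj :=
  ⟨C.τ.rangeRestrict_surjective⟩

section Quotients

variable {G H J : Type*} [Group G] [Group H] [Group J]
variable (C : CrossedModule G H) (C' : CrossedModule H J)

/-- The subgroup `ττ'(J)` of `G`. -/
def tauJ : Subgroup G := (C.τ.comp C'.τ).range

lemma conj_mem_range (h x : H) (hx : x ∈ C'.τ.range) : h * x * h⁻¹ ∈ C'.τ.range := by
  obtain ⟨j, rfl⟩ := hx
  exact ⟨C'.α h j, C'.τ_α h j⟩

/-- The subgroup `J_H = {(τ'(j), ττ'(j'))}` of `H ⋊ G`. -/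
def JH : Subgroup (H ⋊[C.α] G) where
  carrier := {p | p.left ∈ C'.τ.range ∧ p.right ∈ tauJ C C'}
  one_mem' := ⟨one_mem _, one_mem _⟩
  mul_mem' := by
    rintro ⟨x, _⟩ ⟨y, _⟩ ⟨hx, j, rfl⟩ ⟨hy, j', rfl⟩
    refine ⟨?_, mul_mem ⟨j, rfl⟩ ⟨j', rfl⟩⟩
    refine mul_mem hx ?_
    simp only [MonoidHom.comp_apply, C.α_τ]
    exact conj_mem_range C' _ _ hy
  inv_mem' := by
    rintro ⟨x, _⟩ ⟨hx, j, rfl⟩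
    refine ⟨?_, inv_mem ⟨j, rfl⟩⟩
    simp only [SemidirectProduct.inv_left, MonoidHom.comp_apply, ← map_inv C.τ, C.α_τ]
    exact conj_mem_range C' _ _ (inv_mem hx)

instance tauJ_normal [hC : C.TauSurj] : (tauJ C C').Normal := by
  refine ⟨?_⟩
  rintro _ ⟨j, rfl⟩ g
  obtain ⟨h, rfl⟩ := hC.surj g
  exact ⟨C'.α h j, by simp [C'.τ_α]⟩

instance JH_normal [hC : C.TauSurj] : (JH C C').Normal := by
  refine ⟨?_⟩
  rintro ⟨x, _⟩ ⟨hx, j, rfl⟩ ⟨h, g⟩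
  obtain ⟨h₀, rfl⟩ := hC.surj g
  refine ⟨?_, (tauJ_normal C C').conj_mem _ ⟨j, rfl⟩ _⟩
  have e : (⟨h, C.τ h₀⟩ * ⟨x, (C.τ.comp C'.τ) j⟩ * (⟨h, C.τ h₀⟩ : H ⋊[C.α] G)⁻¹).left =
      ((h * h₀) * x * (h * h₀)⁻¹) * ((h * h₀) * C'.τ j * (h * h₀)⁻¹) *
        (h₀ * (C'.τ j)⁻¹ * h₀⁻¹) := by
    simp only [SemidirectProduct.mul_left, SemidirectProduct.mul_right,
      SemidirectProduct.inv_left, MonoidHom.comp_apply, map_mul, MulAut.mul_apply,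
      ← map_inv C.τ, C.α_τ]
    group
  rw [e]
  exact mul_mem (mul_mem (conj_mem_range C' _ _ hx) (conj_mem_range C' _ _ ⟨j, rfl⟩))
    (conj_mem_range C' _ _ (inv_mem ⟨j, rfl⟩))

/-- The object group `G / ττ'(J)`. -/
def GBar := G ⧸ tauJ C C'

/-- The morphism group `(H ⋊ G) / J_H`. -/
def MorBar := (H ⋊[C.α] G) ⧸ JH C C'

instance [TopologicalSpace G] : TopologicalSpace (GBar C C') :=
  inferInstanceAs (TopologicalSpace (G ⧸ tauJ C C'))

variable [C.TauSurj]

instance : Group (GBar C C') := inferInstanceAs (Group (G ⧸ tauJ C C'))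

instance : Group (MorBar C C') := inferInstanceAs (Group ((H ⋊[C.α] G) ⧸ JH C C'))

/-- The quotient map on objects. -/
def toGBar : G →* GBar C C' := QuotientGroup.mk' (tauJ C C')

/-- The quotient map on morphisms. -/
def toMorBar : H ⋊[C.α] G →* MorBar C C' := QuotientGroup.mk' (JH C C')

lemma toMorBar_surj : Function.Surjective (toMorBar C C') := QuotientGroup.mk'_surjective _

lemma toGBar_eq_one {g : G} : toGBar C C' g = 1 ↔ g ∈ tauJ C C' := QuotientGroup.eq_one_iff g

lemma toMorBar_eq_one {p : H ⋊[C.α] G} : toMorBar C C' p = 1 ↔ p ∈ JH C C' :=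
  QuotientGroup.eq_one_iff p

/-- The target map `(h, g) ↦ τ(h) g` of the categorical group of a crossed module. -/
def targetHom : H ⋊[C.α] G →* G where
  toFun p := C.τ p.left * p.right
  map_one' := by simp
  map_mul' p q := by simp [C.τ_α, mul_assoc]

/-- The source map, induced by `(h, g) ↦ g`. -/
def srcBar : MorBar C C' →* GBar C C' :=
  QuotientGroup.map (JH C C') (tauJ C C') SemidirectProduct.rightHom fun _ hp => hp.2

/-- The target map, induced by `(h, g) ↦ τ(h) g`. -/
def tgtBar : MorBar C C' →* GBar C C' :=
  QuotientGroup.map (JH C C') (tauJ C C') (targetHom C) fun p hp => by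
    obtain ⟨⟨j, hj⟩, hp2⟩ := hp
    exact mul_mem (show C.τ p.left ∈ tauJ C C' from ⟨j, by simp [hj]⟩) hp2

/-- The identity morphisms, induced by `g ↦ (e, g)`. -/
def idBar : GBar C C' →* MorBar C C' :=
  QuotientGroup.map (tauJ C C') (JH C C') SemidirectProduct.inr fun _ hg => ⟨one_mem _, hg⟩

@[simp] lemma srcBar_mk (p : H ⋊[C.α] G) :
    srcBar C C' (toMorBar C C' p) = toGBar C C' p.right := rfl

@[simp] lemma tgtBar_mk (p : H ⋊[C.α] G) :
    tgtBar C C' (toMorBar C C' p) = toGBar C C' (C.τ p.left * p.right) := rfl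

@[simp] lemma idBar_mk (g : G) : idBar C C' (toGBar C C' g) = toMorBar C C' ⟨1, g⟩ := rfl

lemma toGBar_surj : Function.Surjective (toGBar C C') := QuotientGroup.mk'_surjective _

@[simp] lemma srcBar_idBar (x : GBar C C') : srcBar C C' (idBar C C' x) = x := by
  obtain ⟨g, rfl⟩ := toGBar_surj C C' x
  rfl

@[simp] lemma tgtBar_idBar (x : GBar C C') : tgtBar C C' (idBar C C' x) = x := by
  obtain ⟨g, rfl⟩ := toGBar_surj C C' x
  simp

/-- The composition `φ₂ ∘ φ₁` (used when the source of `φ₂` is the target of `φ₁`). By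
`compBar_mk` it is the composition induced by `(h₂, g₂) ∘ (h₁, g₁) = (h₂ h₁, g₁)`. -/
def compBar (φ₂ φ₁ : MorBar C C') : MorBar C C' := φ₂ * (idBar C C' (srcBar C C' φ₂))⁻¹ * φ₁

/-- If `(h₂, g₂)` and `(h₁, g₁)` are composable, then the composition of their classes is the
class of `(h₂ h₁, g₁)`. -/
lemma compBar_mk (h₁ h₂ : H) (g₁ g₂ : G) (_ : g₂ = C.τ h₁ * g₁) :
    compBar C C' (toMorBar C C' ⟨h₂, g₂⟩) (toMorBar C C' ⟨h₁, g₁⟩) =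
      toMorBar C C' ⟨h₂ * h₁, g₁⟩ := by
  simp only [compBar, srcBar_mk, idBar_mk, ← map_inv, ← map_mul]
  congr 1
  ext <;> simp

/-- Two composable classes have composable representatives. -/
lemma exists_composable (φ₂ φ₁ : MorBar C C') (hs : srcBar C C' φ₂ = tgtBar C C' φ₁) :
    ∃ (h₁ h₂ : H) (g₁ g₂ : G), g₂ = C.τ h₁ * g₁ ∧ toMorBar C C' ⟨h₁, g₁⟩ = φ₁ ∧
      toMorBar C C' ⟨h₂, g₂⟩ = φ₂ := by
  obtain ⟨⟨h₁, g₁⟩, rfl⟩ := toMorBar_surj C C' φ₁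
  obtain ⟨⟨h₂, g₂⟩, rfl⟩ := toMorBar_surj C C' φ₂
  refine ⟨h₁, h₂, g₁, C.τ h₁ * g₁, rfl, rfl, ?_⟩
  rw [srcBar_mk, tgtBar_mk, eq_comm, ← inv_mul_eq_one, ← map_inv, ← map_mul,
    toGBar_eq_one] at hs
  rw [← inv_mul_eq_one, ← map_inv, ← map_mul, toMorBar_eq_one]
  refine ⟨?_, hs⟩
  simp

lemma srcBar_compBar {φ₂ φ₁ : MorBar C C'} :
    srcBar C C' (compBar C C' φ₂ φ₁) = srcBar C C' φ₁ := by
  simp [compBar]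

lemma tgtBar_compBar {φ₂ φ₁ : MorBar C C'} (h : srcBar C C' φ₂ = tgtBar C C' φ₁) :
    tgtBar C C' (compBar C C' φ₂ φ₁) = tgtBar C C' φ₂ := by
  simp [compBar, h]

lemma compBar_assoc (φ₃ φ₂ φ₁ : MorBar C C') :
    compBar C C' φ₃ (compBar C C' φ₂ φ₁) = compBar C C' (compBar C C' φ₃ φ₂) φ₁ := by
  rw [compBar, compBar, compBar, srcBar_compBar, compBar]
  simp only [mul_assoc]

lemma idBar_comp {φ : MorBar C C'} {x : GBar C C'} : compBar C C' (idBar C C' x) φ = φ := by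
  simp [compBar]

lemma comp_idBar {φ : MorBar C C'} {x : GBar C C'} (h : srcBar C C' φ = x) :
    compBar C C' φ (idBar C C' x) = φ := by
  simp [compBar, h]

/-- Morphisms with trivial source commute with morphisms with trivial target. -/
lemma ker_commute {x y : MorBar C C'} (hx : srcBar C C' x = 1) (hy : tgtBar C C' y = 1) :
    x * y = y * x := by
  obtain ⟨⟨h, g⟩, rfl⟩ := toMorBar_surj C C' x
  obtain ⟨⟨h', g'⟩, rfl⟩ := toMorBar_surj C C' y
  rw [srcBar_mk, toGBar_eq_one] at hx
  rw [tgtBar_mk, toGBar_eq_one] at hy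
  have e1 : toMorBar C C' ⟨h, g⟩ = toMorBar C C' ⟨h, 1⟩ := by
    rw [eq_comm, ← inv_mul_eq_one, ← map_inv, ← map_mul, toMorBar_eq_one]
    exact ⟨by simp, by simpa using hx⟩
  have e2 : toMorBar C C' ⟨h', g'⟩ = toMorBar C C' ⟨h', C.τ h'⁻¹⟩ := by
    rw [eq_comm, ← inv_mul_eq_one, ← map_inv, ← map_mul, toMorBar_eq_one]
    exact ⟨by simp, by simpa using hy⟩
  rw [e1, e2, ← map_mul, ← map_mul]
  congr 1
  ext
  · simp only [SemidirectProduct.mul_left, C.α_τ, map_one, MulAut.one_apply]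
    group
  · simp

/-- The interchange law. -/
lemma compBar_mul {φ₂ φ₁ : MorBar C C'} (ψ₂ ψ₁ : MorBar C C')
    (h : srcBar C C' φ₂ = tgtBar C C' φ₁) :
    compBar C C' (φ₂ * ψ₂) (φ₁ * ψ₁) = compBar C C' φ₂ φ₁ * compBar C C' ψ₂ ψ₁ := by
  have hk := ker_commute C C' (x := ψ₂ * (idBar C C' (srcBar C C' ψ₂))⁻¹)
    (y := (idBar C C' (srcBar C C' φ₂))⁻¹ * φ₁) (by simp) (by simp [h])
  simp only [compBar, map_mul, mul_inv_rev]
  calc φ₂ * ψ₂ * ((idBar C C' (srcBar C C' ψ₂))⁻¹ * (idBar C C' (srcBar C C' φ₂))⁻¹) * (φ₁ * ψ₁)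
      = φ₂ * ((ψ₂ * (idBar C C' (srcBar C C' ψ₂))⁻¹) *
          ((idBar C C' (srcBar C C' φ₂))⁻¹ * φ₁)) * ψ₁ := by simp only [mul_assoc]
    _ = _ := by rw [hk]; simp only [mul_assoc]

instance : Category (GBar C C') where
  Hom a b := {φ : MorBar C C' // srcBar C C' φ = a ∧ tgtBar C C' φ = b}
  id a := ⟨idBar C C' a, by simp, by simp⟩
  comp f g := ⟨compBar C C' g.1 f.1, (srcBar_compBar C C').trans f.2.1,
    (tgtBar_compBar C C' (g.2.1.trans f.2.2.symm)).trans g.2.2⟩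
  id_comp f := Subtype.ext (comp_idBar C C' f.2.1)
  comp_id f := Subtype.ext (idBar_comp C C')
  assoc f g h := Subtype.ext (compBar_assoc C C' h.1 g.1 f.1)

/-- An element of `(H ⋊ G) / J_H`, as a morphism of the category. -/
def barMor (φ : MorBar C C') : Mor (GBar C C') := ⟨srcBar C C' φ, tgtBar C C' φ, ⟨φ, rfl, rfl⟩⟩

/-- The morphisms of the category are the elements of `(H ⋊ G) / J_H`. -/
def morEquiv : Mor (GBar C C') ≃ MorBar C C' where
  toFun f := f.hom.1
  invFun := barMor C C'
  left_inv := by rintro ⟨_, _, ⟨φ, rfl, rfl⟩⟩; rfl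
  right_inv _ := rfl

instance : CategoricalGroup (GBar C C') where
  morGroup := (morEquiv C C').group
  mulFunctor :=
    { obj := fun p => p.1 * p.2
      map := fun f => ⟨f.1.1 * f.2.1, by rw [map_mul, f.1.2.1, f.2.2.1],
        by rw [map_mul, f.1.2.2, f.2.2.2]⟩
      map_id := fun p => Subtype.ext (map_mul (idBar C C') p.1 p.2).symm
      map_comp := fun f g =>
        Subtype.ext (compBar_mul C C' g.2.1 f.2.1 (g.1.2.1.trans f.1.2.2.symm)).symm }
  mulFunctor_obj _ _ := rfl
  mulFunctor_mor f g := (morEquiv C C').injective (by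
    rw [Equiv.mul_def, Equiv.apply_symm_apply]; rfl)

end Quotients

/-! ### Gerbal cocycles and their functorial form -/

section Cocycles

variable {G H J : Type*} [Group G] [Group H] [Group J]
variable {EB : Type*} [NormedAddCommGroup EB] [NormedSpace ℝ EB]
variable {B : Type*} [TopologicalSpace B] [ChartedSpace EB B] {ι : Type*}

/-- The relation of a gerbal cocycle for the crossed module `(H, J, α', τ')` and the open cover
`U`. The functions `h i k` and `j i k m` are only used on `U_i ∩ U_k` and `U_i ∩ U_k ∩ U_m`; their
values elsewhere are irrelevant. -/
structure GerbalCocycle (C' : CrossedModule H J) (U : ι → TopologicalSpace.Opens B) where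
  h : ι → ι → B → H
  j : ι → ι → ι → B → J
  rel : ∀ i k m u, u ∈ U i → u ∈ U k → u ∈ U m →
    h i m u = C'.τ (j i k m u) * h i k u * h k m u

/-- The functions of the gerbal cocycle are smooth where they are used. -/
structure GerbalCocycle.Smooth {C' : CrossedModule H J} {U : ι → TopologicalSpace.Opens B}
    (c : GerbalCocycle C' U) (EB EH EJ : Type*) [NormedAddCommGroup EB] [NormedSpace ℝ EB]
    [NormedAddCommGroup EH] [NormedSpace ℝ EH] [NormedAddCommGroup EJ] [NormedSpace ℝ EJ]
    [ChartedSpace EB B] [TopologicalSpace H] [ChartedSpace EH H]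
    [TopologicalSpace J] [ChartedSpace EJ J] : Prop where
  smooth_h : ∀ i k, ContMDiffOn 𝓘(ℝ, EB) 𝓘(ℝ, EH) ∞ (c.h i k) (U i ∩ U k : Set B)
  smooth_j : ∀ i k m, ContMDiffOn 𝓘(ℝ, EB) 𝓘(ℝ, EJ) ∞ (c.j i k m) (U i ∩ U k ∩ U m : Set B)

/-- The intersection `U_I`. -/
def UI (U : ι → TopologicalSpace.Opens B) (I : Finset ι) : Set B := {u | ∀ i ∈ I, u ∈ U i}

variable (C : CrossedModule G H) {C' : CrossedModule H J} [C.TauSurj]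
variable {U : ι → TopologicalSpace.Opens B} (c : GerbalCocycle C' U)

lemma GerbalCocycle.h_self (i : ι) (u : B) (hu : u ∈ U i) : c.h i i u ∈ C'.τ.range := by
  have h1 := c.rel i i i u hu hu hu
  have h2 : c.h i i u = (C'.τ (c.j i i i u))⁻¹ := by
    have h3 : C'.τ (c.j i i i u) * c.h i i u = 1 := mul_eq_right.mp h1.symm
    exact eq_inv_of_mul_eq_one_right h3
  rw [h2]
  exact inv_mem ⟨_, rfl⟩

/-- The class of `g_{ik}(u) = τ(h_{ik}(u))` in `G / ττ'(J)`. -/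
def gBar (i k : ι) (u : B) : GBar C C' := toGBar C C' (C.τ (c.h i k u))

/-- The class of `θ_{ik}(γ) = (h_{ik}(γ₁) h_{ik}(γ₀)⁻¹, g_{ik}(γ₀))` in `(H ⋊ G) / J_H`, for
a path `γ` from `γ₀` to `γ₁`. -/
def thetaBar (i k : ι) (γ : PSPath EB B) : MorBar C C' :=
  toMorBar C C' ⟨c.h i k γ.tgt * (c.h i k γ.src)⁻¹, C.τ (c.h i k γ.src)⟩

lemma gBar_mul {i k m : ι} {u : B} (hi : u ∈ U i) (hk : u ∈ U k) (hm : u ∈ U m) :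
    gBar C c i k u * gBar C c k m u = gBar C c i m u := by
  have h1 : toGBar C C' (C.τ (C'.τ (c.j i k m u))) = 1 := (toGBar_eq_one C C').mpr ⟨_, rfl⟩
  rw [gBar, gBar, gBar, c.rel i k m u hi hk hm, map_mul, map_mul, map_mul, map_mul, h1, one_mul]

lemma gBar_self {i : ι} {u : B} (hi : u ∈ U i) : gBar C c i i u = 1 :=
  mul_eq_left.mp (gBar_mul C c hi hi hi)

lemma thetaBar_self {i : ι} {γ : PSPath EB B} (hγ : γ.Inside (U i)) : thetaBar C c i i γ = 1 := by
  obtain ⟨j, hj⟩ := c.h_self i γ.src (hγ _)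
  refine (toMorBar_eq_one C C').mpr ⟨mul_mem (c.h_self i _ (hγ _)) (inv_mem ⟨j, hj⟩), ⟨j, ?_⟩⟩
  simp [hj]

lemma thetaBar_const {i k : ι} {u : B} :
    thetaBar C c i k (PSPath.const u : PSPath EB B) = idBar C C' (gBar C c i k u) := by
  simp [thetaBar, gBar]

/-! ### The object set of the bundle -/

/-- The disjoint union of the sets `{i} × U_i × Ḡ`. -/
abbrev PreObj (_ : GerbalCocycle C' U) := Σ i : ι, (U i) × GBar C C'

/-- `(i, u, g)` and `(j, v, g')` are equivalent if `v = u` and `g' = ḡ_{ji}(u) g`. -/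
instance objSetoid : Setoid (PreObj C c) where
  r p q := q.2.1.1 = p.2.1.1 ∧ q.2.2 = gBar C c q.1 p.1 p.2.1.1 * p.2.2
  iseqv :=
    { refl := fun p => ⟨rfl, by rw [gBar_self C c p.2.1.2, one_mul]⟩
      symm := by
        rintro ⟨i, ⟨u, hu⟩, g⟩ ⟨j, ⟨v, hv⟩, g'⟩ ⟨h1, h2⟩
        dsimp only at h1 h2 ⊢
        subst h1
        refine ⟨rfl, ?_⟩
        rw [h2, ← mul_assoc, gBar_mul C c hu hv hu, gBar_self C c hu, one_mul]
      trans := by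
        rintro ⟨i, ⟨u, hu⟩, g⟩ ⟨j, ⟨v, hv⟩, g'⟩ ⟨k, ⟨w, hw⟩, g''⟩ ⟨h1, h2⟩ ⟨h3, h4⟩
        dsimp only at h1 h2 h3 h4 ⊢
        subst h1
        subst h3
        refine ⟨rfl, ?_⟩
        rw [h4, h2, ← mul_assoc, gBar_mul C c hw hv hu] }

/-- The object set of the bundle. -/
def TotalObj := Quotient (objSetoid C c)

instance [TopologicalSpace G] : TopologicalSpace (TotalObj C c) :=
  inferInstanceAs (TopologicalSpace (Quotient (objSetoid C c)))

/-- The point `[i, u, g]`. -/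
def pt (i : ι) (p : (U i) × GBar C C') : TotalObj C c := Quotient.mk (objSetoid C c) ⟨i, p⟩

lemma pt_eq {i k : ι} {u : B} (hi : u ∈ U i) (hk : u ∈ U k) (g : GBar C C') :
    pt C c i (⟨u, hi⟩, g) = pt C c k (⟨u, hk⟩, gBar C c k i u * g) :=
  Quotient.sound ⟨rfl, rfl⟩

/-! ### The quiver of decorated local paths -/

variable (EB) in
/-- An edge: a quadruple `(i, I, γ, φ)` with `i ∈ I`, a path `γ` inside `U_I` and a morphism `φ`. -/
structure Edge (_ : GerbalCocycle C' U) where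
  i : ι
  I : Finset ι
  mem : i ∈ I
  γ : PSPath EB B
  inside : γ.Inside (UI U I)
  φ : MorBar C C'

variable {C c}

lemma Edge.src_mem (e : Edge EB C c) : e.γ.src ∈ U e.i := e.inside _ _ e.mem

lemma Edge.tgt_mem (e : Edge EB C c) : e.γ.tgt ∈ U e.i := e.inside _ _ e.mem

/-- The source `[i, s(γ), s(φ)]` of an edge. -/
def Edge.src (e : Edge EB C c) : TotalObj C c :=
  pt C c e.i (⟨e.γ.src, e.src_mem⟩, srcBar C C' e.φ)

/-- The target `[i, t(γ), t(φ)]` of an edge. -/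
def Edge.tgt (e : Edge EB C c) : TotalObj C c :=
  pt C c e.i (⟨e.γ.tgt, e.tgt_mem⟩, tgtBar C C' e.φ)

variable (EB C c)

/-- The vertex set of the quiver of decorated local paths. -/
def TotalQuiver (_EB : Type*) (C : CrossedModule G H) [C.TauSurj] (c : GerbalCocycle C' U) :=
  TotalObj C c

instance : Quiver (TotalQuiver EB C c) where
  Hom x y := {e : Edge EB C c // e.src = x ∧ e.tgt = y}

end Cocycles

/-! ### The quiver algebra -/

section QuiverAlgebra

/-- The non-identity morphisms of the free category of a quiver: the nonempty sequences of edges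
in which the target of each edge is the source of the next one. -/
structure NonIdMor (V : Type*) [Quiver V] where
  {src : V}
  {tgt : V}
  path : Quiver.Path src tgt
  pos : 0 < path.length

variable (V : Type*) [Quiver V]

/-- The defining relations of the quiver algebra. -/
inductive QuiverAlgebra.Rel :
    FreeAlgebra ℝ (NonIdMor V) → FreeAlgebra ℝ (NonIdMor V) → Prop
  | concat {x y z : V} (p : Quiver.Path x y) (q : Quiver.Path y z) (hp : 0 < p.length)
      (hq : 0 < q.length) :
      Rel (FreeAlgebra.ι ℝ ⟨p, hp⟩ * FreeAlgebra.ι ℝ ⟨q, hq⟩)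
        (FreeAlgebra.ι ℝ ⟨p.comp q, by rw [Quiver.Path.length_comp]; omega⟩)
  | mismatch (p q : NonIdMor V) (h : p.tgt ≠ q.src) :
      Rel (FreeAlgebra.ι ℝ p * FreeAlgebra.ι ℝ q) 0

/-- The quiver algebra: the free algebra on the non-identity morphisms of the free category, modulo
the relations that a product of two of them is the concatenation if target and source match, and
zero otherwise. (A unit is adjoined; the nonempty paths span a two-sided ideal of this algebra, and
an element of that ideal lies in the same two-sided ideals generated by subsets of it, with or
without the unit.) -/
abbrev QuiverAlgebra := RingQuot (QuiverAlgebra.Rel V)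

variable {V}

/-- A non-identity morphism, as an element of the quiver algebra. -/
def QuiverAlgebra.of (p : NonIdMor V) : QuiverAlgebra V :=
  RingQuot.mkAlgHom ℝ (QuiverAlgebra.Rel V) (FreeAlgebra.ι ℝ p)

lemma QuiverAlgebra.of_mul_of {x y z : V} (p : Quiver.Path x y) (q : Quiver.Path y z)
    (hp : 0 < p.length) (hq : 0 < q.length) :
    QuiverAlgebra.of ⟨p, hp⟩ * QuiverAlgebra.of ⟨q, hq⟩ =
      QuiverAlgebra.of ⟨p.comp q, by rw [Quiver.Path.length_comp]; omega⟩ := by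
  rw [of, of, of, ← map_mul]
  exact RingQuot.mkAlgHom_rel ℝ (QuiverAlgebra.Rel.concat p q hp hq)

end QuiverAlgebra

/-! ### The bundle category -/

section Total

variable {G H J : Type*} [Group G] [Group H] [Group J]
variable {EB : Type*} [NormedAddCommGroup EB] [NormedSpace ℝ EB]
variable {B : Type*} [TopologicalSpace B] [ChartedSpace EB B] {ι : Type*}
variable {C : CrossedModule G H} {C' : CrossedModule H J} [C.TauSurj]
variable {U : ι → TopologicalSpace.Opens B} {c : GerbalCocycle C' U}

/-- An edge, as an arrow of the quiver. -/
def Edge.arrow (e : Edge EB C c) :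
    (show TotalQuiver EB C c from e.src) ⟶ (show TotalQuiver EB C c from e.tgt) := ⟨e, rfl, rfl⟩

/-- An edge, as a non-identity morphism of the free category. -/
def Edge.single (e : Edge EB C c) : NonIdMor (TotalQuiver EB C c) :=
  ⟨e.arrow.toPath, Nat.one_pos⟩

variable (EB C c)

/-- The generators `(i, I, γ, φ) - (j, J, γ, θ̄_{ji}(γ) φ)`. -/
def gensN₀ : Set (QuiverAlgebra (TotalQuiver EB C c)) :=
  {x | ∃ e e' : Edge EB C c, e'.γ = e.γ ∧ e'.φ = thetaBar C c e'.i e.i e.γ * e.φ ∧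
    x = QuiverAlgebra.of e.single - QuiverAlgebra.of e'.single}

/-- The generators `(k, K, γ_k, φ_k) - (i, I, γ_i, φ_i) · (j, J, γ_j, φ_j)`, where `K ⊆ I ∩ J`,
`γ_k = γ_j ∘ γ_i` and `φ_k = (θ̄_{kj}(γ_j) φ_j) ∘ (θ̄_{ki}(γ_i) φ_i)`. -/
def gensN₁ : Set (QuiverAlgebra (TotalQuiver EB C c)) :=
  {x | ∃ ei ej ek : Edge EB C c, ek.I ⊆ ei.I ∧ ek.I ⊆ ej.I ∧
    (∃ h : ei.γ.tgt = ej.γ.src, ek.γ = ei.γ.concat ej.γ h) ∧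
    srcBar C C' (thetaBar C c ek.i ej.i ej.γ * ej.φ) =
      tgtBar C C' (thetaBar C c ek.i ei.i ei.γ * ei.φ) ∧
    ek.φ = compBar C C' (thetaBar C c ek.i ej.i ej.γ * ej.φ)
      (thetaBar C c ek.i ei.i ei.γ * ei.φ) ∧
    x = QuiverAlgebra.of ek.single - QuiverAlgebra.of ei.single * QuiverAlgebra.of ej.single}

/-- The ideal `N` of the quiver algebra. -/
def idealN : TwoSidedIdeal (QuiverAlgebra (TotalQuiver EB C c)) :=
  TwoSidedIdeal.span (gensN₀ EB C c ∪ gensN₁ EB C c)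

/-- The quotient of the quiver algebra by `N`. -/
abbrev QuotAlgebra := (idealN EB C c).ringCon.Quotient

variable {EB C c}

/-- The class of a non-identity morphism of the free category in the quotient algebra. -/
def cls (p : NonIdMor (TotalQuiver EB C c)) : QuotAlgebra EB C c :=
  (idealN EB C c).ringCon.mk' (QuiverAlgebra.of p)

lemma cls_mul {x y z : TotalQuiver EB C c} (p : Quiver.Path x y) (q : Quiver.Path y z)
    (hp : 0 < p.length) (hq : 0 < q.length) :
    cls ⟨p, hp⟩ * cls ⟨q, hq⟩ = cls ⟨p.comp q, by rw [Quiver.Path.length_comp]; omega⟩ := by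
  rw [cls, cls, cls, ← map_mul, QuiverAlgebra.of_mul_of]

lemma cls_eq_of_N₀ {e e' : Edge EB C c} (hγ : e'.γ = e.γ)
    (hφ : e'.φ = thetaBar C c e'.i e.i e.γ * e.φ) : cls e.single = cls e'.single := by
  refine (RingCon.eq _).mpr ((TwoSidedIdeal.rel_iff _ _ _).mpr ?_)
  exact TwoSidedIdeal.subset_span (Or.inl ⟨e, e', hγ, hφ, rfl⟩)

lemma cls_eq_of_N₁ {ei ej ek : Edge EB C c} (hI : ek.I ⊆ ei.I) (hJ : ek.I ⊆ ej.I)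
    (h : ei.γ.tgt = ej.γ.src) (hγ : ek.γ = ei.γ.concat ej.γ h)
    (hst : srcBar C C' (thetaBar C c ek.i ej.i ej.γ * ej.φ) =
      tgtBar C C' (thetaBar C c ek.i ei.i ei.γ * ei.φ))
    (hφ : ek.φ = compBar C C' (thetaBar C c ek.i ej.i ej.γ * ej.φ)
      (thetaBar C c ek.i ei.i ei.γ * ei.φ)) :
    cls ek.single = cls ei.single * cls ej.single := by
  rw [cls, cls, cls, ← map_mul]
  refine (RingCon.eq _).mpr ((TwoSidedIdeal.rel_iff _ _ _).mpr ?_)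
  exact TwoSidedIdeal.subset_span (Or.inr ⟨ei, ej, ek, hI, hJ, ⟨h, hγ⟩, hst, hφ, rfl⟩)

/-- The edge `(i, I, 1_u, 1_g)`. -/
def idEdge (i : ι) (I : Finset ι) (hi : i ∈ I) (u : B) (hu : u ∈ UI U I) (g : GBar C C') :
    Edge EB C c where
  i := i
  I := I
  mem := hi
  γ := PSPath.const u
  inside := fun _ => hu
  φ := idBar C C' g

lemma idEdge_src (i : ι) (I : Finset ι) (hi : i ∈ I) (u : B) (hu : u ∈ UI U I) (g : GBar C C') :
    (idEdge i I hi u hu g : Edge EB C c).src = pt C c i (⟨u, hu i hi⟩, g) := by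
  simp [Edge.src, idEdge]

lemma idEdge_tgt (i : ι) (I : Finset ι) (hi : i ∈ I) (u : B) (hu : u ∈ UI U I) (g : GBar C C') :
    (idEdge i I hi u hu g : Edge EB C c).tgt = pt C c i (⟨u, hu i hi⟩, g) := by
  simp [Edge.tgt, idEdge]

lemma idEdge_cls {i k : ι} {I K : Finset ι} (hi : i ∈ I) (hk : k ∈ K) {u : B} (hu : u ∈ UI U I)
    (hu' : u ∈ UI U K) (g : GBar C C') :
    cls (idEdge i I hi u hu g : Edge EB C c).single =
      cls (idEdge k K hk u hu' (gBar C c k i u * g) : Edge EB C c).single := by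
  refine cls_eq_of_N₀ rfl ?_
  simp only [idEdge]
  rw [thetaBar_const, map_mul]

lemma mem_UI_singleton {i : ι} {u : B} (hu : u ∈ U i) : u ∈ UI U {i} := by
  intro k hk
  rw [Finset.mem_singleton] at hk
  exact hk ▸ hu

variable (EB C c)

/-- The class of the edges `(i, I, 1_u, 1_g)` with `x = [i, u, g]`. -/
def idCls (x : TotalObj C c) : QuotAlgebra EB C c :=
  Quotient.liftOn x (fun p => cls (idEdge p.1 {p.1} (Finset.mem_singleton_self _) p.2.1.1
    (mem_UI_singleton p.2.1.2) p.2.2 : Edge EB C c).single) (by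
      rintro ⟨i, ⟨u, hu⟩, g⟩ ⟨k, ⟨v, hv⟩, g'⟩ ⟨h1, h2⟩
      dsimp only at h1 h2 ⊢
      subst h1
      subst h2
      exact idEdge_cls _ _ _ _ _)

variable {EB C c}

lemma idCls_pt {i : ι} {I : Finset ι} (hi : i ∈ I) {u : B} (hu : u ∈ UI U I) (g : GBar C C') :
    idCls EB C c (pt C c i (⟨u, hu i hi⟩, g)) =
      cls (idEdge i I hi u hu g : Edge EB C c).single := by
  refine (idEdge_cls (Finset.mem_singleton_self i) hi (mem_UI_singleton (hu i hi)) hu g).trans ?_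
  rw [gBar_self C c (hu i hi), one_mul]

lemma cls_toPath {x y : TotalQuiver EB C c} (a : x ⟶ y) (h : 0 < a.toPath.length) :
    cls ⟨a.toPath, h⟩ = cls a.1.single := by
  obtain ⟨e, rfl, rfl⟩ := a
  rfl

lemma exists_idCls (x : TotalObj C c) :
    ∃ (p : Quiver.Path (show TotalQuiver EB C c from x) (show TotalQuiver EB C c from x))
      (hp : 0 < p.length), cls ⟨p, hp⟩ = idCls EB C c x := by
  obtain ⟨⟨i, ⟨u, hu⟩, g⟩, rfl⟩ := Quotient.exists_rep x
  let e : Edge EB C c := idEdge i {i} (Finset.mem_singleton_self i) u (mem_UI_singleton hu) g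
  let a : (show TotalQuiver EB C c from pt C c i (⟨u, hu⟩, g)) ⟶
      (show TotalQuiver EB C c from pt C c i (⟨u, hu⟩, g)) :=
    ⟨e, idEdge_src _ _ _ _ _ _, idEdge_tgt _ _ _ _ _ _⟩
  exact ⟨a.toPath, Nat.one_pos, cls_toPath a Nat.one_pos⟩

lemma idCls_mul_single (e : Edge EB C c) : idCls EB C c e.src * cls e.single = cls e.single := by
  have h1 : idCls EB C c e.src = _ := idCls_pt e.mem (e.inside 0) (srcBar C C' e.φ)
  have hθ : thetaBar C c e.i e.i e.γ = 1 := thetaBar_self C c fun t => e.inside t _ e.mem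
  have hθ' : thetaBar C c e.i e.i (PSPath.const (e.γ.toFun 0) : PSPath EB B) = 1 :=
    thetaBar_self C c fun _ => e.inside 0 _ e.mem
  rw [h1]
  refine (cls_eq_of_N₁ (ei := idEdge e.i e.I e.mem _ (e.inside 0) (srcBar C C' e.φ))
    (ej := e) (ek := e) (fun _ h => h) (fun _ h => h) rfl
    (PSPath.const_concat _ e.γ rfl).symm ?_ ?_).symm
  · simp [idEdge, hθ, hθ']
  · simp only [idEdge, hθ, hθ', one_mul]
    exact (comp_idBar C C' rfl).symm

lemma single_mul_idCls (e : Edge EB C c) : cls e.single * idCls EB C c e.tgt = cls e.single := by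
  have h1 : idCls EB C c e.tgt = _ := idCls_pt e.mem (e.inside e.γ.len) (tgtBar C C' e.φ)
  have hθ : thetaBar C c e.i e.i e.γ = 1 := thetaBar_self C c fun t => e.inside t _ e.mem
  have hθ' : thetaBar C c e.i e.i (PSPath.const (e.γ.toFun e.γ.len) : PSPath EB B) = 1 :=
    thetaBar_self C c fun _ => e.inside _ _ e.mem
  rw [h1]
  refine (cls_eq_of_N₁ (ei := e)
    (ej := idEdge e.i e.I e.mem _ (e.inside e.γ.len) (tgtBar C C' e.φ)) (ek := e)
    (fun _ h => h) (fun _ h => h) rfl (PSPath.concat_const _ e.γ rfl).symm ?_ ?_).symm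
  · simp [idEdge, hθ, hθ']
  · simp only [idEdge, hθ, hθ', one_mul]
    exact (idBar_comp C C').symm

lemma idCls_mul {x y : TotalQuiver EB C c} (p : Quiver.Path x y) (hp : 0 < p.length) :
    idCls EB C c x * cls ⟨p, hp⟩ = cls ⟨p, hp⟩ := by
  induction p with
  | nil => exact absurd hp (lt_irrefl _)
  | @cons y z q a ih =>
    by_cases hq : 0 < q.length
    · have h1 := cls_mul q a.toPath hq Nat.one_pos
      have h2 : cls ⟨q.cons a, hp⟩ = cls ⟨q, hq⟩ * cls ⟨a.toPath, Nat.one_pos⟩ := h1.symm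
      rw [h2, ← mul_assoc, ih hq]
    · cases q with
      | nil =>
        obtain ⟨e, rfl, rfl⟩ := a
        exact idCls_mul_single e
      | cons q b => exact absurd (Nat.succ_pos _) hq

lemma mul_idCls {x y : TotalQuiver EB C c} (p : Quiver.Path x y) (hp : 0 < p.length) :
    cls ⟨p, hp⟩ * idCls EB C c y = cls ⟨p, hp⟩ := by
  cases p with
  | nil => exact absurd hp (lt_irrefl _)
  | cons q a =>
    obtain ⟨e, rfl, rfl⟩ := a
    have h0 : cls e.single * idCls EB C c e.tgt = cls e.single := single_mul_idCls e
    by_cases hq : 0 < q.length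
    · have h1 := cls_mul q e.arrow.toPath hq Nat.one_pos
      have h2 : cls ⟨q.cons ⟨e, rfl, rfl⟩, hp⟩ = cls ⟨q, hq⟩ * cls e.single := h1.symm
      rw [h2, mul_assoc, h0]
    · cases q with
      | nil => exact h0
      | cons q b => exact absurd (Nat.succ_pos _) hq

variable (EB C c)

/-- The bundle category. Its objects are the points `[i, u, g]`. Its morphisms from `x` to `y` are
the classes, in the quotient of the quiver algebra by `N`, of the nonempty sequences of edges that
lead from `x` to `y`; the composition is the multiplication of the quotient algebra; the identity
at `[i, u, g]` is the class of the edge `(i, {i}, 1_u, 1_g)`. -/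
def TotalCat (_EB : Type*) (C : CrossedModule G H) [C.TauSurj] (c : GerbalCocycle C' U) :=
  TotalObj C c

instance : Category (TotalCat EB C c) where
  Hom x y := {a : QuotAlgebra EB C c //
    ∃ (p : Quiver.Path (show TotalQuiver EB C c from x) (show TotalQuiver EB C c from y))
      (hp : 0 < p.length), cls ⟨p, hp⟩ = a}
  id x := ⟨idCls EB C c x, exists_idCls x⟩
  comp f g := ⟨f.1 * g.1, by
    obtain ⟨_, p, hp, rfl⟩ := f
    obtain ⟨_, q, hq, rfl⟩ := g
    exact ⟨p.comp q, by rw [Quiver.Path.length_comp]; omega, (cls_mul p q hp hq).symm⟩⟩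
  id_comp f := by
    obtain ⟨_, p, hp, rfl⟩ := f
    exact Subtype.ext (idCls_mul p hp)
  comp_id f := by
    obtain ⟨_, p, hp, rfl⟩ := f
    exact Subtype.ext (mul_idCls p hp)
  assoc f g h := Subtype.ext (mul_assoc f.1 g.1 h.1)

variable {EB C c}

/-- The morphism `[i, I, γ, φ]` of the bundle category. -/
def edgeMor (e : Edge EB C c) : Mor (TotalCat EB C c) :=
  ⟨e.src, e.tgt, ⟨cls e.single, e.arrow.toPath, Nat.one_pos, rfl⟩⟩

/-! ### The assertions about the bundle category -/

/-- `π` is the projection: `[i, u, g] ↦ u` and `[i, I, γ, φ] ↦ γ`. -/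
def IsProjection (π : TotalCat EB C c ⥤ PathCat EB B) : Prop :=
  (∀ (i : ι) (p : (U i) × GBar C C'), π.obj (pt C c i p) = (p.1 : B)) ∧
  (∀ e : Edge EB C c, onMor π (edgeMor e) = pathMor e.γ)

/-- `act` is the right action: `[i, u, g] · a = [i, u, g a]` and
`[i, I, γ, φ] · ψ = [i, I, γ, φ ψ]`. -/
def IsRightAction (act : TotalCat EB C c × GBar C C' ⥤ TotalCat EB C c) : Prop :=
  (∀ (i : ι) (p : (U i) × GBar C C') (a : GBar C C'),
    act.obj (pt C c i p, a) = pt C c i (p.1, p.2 * a)) ∧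
  (∀ (e : Edge EB C c) (ψ : MorBar C C'),
    onMor act (pairMor (edgeMor e) (barMor C C' ψ)) = edgeMor { e with φ := e.φ * ψ })

/-- A path inside `U_I`, as a morphism of the category of points and paths of `U_I`. -/
def insideMor {S : Set B} (γ : PSPath EB B) (hγ : γ.Inside S) : Mor (pathSub EB S).Carrier :=
  ⟨⟨γ.src, hγ _⟩, ⟨γ.tgt, hγ _⟩, ⟨⟨γ, rfl, rfl⟩, hγ⟩⟩

/-- Local triviality. For every finite `I` and `i ∈ I`, the formulas `(u, g) ↦ [i, u, g]` and
`(γ, φ) ↦ [i, I, γ, φ]` define an isomorphism of categories from the product of `U_I` and `Ḡ` onto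
the subcategory of the objects over `U_I` and the morphisms over paths inside `U_I`; it respects the
projections and the actions. -/
def IsLocallyTrivial (π : TotalCat EB C c ⥤ PathCat EB B)
    (act : TotalCat EB C c × GBar C C' ⥤ TotalCat EB C c) : Prop :=
  ∀ (I : Finset ι) (i : ι) (hi : i ∈ I),
    ∃ (Φ : (pathSub EB (UI U I)).Carrier × GBar C C' ⥤
          ((pathSub EB (UI U I)).comap π).Carrier)
      (Ψ : ((pathSub EB (UI U I)).comap π).Carrier ⥤
          (pathSub EB (UI U I)).Carrier × GBar C C'),
      Φ ⋙ Ψ = 𝟭 _ ∧ Ψ ⋙ Φ = 𝟭 _ ∧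
      (∀ (u : B) (hu : u ∈ UI U I) (g : GBar C C'),
        (Φ ⋙ Subcat.incl _).obj (⟨u, hu⟩, g) = pt C c i (⟨u, hu i hi⟩, g)) ∧
      (∀ (γ : PSPath EB B) (hγ : γ.Inside (UI U I)) (φ : MorBar C C'),
        onMor (Φ ⋙ Subcat.incl _) (pairMor (insideMor γ hγ) (barMor C C' φ)) =
          edgeMor ⟨i, I, hi, γ, hγ, φ⟩) ∧
      Φ ⋙ Subcat.incl _ ⋙ π = CategoryTheory.Prod.fst _ _ ⋙ Subcat.incl _ ∧
      (∀ u (g a : GBar C C'), (Φ ⋙ Subcat.incl _).obj (u, g * a) =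
        act.obj ((Φ ⋙ Subcat.incl _).obj (u, g), a)) ∧
      (∀ f (φ ψ : Mor (GBar C C')), onMor (Φ ⋙ Subcat.incl _) (pairMor f (φ * ψ)) =
        onMor act (pairMor (onMor (Φ ⋙ Subcat.incl _) (pairMor f φ)) ψ))

/-- The object part of the projection, as a map to `B`. -/
def objProj (π : TotalCat EB C c ⥤ PathCat EB B) : TotalObj C c → B := π.obj

/-- The object part of the action. -/
def objAct (act : TotalCat EB C c × GBar C C' ⥤ TotalCat EB C c) :
    TotalObj C c × GBar C C' → TotalObj C c := act.obj

/-- The object part is a locally trivial topological principal bundle: for the quotient topology of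
the disjoint union of the `U_i × Ḡ`, the map `(u, g) ↦ [i, u, g]` is a homeomorphism of `U_i × Ḡ`
onto the open part of the bundle over `U_i`, and projection and action are continuous. Moreover the
bundle space is Hausdorff and second countable. -/
structure IsTopologicalObjBundle [TopologicalSpace G] (π : TotalCat EB C c ⥤ PathCat EB B)
    (act : TotalCat EB C c × GBar C C' ⥤ TotalCat EB C c) : Prop where
  triv : ∀ i, Topology.IsOpenEmbedding (pt C c i)
  range_triv : ∀ i, Set.range (pt C c i) = objProj π ⁻¹' (U i)
  continuous_proj : Continuous (objProj π)
  continuous_act : Continuous (objAct act)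
  t2 : T2Space (TotalObj C c)
  secondCountable : SecondCountableTopology (TotalObj C c)

/-- The object part is a smooth principal bundle: whenever `Ḡ` carries its structure of a quotient
Lie group (a Lie group structure on the topological group `Ḡ` for which `H → Ḡ`, `h ↦ [τ(h)]` is
smooth), the bundle space has the structure of a smooth manifold, modelled on the product of the
models of `B` and `Ḡ`, for which the maps `(u, g) ↦ [i, u, g]` are local diffeomorphisms (hence
diffeomorphisms onto open sets, being injective) and projection and action are smooth. -/
def IsSmoothObjBundle [TopologicalSpace G]
    (EH : Type*) [NormedAddCommGroup EH] [NormedSpace ℝ EH]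
    [TopologicalSpace H] [ChartedSpace EH H]
    (EK : Type*) [NormedAddCommGroup EK] [NormedSpace ℝ EK]
    (π : TotalCat EB C c ⥤ PathCat EB B)
    (act : TotalCat EB C c × GBar C C' ⥤ TotalCat EB C c) : Prop :=
  ∀ [ChartedSpace EK (GBar C C')] [LieGroup 𝓘(ℝ, EK) ∞ (GBar C C')],
    ContMDiff 𝓘(ℝ, EH) 𝓘(ℝ, EK) ∞ (fun h : H => toGBar C C' (C.τ h)) →
    ∃ _ : ChartedSpace (ModelProd EB EK) (TotalObj C c),
      IsManifold (𝓘(ℝ, EB).prod 𝓘(ℝ, EK)) ∞ (TotalObj C c) ∧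
      (∀ i, IsLocalDiffeomorph (𝓘(ℝ, EB).prod 𝓘(ℝ, EK)) (𝓘(ℝ, EB).prod 𝓘(ℝ, EK)) ∞
        (pt C c i)) ∧
      ContMDiff (𝓘(ℝ, EB).prod 𝓘(ℝ, EK)) 𝓘(ℝ, EB) ∞ (objProj π) ∧
      ContMDiff ((𝓘(ℝ, EB).prod 𝓘(ℝ, EK)).prod 𝓘(ℝ, EK)) (𝓘(ℝ, EB).prod 𝓘(ℝ, EK)) ∞
        (objAct act)

variable (EB C c)

/-- All assertions about the bundle category: source and target of a class of non-identity morphisms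
are well defined; the projection and the right action exist; they form a categorical principal
bundle with structure categorical group `Ḡ`, which is locally trivial; and its object part is a
topological and a smooth principal bundle. -/
def HasPrincipalBundle [TopologicalSpace G]
    (EH : Type*) [NormedAddCommGroup EH] [NormedSpace ℝ EH]
    [TopologicalSpace H] [ChartedSpace EH H]
    (EK : Type*) [NormedAddCommGroup EK] [NormedSpace ℝ EK] : Prop :=
  (∀ p q : NonIdMor (TotalQuiver EB C c), cls p = cls q → p.src = q.src ∧ p.tgt = q.tgt) ∧
  ∃ (π : TotalCat EB C c ⥤ PathCat EB B)
    (act : TotalCat EB C c × GBar C C' ⥤ TotalCat EB C c),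
    IsProjection π ∧ IsRightAction act ∧ IsCategoricalPrincipalBundle π act ∧
    IsLocallyTrivial π act ∧ IsTopologicalObjBundle π act ∧ IsSmoothObjBundle EH EK π act

end Total

end CatBundle

set_option linter.unusedSectionVars false

namespace CatBundle

/-! ### Functors and total sets of morphisms -/

section Functors

variable {A D : Type*} [Category A] [Category D]

/-! As a category, without topology, the bundle is globally trivial. Choose for every point `u` an
index `ch u` with `u ∈ U (ch u)`; no regularity of this choice is needed. Reading an object in the
chart chosen at its base point, `[i, u, g] ↦ (u, ḡ_{ch(u) i}(u) g)`, identifies `X` with `B × Ḡ`. An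
edge is read in the charts chosen at its two end points, which multiplies `φ` on the left by the
class of `(b a⁻¹, τ(a))`, where `a` and `b` are the values of `h_{ch i}` at the start and at the
end. The proof shows that this defines an isomorphism of categories from `X` onto `PathCat EB B ×
GBar C C'`. The axioms of a categorical principal bundle and local triviality are then computations
in a product.

The algebraic fact behind this is that `(a, b) ↦ [b a⁻¹, τ(a)]` is a homomorphism on `H × H`
(`pairHom`) that kills `τ'(J) × τ'(J)`. Hence the gerbal relation becomes an honest cocycle
relation, even with different indices at the two ends (`GerbalCocycle.pairHom_mul`).

To see that the normal form depends only on the class modulo `N`, the quiver algebra is represented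
on the real functions on the morphisms of the product category, an edge acting through composition
with its normal form. The generators of `N` act as zero, and different morphisms act by different
operators (`normMor_eq_of_cls_eq`). Since the normal form is injective on objects, source and target
of a class are well defined.

Over a path inside some `U_I`, the relations rewrite every sequence as a single edge in any chosen
chart with index in `I` (`exists_edgeHom_eq`), so the normal form is bijective there. A Lebesgue
subdivision (`PSPath.induction_cover`) extends this to all paths (`normFunctor_full`,
`normFunctor_faithful`).

Topology and smooth structure on objects do not use the choice `ch`. They are glued from the sets
`U_i × Ḡ` along the transition maps `(u, g) ↦ (u, ḡ_{ki}(u) g)`. The general case is the case of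
surjective `τ`, applied to the crossed module with `τ(H)` in place of `G`. -/

lemma Mor.ext_of_eq {f g : Mor A} (hl : f.left = g.left) (hr : f.right = g.right)
    (h : f.hom = eqToHom hl ≫ g.hom ≫ eqToHom hr.symm) : f = g := by
  obtain ⟨a, b, f⟩ := f
  obtain ⟨a', b', g⟩ := g
  dsimp only at hl hr
  subst hl hr
  simpa using h

/-- Identity morphisms record the objects, so the action on total morphisms determines a functor
strictly. Later functor identities are checked in this form, which avoids transport between
hom-sets. -/
lemma functor_eq_of_onMor {F G : A ⥤ D} (h : ∀ f, onMor F f = onMor G f) : F = G := by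
  refine Functor.hext (fun x => congrArg Quiver.Total.left (h ⟨x, x, 𝟙 x⟩)) fun x y f => ?_
  have := h ⟨x, y, f⟩
  simp only [onMor, Quiver.Total.mk.injEq] at this
  exact this.2.2

/-- A functor that is bijective on the total sets of morphisms has a strict inverse. -/
lemma exists_inverse_functor (F : A ⥤ D) (hF : Function.Bijective (onMor F)) :
    ∃ E : D ⥤ A, F ⋙ E = 𝟭 _ ∧ E ⋙ F = 𝟭 _ := by
  -- Objects are recovered from their identity morphisms, so bijectivity on morphisms forces
  -- bijectivity on objects.
  have hobj : Function.Injective F.obj := by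
    intro x y hxy
    have : onMor F ⟨x, x, 𝟙 x⟩ = onMor F ⟨y, y, 𝟙 y⟩ := by
      simp only [onMor, F.map_id]
      rw [hxy]
    exact congrArg Quiver.Total.left (hF.1 this)
  have hsurj : ∀ x, ∃ a, F.obj a = x := fun x => by
    obtain ⟨f, hf⟩ := hF.2 ⟨x, x, 𝟙 x⟩
    exact ⟨f.left, congrArg Quiver.Total.left hf⟩
  choose e he using hsurj
  have hmap : ∀ {x y : D} (f : x ⟶ y), ∃ g : e x ⟶ e y,
      F.map g = eqToHom (he x) ≫ f ≫ eqToHom (he y).symm := by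
    intro x y f
    obtain ⟨⟨a, b, g⟩, hg⟩ := hF.2 ⟨x, y, f⟩
    have ha : F.obj a = x := congrArg Quiver.Total.left hg
    have hb : F.obj b = y := congrArg Quiver.Total.right hg
    obtain rfl : a = e x := hobj (ha.trans (he x).symm)
    obtain rfl : b = e y := hobj (hb.trans (he y).symm)
    refine ⟨g, ?_⟩
    have h3 : HEq (F.map g) f := by
      simp only [onMor, Quiver.Total.mk.injEq] at hg
      exact hg.2.2
    exact (conj_eqToHom_iff_heq _ _ (he _) (he _)).mpr h3
  have hfaith : ∀ {a b : A} (f g : a ⟶ b), F.map f = F.map g → f = g := by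
    intro a b f g h
    have : onMor F ⟨a, b, f⟩ = onMor F ⟨a, b, g⟩ := by simp only [onMor, h]
    simpa using hF.1 this
  choose m hm using @hmap
  -- Since `F` is faithful, the functor laws can be checked after applying `F`, where the transports
  -- cancel.
  let E : D ⥤ A :=
    { obj := e
      map := fun f => m f
      map_id := fun x => hfaith _ _ (by simp [hm])
      map_comp := fun f g => hfaith _ _ (by simp [hm]) }
  have hEF : ∀ f, onMor F (onMor E f) = f := by
    rintro ⟨x, y, f⟩
    exact Mor.ext_of_eq (he x) (he y) (hm f)
  refine ⟨E, functor_eq_of_onMor fun f => hF.1 (hEF (onMor F f)), functor_eq_of_onMor hEF⟩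

lemma pairMor_injective {f f' : Mor A} {g g' : Mor D} (h : pairMor f g = pairMor f' g') :
    f = f' ∧ g = g' :=
  ⟨congrArg (onMor (CategoryTheory.Prod.fst A D)) h, congrArg (onMor (CategoryTheory.Prod.snd A D)) h⟩

lemma Subcat.onMor_incl_injective (S : Subcat A) : Function.Injective (onMor S.incl) := by
  rintro ⟨⟨a, ha⟩, ⟨b, hb⟩, ⟨f, hf⟩⟩ ⟨⟨a', ha'⟩, ⟨b', hb'⟩, ⟨f', hf'⟩⟩ h
  have h : (⟨a, b, f⟩ : Mor A) = ⟨a', b', f'⟩ := h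
  cases h
  rfl

/-- A functor with values in a subcategory, as a functor to the subcategory. -/
def Subcat.lift (S : Subcat D) (F : A ⥤ D) (ho : ∀ a, S.obj (F.obj a))
    (hm : ∀ {a b : A} (f : a ⟶ b), S.hom (F.map f)) : A ⥤ S.Carrier where
  obj a := ⟨F.obj a, ho a⟩
  map f := ⟨F.map f, hm f⟩
  map_id a := Subtype.ext (F.map_id a)
  map_comp f g := Subtype.ext (F.map_comp f g)

end Functors

/-! ### A representation of the quiver algebra -/

section Representation

variable {V Y : Type*} [Quiver V] [Category Y]

/-- The operator of precomposition of functions on morphisms with "followed by `f`". -/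
def followOp (f : Mor Y) : Module.End ℝ (Mor Y → ℝ) where
  toFun v m := open Classical in
    if h : m.right = f.left then v ⟨m.left, f.right, m.hom ≫ eqToHom h ≫ f.hom⟩ else 0
  map_add' v w := by
    funext m
    by_cases h : m.right = f.left <;> simp [h]
  map_smul' r v := by
    funext m
    by_cases h : m.right = f.left <;> simp [h]

lemma followOp_apply_of_eq {x y z : Y} (m : x ⟶ y) (f : y ⟶ z) (v : Mor Y → ℝ) :
    followOp ⟨y, z, f⟩ v ⟨x, y, m⟩ = v ⟨x, z, m ≫ f⟩ := by
  simp [followOp]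

lemma followOp_apply_of_ne {m f : Mor Y} (h : m.right ≠ f.left) (v : Mor Y → ℝ) :
    followOp f v m = 0 := by
  simp [followOp, h]

/-- The operators act on functions of a morphism and not on the morphisms themselves. This reverses
the order once more, so that products of operators follow the order of concatenation. -/
lemma followOp_mul {x y z : Y} (f : x ⟶ y) (g : y ⟶ z) :
    followOp ⟨x, y, f⟩ * followOp ⟨y, z, g⟩ = followOp ⟨x, z, f ≫ g⟩ := by
  refine LinearMap.ext fun v => funext fun m => ?_
  obtain ⟨w, x', m⟩ := m
  rw [Module.End.mul_apply]
  by_cases h : x' = x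
  · subst h
    simp only [followOp_apply_of_eq, Category.assoc]
  · rw [followOp_apply_of_ne h, followOp_apply_of_ne h]

lemma followOp_mul_of_ne {f g : Mor Y} (h : f.right ≠ g.left) :
    followOp f * followOp g = 0 := by
  refine LinearMap.ext fun v => funext fun m => ?_
  obtain ⟨x, y, f⟩ := f
  obtain ⟨w, x', m⟩ := m
  rw [Module.End.mul_apply]
  by_cases h' : x' = x
  · subst h'
    rw [followOp_apply_of_eq, followOp_apply_of_ne (m := ⟨w, y, m ≫ f⟩) h]
    rfl
  · rw [followOp_apply_of_ne h']
    rfl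

/-- The operator of `f`, applied to the indicator function of `f` and evaluated at the identity of
the source of `f`, gives 1; the operator of any other morphism gives 0. -/
lemma followOp_injective : Function.Injective (followOp (Y := Y)) := by
  classical
  rintro ⟨x, y, f⟩ g h
  have h1 := congrFun (LinearMap.congr_fun h (Pi.single ⟨x, y, f⟩ 1)) ⟨x, x, 𝟙 x⟩
  rw [followOp_apply_of_eq, Category.id_comp, Pi.single_eq_same] at h1
  by_cases hx : x = g.left
  · subst hx
    obtain ⟨x, z, g⟩ := g
    rw [followOp_apply_of_eq, Category.id_comp] at h1
    by_contra hne
    rw [Pi.single_eq_of_ne (Ne.symm hne)] at h1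
    exact one_ne_zero h1
  · rw [followOp_apply_of_ne hx] at h1
    exact absurd h1 one_ne_zero

/-- The composite in `Y` of the images of the edges of a nonempty edge sequence. -/
def composite (F : V ⥤q Y) (p : NonIdMor V) : Mor Y :=
  ⟨F.obj p.src, F.obj p.tgt, composePath (F.mapPath p.path)⟩

/-- The representation of the quiver algebra of `V` on the functions on the morphisms of `Y`. -/
def quiverRep (F : V ⥤q Y) (hF : Function.Injective F.obj) :
    QuiverAlgebra V →ₐ[ℝ] Module.End ℝ (Mor Y → ℝ) :=
  RingQuot.liftAlgHom ℝ ⟨FreeAlgebra.lift ℝ fun p => followOp (composite F p), by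
    intro a b h
    cases h with
    | concat p q hp hq =>
      simp only [map_mul, FreeAlgebra.lift_ι_apply]
      refine (followOp_mul _ _).trans ?_
      simp only [composite, Prefunctor.mapPath_comp, composePath_comp]
    | mismatch p q h =>
      simp only [map_mul, FreeAlgebra.lift_ι_apply, map_zero]
      -- Injectivity on vertices is essential here: sequences that do not match must keep a mismatch
      -- after mapping, so that their product acts as zero.
      exact followOp_mul_of_ne fun h' => h (hF h')⟩

lemma quiverRep_of (F : V ⥤q Y) (hF : Function.Injective F.obj) (p : NonIdMor V) :
    quiverRep F hF (QuiverAlgebra.of p) = followOp (composite F p) := by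
  simp [quiverRep, QuiverAlgebra.of]

end Representation

/-! ### Piecewise smooth paths: restriction, factorization, induction over a cover -/

namespace PSPath

variable {EB : Type*} [NormedAddCommGroup EB] [NormedSpace ℝ EB]
variable {B : Type*} [TopologicalSpace B] [ChartedSpace EB B]

lemma toFun_of_nonpos (γ : PSPath EB B) {t : ℝ} (ht : t ≤ 0) : γ.toFun t = γ.src :=
  γ.left_const t ht

lemma concat_toFun_of_le {γ₁ γ₂ : PSPath EB B} (h : γ₁.tgt = γ₂.src) {t : ℝ} (ht : t ≤ γ₁.len) :
    (γ₁.concat γ₂ h).toFun t = γ₁.toFun t := if_pos ht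

lemma concat_toFun_of_ge {γ₁ γ₂ : PSPath EB B} (h : γ₁.tgt = γ₂.src) {t : ℝ} (ht : γ₁.len ≤ t) :
    (γ₁.concat γ₂ h).toFun t = γ₂.toFun (t - γ₁.len) := by
  rcases ht.lt_or_eq with ht | rfl
  · exact if_neg (not_le.mpr ht)
  · rw [concat_toFun_of_le h le_rfl, sub_self]
    exact h

lemma Inside.of_concat_left {γ₁ γ₂ : PSPath EB B} {h : γ₁.tgt = γ₂.src} {S : Set B}
    (hS : (γ₁.concat γ₂ h).Inside S) : γ₁.Inside S := by
  intro t
  rcases le_total t γ₁.len with ht | ht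
  · rw [← concat_toFun_of_le h ht]
    exact hS t
  · rw [γ₁.right_const t ht, ← concat_toFun_of_le h le_rfl]
    exact hS _

lemma Inside.of_concat_right {γ₁ γ₂ : PSPath EB B} {h : γ₁.tgt = γ₂.src} {S : Set B}
    (hS : (γ₁.concat γ₂ h).Inside S) : γ₂.Inside S := by
  intro t
  rcases le_total 0 t with ht | ht
  · have := hS (t + γ₁.len)
    rwa [concat_toFun_of_ge h (by linarith), add_sub_cancel_right] at this
  · have := hS γ₁.len
    rw [concat_toFun_of_ge h le_rfl, sub_self] at this
    rw [toFun_of_nonpos γ₂ ht]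
    exact this

lemma concat_left_cancel {γ α β : PSPath EB B} {h : γ.tgt = α.src} {h' : γ.tgt = β.src}
    (e : γ.concat α h = γ.concat β h') : α = β := by
  refine PSPath.ext ?_ (funext fun t => ?_)
  · have := congrArg PSPath.len e
    simpa [concat] using this
  · rcases le_total 0 t with ht | ht
    · have := congrFun (congrArg PSPath.toFun e) (t + γ.len)
      rwa [concat_toFun_of_ge h (by linarith), concat_toFun_of_ge h' (by linarith),
        add_sub_cancel_right] at this
    · rw [toFun_of_nonpos _ ht, toFun_of_nonpos _ ht, ← h, h']

/-- The restriction of a path to the interval `[a, b]`, translated to `[0, b - a]`. -/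
def restrict (γ : PSPath EB B) (a b : ℝ) (ha : 0 ≤ a) (hab : a ≤ b) (hb : b ≤ γ.len) :
    PSPath EB B where
  len := b - a
  -- Clamping to `[a, b]` produces the constant continuation outside `[0, b - a]` that the
  -- normalization of paths demands.
  toFun t := γ.toFun (max a (min b (t + a)))
  len_nonneg := sub_nonneg.mpr hab
  left_const t ht := by
    rw [min_eq_right (by linarith), max_eq_left (by linarith), zero_add, min_eq_right hab, max_self]
  right_const t ht := by
    rw [min_eq_left (by linarith), sub_add_cancel, min_self]
  smooth := by
    obtain ⟨T, hT⟩ := γ.smooth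
    classical
    refine ⟨T.image fun t => t - a, fun s t hs ht hst => ?_⟩
    have key := hT (s + a) (t + a) (by linarith) (by linarith) fun r hr hm =>
      hst (r - a) (Finset.mem_image_of_mem _ hr) ⟨by linarith [hm.1], by linarith [hm.2]⟩
    have hadd : ContMDiffOn 𝓘(ℝ, ℝ) 𝓘(ℝ, ℝ) ∞ (fun r : ℝ => r + a) (Set.Icc s t) :=
      (contDiff_id.add contDiff_const).contMDiff.contMDiffOn
    refine (key.comp hadd fun r hr => ⟨by linarith [hr.1], by linarith [hr.2]⟩).congr
      fun r hr => ?_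
    have h1 : r + a ≤ b := by linarith [hr.2]
    have h2 : a ≤ r + a := by linarith [hr.1]
    rw [min_eq_right h1, max_eq_right h2]
    rfl

variable (γ : PSPath EB B)

lemma restrict_toFun {a b : ℝ} (ha : 0 ≤ a) (hab : a ≤ b) (hb : b ≤ γ.len) {t : ℝ} (h0 : 0 ≤ t)
    (ht : t + a ≤ b) : (γ.restrict a b ha hab hb).toFun t = γ.toFun (t + a) := by
  simp only [restrict]
  rw [min_eq_right ht, max_eq_right (by linarith)]

lemma src_restrict {a b : ℝ} (ha : 0 ≤ a) (hab : a ≤ b) (hb : b ≤ γ.len) :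
    (γ.restrict a b ha hab hb).src = γ.toFun a := by
  rw [src, restrict_toFun γ ha hab hb le_rfl (by linarith), zero_add]

lemma tgt_restrict {a b : ℝ} (ha : 0 ≤ a) (hab : a ≤ b) (hb : b ≤ γ.len) :
    (γ.restrict a b ha hab hb).tgt = γ.toFun b := by
  have h : (γ.restrict a b ha hab hb).len = b - a := rfl
  rw [tgt, h, restrict_toFun γ ha hab hb (by linarith) (by linarith), sub_add_cancel]

lemma ext_of_Icc {α β : PSPath EB B} (hl : α.len = β.len)
    (h : ∀ t, 0 ≤ t → t ≤ α.len → α.toFun t = β.toFun t) : α = β := by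
  refine PSPath.ext hl (funext fun t => ?_)
  rcases le_total 0 t with h0 | h0
  · rcases le_total t α.len with h1 | h1
    · exact h t h0 h1
    · rw [α.right_const t h1, β.right_const t (hl ▸ h1), h _ α.len_nonneg le_rfl, hl]
  · rw [α.left_const t h0, β.left_const t h0, h 0 le_rfl α.len_nonneg]

lemma restrict_full : γ.restrict 0 γ.len le_rfl γ.len_nonneg le_rfl = γ := by
  refine ext_of_Icc (sub_zero _) fun t h0 h1 => ?_
  rw [restrict_toFun γ le_rfl γ.len_nonneg le_rfl h0 (by simpa [restrict] using h1), add_zero]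

lemma restrict_concat {a b d : ℝ} (ha : 0 ≤ a) (hab : a ≤ b) (hbd : b ≤ d) (hd : d ≤ γ.len) :
    γ.restrict a d ha (hab.trans hbd) hd =
      (γ.restrict a b ha hab (hbd.trans hd)).concat (γ.restrict b d (ha.trans hab) hbd hd)
        ((γ.tgt_restrict _ _ _).trans (γ.src_restrict _ _ _).symm) := by
  refine ext_of_Icc (by simp [restrict, concat]) fun t h0 h1 => ?_
  have h1 : t ≤ d - a := h1
  rw [restrict_toFun γ _ _ _ h0 (by linarith)]
  rcases le_total t (b - a) with h2 | h2
  · rw [concat_toFun_of_le _ h2, restrict_toFun γ _ _ _ h0 (by linarith)]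
  · have hl : (γ.restrict a b ha hab (hbd.trans hd)).len = b - a := rfl
    rw [concat_toFun_of_ge _ h2, hl, restrict_toFun γ _ _ _ (by linarith) (by linarith)]
    congr 1
    ring

lemma exists_factor_of_len_le {α β γ₁ γ₂ : PSPath EB B} {h : α.tgt = β.src}
    {h' : γ₁.tgt = γ₂.src} (e : α.concat β h = γ₁.concat γ₂ h') (hl : γ₁.len ≤ α.len) :
    ∃ (δ : PSPath EB B) (h₁ : γ₁.tgt = δ.src) (h₂ : δ.tgt = β.src),
      α = γ₁.concat δ h₁ ∧ γ₂ = δ.concat β h₂ := by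
  have hfun : ∀ t, t ≤ γ₁.len → α.toFun t = γ₁.toFun t := fun t ht => by
    rw [← concat_toFun_of_le h (ht.trans hl), e, concat_toFun_of_le h' ht]
  -- The middle piece `δ` is the part of `α` after time `γ₁.len`.
  have h₁ : γ₁.tgt = (α.restrict γ₁.len α.len γ₁.len_nonneg hl le_rfl).src := by
    rw [src_restrict, hfun _ le_rfl, tgt]
  have h₂ : (α.restrict γ₁.len α.len γ₁.len_nonneg hl le_rfl).tgt = β.src := by
    rw [tgt_restrict, ← h, tgt]
  have e₁ : α = γ₁.concat _ h₁ := by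
    refine ext_of_Icc (by simp [restrict, concat]) fun t h0 h1 => ?_
    rcases le_total t γ₁.len with h2 | h2
    · rw [concat_toFun_of_le _ h2, hfun t h2]
    · rw [concat_toFun_of_ge _ h2, restrict_toFun _ _ _ _ (by linarith) (by linarith),
        sub_add_cancel]
  -- The second identity follows by cancelling `γ₁` on the left: first `γ₁`, then `δ`, then `β` is
  -- the same path as first `γ₁`, then `γ₂`.
  refine ⟨_, h₁, h₂, e₁, concat_left_cancel (γ := γ₁) (h := h') (h' := by simpa using h₁) ?_⟩
  rw [← concat_assoc _ _ _ h₁ h₂, ← e]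
  congr 1

/-- Two factorizations of a path have a common refinement. -/
lemma exists_factor {α β γ₁ γ₂ : PSPath EB B} {h : α.tgt = β.src}
    {h' : γ₁.tgt = γ₂.src} (e : α.concat β h = γ₁.concat γ₂ h') :
    (∃ (δ : PSPath EB B) (h₁ : γ₁.tgt = δ.src) (h₂ : δ.tgt = β.src),
      α = γ₁.concat δ h₁ ∧ γ₂ = δ.concat β h₂) ∨
    (∃ (δ : PSPath EB B) (h₁ : α.tgt = δ.src) (h₂ : δ.tgt = γ₂.src),
      γ₁ = α.concat δ h₁ ∧ β = δ.concat γ₂ h₂) :=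
  (le_total γ₁.len α.len).imp (exists_factor_of_len_le e) (exists_factor_of_len_le e.symm)

lemma continuousOn : ContinuousOn γ.toFun (Set.Icc 0 γ.len) := by
  obtain ⟨T, hT⟩ := γ.smooth
  classical
  intro t ht
  -- This `ε` separates `t` from all other break points. The path is therefore smooth on a closed
  -- interval ending at `t` and on one starting at `t`, and the two one-sided continuities combine.
  obtain ⟨ε, hε, hball⟩ := Metric.isOpen_iff.mp
    ((T.erase t).finite_toSet.isClosed.isOpen_compl) t (by simp)
  have hne : ∀ r ∈ T, |r - t| < ε → r = t := by
    intro r hr hrt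
    by_contra hc
    exact hball (show r ∈ Metric.ball t ε from hrt) (by simp [hc, hr])
  have h1 := (hT (max 0 (t - ε / 2)) t (le_max_left _ _) ht.2 fun r hr hm => by
    have := (le_max_right 0 (t - ε / 2)).trans_lt hm.1
    have h2 := hne r hr (abs_lt.mpr ⟨by linarith, by linarith [hm.2]⟩)
    exact hm.2.ne h2).continuousOn
  have h2 := (hT t (min γ.len (t + ε / 2)) ht.1 (min_le_left _ _) fun r hr hm => by
    have := hm.2.trans_le (min_le_right γ.len (t + ε / 2))
    have h2 := hne r hr (abs_lt.mpr ⟨by linarith [hm.1], by linarith⟩)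
    exact hm.1.ne h2.symm).continuousOn
  have h3 := (h1 t ⟨max_le ht.1 (by linarith), le_rfl⟩).union
    (h2 t ⟨le_rfl, le_min ht.2 (by linarith)⟩)
  refine h3.mono_of_mem_nhdsWithin ?_
  filter_upwards [self_mem_nhdsWithin, mem_nhdsWithin_of_mem_nhds (Metric.ball_mem_nhds t
    (half_pos hε))] with s hs hst
  rw [Metric.mem_ball, Real.dist_eq, abs_lt] at hst
  rcases le_total s t with hle | hle
  · exact Or.inl ⟨max_le hs.1 (by linarith), hle⟩
  · exact Or.inr ⟨hle, le_min hs.2 (by linarith)⟩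

/-- A property of paths that is closed under concatenation holds for all paths if it holds for the
paths that stay inside some member of an open cover. -/
lemma induction_cover {ι : Type*} {U : ι → TopologicalSpace.Opens B} (hU : ∀ u, ∃ i, u ∈ U i)
    {P : PSPath EB B → Prop} (hloc : ∀ γ i, γ.Inside (U i) → P γ)
    (hconcat : ∀ γ₁ γ₂ h, P γ₁ → P γ₂ → P (γ₁.concat γ₂ h)) (γ : PSPath EB B) : P γ := by
  -- A Lebesgue subdivision: `t` is monotone, starts at 0, equals `γ.len` from the index `m` on, and
  -- each piece lies in one member of the cover.
  obtain ⟨t, ht0, hmono, ⟨m, hm⟩, hsub⟩ := exists_monotone_Icc_subset_open_cover_Icc γ.len_nonneg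
    (c := fun i => {s : Set.Icc 0 γ.len | γ.toFun s ∈ U i})
    (fun i => (U i).2.preimage (continuousOn_iff_continuous_domRestrict.mp γ.continuousOn))
    (fun s _ => by
      obtain ⟨i, hi⟩ := hU (γ.toFun s)
      exact Set.mem_iUnion.mpr ⟨i, hi⟩)
  have piece : ∀ (a b : ℝ) (ha : 0 ≤ a) (hab : a ≤ b) (hb : b ≤ γ.len) (i : ι),
      (∀ s, a ≤ s → s ≤ b → γ.toFun s ∈ U i) → P (γ.restrict a b ha hab hb) :=
    fun a b ha hab hb i h => hloc _ i fun s =>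
      h _ (le_max_left _ _) (max_le hab (min_le_left _ _))
  have key : ∀ n, P (γ.restrict 0 (t n) le_rfl (t n).2.1 (t n).2.2) := by
    intro n
    induction n with
    | zero =>
      -- The piece up to `t 0 = 0` has length zero, so any member of the cover around the initial
      -- point serves.
      obtain ⟨i, hi⟩ := hU (γ.toFun 0)
      refine piece _ _ _ _ _ i fun s h0 h1 => ?_
      rw [ht0] at h1
      rwa [le_antisymm h1 h0]
    | succ n ih =>
      have hle : (t n : ℝ) ≤ t (n + 1) := hmono n.le_succ
      rw [restrict_concat γ le_rfl (t n).2.1 hle (t (n + 1)).2.2]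
      refine hconcat _ _ _ ih ?_
      obtain ⟨i, hi⟩ := hsub n
      refine piece _ _ _ _ _ i fun s h0 h1 => ?_
      exact hi (show (⟨s, (t n).2.1.trans h0, h1.trans (t (n + 1)).2.2⟩ : Set.Icc 0 γ.len) ∈
        Set.Icc (t n) (t (n + 1)) from ⟨h0, h1⟩)
  have hfin := key m
  simp only [hm m le_rfl] at hfin
  rwa [restrict_full] at hfin

end PSPath

/-! ### Coordinate changes on morphisms -/

section PairHom

variable {G H J : Type*} [Group G] [Group H] [Group J]
variable (C : CrossedModule G H) (C' : CrossedModule H J) [C.TauSurj]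

/-- The homomorphism `(a, b) ↦ [b a⁻¹, τ(a)]`: the morphism from `[τ(a)]` to `[τ(b)]`
determined by `a` and `b`. -/
def pairHom : H × H →* MorBar C C' where
  toFun p := toMorBar C C' ⟨p.2 * p.1⁻¹, C.τ p.1⟩
  map_one' := by
    rw [← map_one (toMorBar C C')]
    congr 1
    ext <;> simp
  map_mul' p q := by
    rw [← map_mul]
    congr 1
    ext
    -- By the Peiffer identity, `α` at `τ(a)` is conjugation by `a`, so `b a⁻¹ · a (b' a'⁻¹) a⁻¹ =
    -- (b b') (a a')⁻¹`.
    · simp only [Prod.fst_mul, Prod.snd_mul, SemidirectProduct.mul_left, C.α_τ]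
      group
    · simp

@[simp] lemma srcBar_pairHom (a b : H) :
    srcBar C C' (pairHom C C' (a, b)) = toGBar C C' (C.τ a) := rfl

@[simp] lemma tgtBar_pairHom (a b : H) :
    tgtBar C C' (pairHom C C' (a, b)) = toGBar C C' (C.τ b) := by
  simp [pairHom]

lemma compBar_pairHom (a b d : H) :
    compBar C C' (pairHom C C' (b, d)) (pairHom C C' (a, b)) = pairHom C C' (a, d) := by
  refine (compBar_mk C C' _ _ _ _ (by simp)).trans ?_
  simp [pairHom]

lemma pairHom_eq_one {a b : H} (ha : a ∈ C'.τ.range) (hb : b ∈ C'.τ.range) :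
    pairHom C C' (a, b) = 1 := by
  obtain ⟨j, rfl⟩ := ha
  exact (toMorBar_eq_one C C').mpr ⟨mul_mem hb (inv_mem ⟨j, rfl⟩), ⟨j, rfl⟩⟩

lemma pairHom_diag (a : H) : pairHom C C' (a, a) = idBar C C' (toGBar C C' (C.τ a)) := by
  simp [pairHom]

/-- Every morphism of the categorical group is invertible. -/
lemma exists_inverse_hom {a b : GBar C C'} (f : a ⟶ b) :
    ∃ g : b ⟶ a, f ≫ g = 𝟙 a ∧ g ≫ f = 𝟙 b := by
  obtain ⟨φ, rfl, rfl⟩ := f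
  refine ⟨⟨idBar C C' (srcBar C C' φ) * φ⁻¹ * idBar C C' (tgtBar C C' φ), by simp, by simp⟩,
    Subtype.ext ?_, Subtype.ext ?_⟩
  · change compBar C C' _ φ = idBar C C' (srcBar C C' φ)
    simp [compBar]
  · change compBar C C' φ _ = idBar C C' (tgtBar C C' φ)
    simp [compBar, mul_assoc]

lemma barMor_surjective : Function.Surjective (barMor C C') := (morEquiv C C').symm.surjective

lemma barMor_injective : Function.Injective (barMor C C') := (morEquiv C C').symm.injective

lemma barMor_mul (φ ψ : MorBar C C') : barMor C C' (φ * ψ) = barMor C C' φ * barMor C C' ψ :=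
  (Equiv.symm_apply_apply (morEquiv C C') _).symm

end PairHom

/-! ### Normal forms of objects, edges and edge sequences -/

section Normalization

variable {G H J : Type*} [Group G] [Group H] [Group J]
variable {EB : Type*} [NormedAddCommGroup EB] [NormedSpace ℝ EB]
variable {B : Type*} [TopologicalSpace B] [ChartedSpace EB B] {ι : Type*}
variable (C : CrossedModule G H) {C' : CrossedModule H J} [C.TauSurj]
variable {U : ι → TopologicalSpace.Opens B} (c : GerbalCocycle C' U)

/-- At each of the two points the cocycle relation fails only by an element of `τ'(J)`, and
`pairHom` kills such pairs. The indices at `u` and at `v` are independent, which is what allows the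
two ends of a path to be read in different charts. -/
lemma GerbalCocycle.pairHom_mul {i k m i' k' m' : ι} {u v : B} (hi : u ∈ U i) (hk : u ∈ U k)
    (hm : u ∈ U m) (hi' : v ∈ U i') (hk' : v ∈ U k') (hm' : v ∈ U m') :
    pairHom C C' (c.h i k u, c.h i' k' v) * pairHom C C' (c.h k m u, c.h k' m' v) =
      pairHom C C' (c.h i m u, c.h i' m' v) := by
  rw [c.rel i k m u hi hk hm, c.rel i' k' m' v hi' hk' hm', ← map_mul, mul_assoc, mul_assoc]
  have := map_mul (pairHom C C') (C'.τ (c.j i k m u), C'.τ (c.j i' k' m' v))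
    (c.h i k u * c.h k m u, c.h i' k' v * c.h k' m' v)
  rw [pairHom_eq_one C C' ⟨_, rfl⟩ ⟨_, rfl⟩, one_mul] at this
  exact this.symm

/-- The given transition functions and the passage to the chosen charts thus become values of one
homomorphism and can be combined by `GerbalCocycle.pairHom_mul`. -/
lemma thetaBar_eq_pairHom (i k : ι) (γ : PSPath EB B) :
    thetaBar C c i k γ = pairHom C C' (c.h i k γ.src, c.h i k γ.tgt) := rfl

variable (ch : B → ι)

/-- The coordinate of an object in a chosen chart around its base point. -/
def normObj (hch : ∀ u, u ∈ U (ch u)) (x : TotalObj C c) : PathCat EB B × GBar C C' :=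
  Quotient.liftOn x (fun p => (p.2.1.1, gBar C c (ch p.2.1.1) p.1 p.2.1.1 * p.2.2)) (by
    rintro ⟨i, ⟨u, hu⟩, g⟩ ⟨k, ⟨v, hv⟩, g'⟩ ⟨h1, h2⟩
    dsimp only at h1 h2 ⊢
    subst h1
    rw [h2, ← mul_assoc, gBar_mul C c (hch _) hv hu])

variable {ch} (hch : ∀ u, u ∈ U (ch u))

lemma normObj_pt {i : ι} {u : B} (hu : u ∈ U i) (g : GBar C C') :
    normObj (EB := EB) C c ch hch (pt C c i (⟨u, hu⟩, g)) = (u, gBar C c (ch u) i u * g) := rfl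

lemma normObj_bijective : Function.Bijective (normObj (EB := EB) C c ch hch) := by
  constructor
  · intro x y h
    obtain ⟨⟨i, ⟨u, hu⟩, g⟩, rfl⟩ := Quotient.exists_rep x
    obtain ⟨⟨k, ⟨v, hv⟩, g'⟩, rfl⟩ := Quotient.exists_rep y
    obtain ⟨h1, h2⟩ := Prod.ext_iff.mp h
    have h1 : u = v := h1
    subst h1
    have h2 : gBar C c (ch u) i u * g = gBar C c (ch u) k u * g' := h2
    refine Quotient.sound ⟨rfl, ?_⟩
    dsimp only
    -- The transition from the chart `i` to the chart `k` is taken through the chosen chart, where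
    -- both coordinates agree.
    rw [← gBar_mul C c hv (hch u) hu, mul_assoc, h2, ← mul_assoc, gBar_mul C c hv (hch u) hv,
      gBar_self C c hv, one_mul]
  · rintro ⟨u, a⟩
    refine ⟨pt C c (ch u) (⟨u, hch u⟩, a), (normObj_pt C c hch (hch u) a).trans ?_⟩
    rw [gBar_self C c (hch u), one_mul]
    rfl

variable {C c}

/-- The morphism of an edge in the chosen charts around its end points. -/
def normEdge (ch : B → ι) (e : Edge EB C c) : MorBar C C' :=
  pairHom C C' (c.h (ch e.γ.src) e.i e.γ.src, c.h (ch e.γ.tgt) e.i e.γ.tgt) * e.φ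

variable (C c)

/-- The quiver of decorated local paths, mapped to the product of the path category and the
categorical group by means of the chosen charts. -/
def normPrefunctor : TotalQuiver EB C c ⥤q (PathCat EB B × GBar C C') where
  obj := normObj C c ch hch
  map := fun e => Prod.mkHom
    ⟨e.1.γ, congrArg (fun x => (normObj (EB := EB) C c ch hch x).1) e.2.1,
      congrArg (fun x => (normObj (EB := EB) C c ch hch x).1) e.2.2⟩
    ⟨normEdge ch e.1, by
      refine Eq.trans ?_ (congrArg (fun x => (normObj (EB := EB) C c ch hch x).2) e.2.1)
      rw [normEdge, map_mul]
      rfl, by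
      refine Eq.trans ?_ (congrArg (fun x => (normObj (EB := EB) C c ch hch x).2) e.2.2)
      rw [normEdge, map_mul, tgtBar_pairHom]
      rfl⟩

variable {C c}

/-- The normal form of a nonempty edge sequence. -/
def normMor (p : NonIdMor (TotalQuiver EB C c)) : Mor (PathCat EB B × GBar C C') :=
  composite (normPrefunctor C c hch) p

lemma pathMor_surjective : Function.Surjective (pathMor (E := EB) (B := B)) := by
  rintro ⟨_, _, ⟨γ, rfl, rfl⟩⟩
  exact ⟨γ, rfl⟩

lemma pathMor_injective : Function.Injective (pathMor (E := EB) (B := B)) :=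
  Function.LeftInverse.injective (g := fun f : Mor (PathCat EB B) => f.hom.1) fun _ => rfl

lemma prodMor_ext {a b : PathCat EB B × GBar C C'} {f g : a ⟶ b} (h₁ : f.1.1 = g.1.1)
    (h₂ : f.2.1 = g.2.1) : f = g :=
  Prod.ext (Subtype.ext h₁) (Subtype.ext h₂)

lemma mk_eq_pairMor {a b : PathCat EB B × GBar C C'} (f : a ⟶ b) :
    (⟨a, b, f⟩ : Mor _) = pairMor (pathMor f.1.1) (barMor C C' f.2.1) := by
  obtain ⟨a, a'⟩ := a
  obtain ⟨b, b'⟩ := b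
  obtain ⟨⟨γ, h1, h2⟩, ⟨φ, h3, h4⟩⟩ := f
  dsimp only at h1 h2 h3 h4
  subst h1 h2 h3 h4
  rfl

lemma followOp_pairMor_mul {γ₁ γ₂ : PSPath EB B} {φ₁ φ₂ : MorBar C C'} (h : γ₁.tgt = γ₂.src)
    (hs : srcBar C C' φ₂ = tgtBar C C' φ₁) :
    followOp (pairMor (pathMor γ₁) (barMor C C' φ₁)) *
        followOp (pairMor (pathMor γ₂) (barMor C C' φ₂)) =
      followOp (pairMor (pathMor (γ₁.concat γ₂ h)) (barMor C C' (compBar C C' φ₂ φ₁))) := by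
  let m₁ : ((γ₁.src, srcBar C C' φ₁) : PathCat EB B × GBar C C') ⟶
      (γ₁.tgt, tgtBar C C' φ₁) := Prod.mkHom ⟨γ₁, rfl, rfl⟩ ⟨φ₁, rfl, rfl⟩
  let m₂ : ((γ₁.tgt, tgtBar C C' φ₁) : PathCat EB B × GBar C C') ⟶
      (γ₂.tgt, tgtBar C C' φ₂) := Prod.mkHom ⟨γ₂, h.symm, rfl⟩ ⟨φ₂, hs, rfl⟩
  have e₁ : _ = pairMor (pathMor γ₁) (barMor C C' φ₁) := mk_eq_pairMor m₁
  have e₂ : _ = pairMor (pathMor γ₂) (barMor C C' φ₂) := mk_eq_pairMor m₂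
  have e₃ : _ = pairMor (pathMor (γ₁.concat γ₂ h)) (barMor C C' (compBar C C' φ₂ φ₁)) :=
    mk_eq_pairMor (m₁ ≫ m₂)
  rw [← e₁, ← e₂, ← e₃, followOp_mul]

lemma normMor_single (e : Edge EB C c) :
    normMor hch e.single = pairMor (pathMor e.γ) (barMor C C' (normEdge ch e)) := by
  refine (mk_eq_pairMor _).trans ?_
  have : composePath ((normPrefunctor C c hch).mapPath e.single.path) =
      (normPrefunctor C c hch).map e.arrow := Category.id_comp _
  rw [this]
  rfl

/-- Passing from `e.i` to `e'.i` and from there to the chosen charts is the same as passing to the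
chosen charts directly. -/
lemma normEdge_eq_of_N₀ (hch : ∀ u, u ∈ U (ch u)) {e e' : Edge EB C c} (hγ : e'.γ = e.γ)
    (hφ : e'.φ = thetaBar C c e'.i e.i e.γ * e.φ) : normEdge ch e = normEdge ch e' := by
  have h0 := e'.src_mem
  have h1 := e'.tgt_mem
  rw [hγ] at h0 h1
  rw [normEdge, normEdge, hφ, hγ, thetaBar_eq_pairHom, ← mul_assoc,
    c.pairHom_mul C (hch _) h0 e.src_mem (hch _) h1 e.tgt_mem]

/-- Both factors run inside the chart `ek.i`, so they can first be read there. The interchange law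
then separates the changes of chart from the group parts. The former compose by `compBar_pairHom`;
the latter compose to `ek.φ`. -/
lemma normEdge_eq_of_N₁ (hch : ∀ u, u ∈ U (ch u)) {ei ej ek : Edge EB C c}
    (h : ei.γ.tgt = ej.γ.src) (hγ : ek.γ = ei.γ.concat ej.γ h)
    (hφ : ek.φ = compBar C C' (thetaBar C c ek.i ej.i ej.γ * ej.φ)
      (thetaBar C c ek.i ei.i ei.γ * ei.φ)) :
    normEdge ch ek = compBar C C' (normEdge ch ej) (normEdge ch ei) := by
  have hin := ek.inside
  rw [hγ] at hin
  have hs : ek.γ.src = ei.γ.src := by rw [hγ, PSPath.src_concat]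
  have ht : ek.γ.tgt = ej.γ.tgt := by rw [hγ, PSPath.tgt_concat]
  have h0 : ei.γ.src ∈ U ek.i := hin.of_concat_left _ _ ek.mem
  have h1 : ei.γ.tgt ∈ U ek.i := hin.of_concat_left _ _ ek.mem
  have h1' : ej.γ.src ∈ U ek.i := hin.of_concat_right _ _ ek.mem
  have h2 : ej.γ.tgt ∈ U ek.i := hin.of_concat_right _ _ ek.mem
  have ei' : normEdge ch ei = pairHom C C' (c.h (ch ei.γ.src) ek.i ei.γ.src,
      c.h (ch ei.γ.tgt) ek.i ei.γ.tgt) * (thetaBar C c ek.i ei.i ei.γ * ei.φ) := by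
    rw [normEdge, thetaBar_eq_pairHom, ← mul_assoc,
      c.pairHom_mul C (hch _) h0 ei.src_mem (hch _) h1 ei.tgt_mem]
  have ej' : normEdge ch ej = pairHom C C' (c.h (ch ej.γ.src) ek.i ej.γ.src,
      c.h (ch ej.γ.tgt) ek.i ej.γ.tgt) * (thetaBar C c ek.i ej.i ej.γ * ej.φ) := by
    rw [normEdge, thetaBar_eq_pairHom, ← mul_assoc,
      c.pairHom_mul C (hch _) h1' ej.src_mem (hch _) h2 ej.tgt_mem]
  rw [ei', ej', compBar_mul C C' _ _ (by simp [h]), ← hφ, normEdge, h, compBar_pairHom, hs, ht]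

/-- The hypothesis `hst` is composability in the chart `ek.i` at the common end point. Left
multiplication by the transition to the chosen chart there turns it into composability of the normal
forms. -/
lemma normEdge_composable (hch : ∀ u, u ∈ U (ch u)) {ei ej ek : Edge EB C c}
    (h : ei.γ.tgt = ej.γ.src) (hγ : ek.γ = ei.γ.concat ej.γ h)
    (hst : srcBar C C' (thetaBar C c ek.i ej.i ej.γ * ej.φ) =
      tgtBar C C' (thetaBar C c ek.i ei.i ei.γ * ei.φ)) :
    srcBar C C' (normEdge ch ej) = tgtBar C C' (normEdge ch ei) := by
  have hin := ek.inside
  rw [hγ] at hin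
  have h1 : ei.γ.tgt ∈ U ek.i := hin.of_concat_left _ _ ek.mem
  rw [map_mul, map_mul, thetaBar_eq_pairHom, thetaBar_eq_pairHom, srcBar_pairHom, tgtBar_pairHom,
    ← h] at hst
  have hj := ej.src_mem
  rw [← h] at hj
  rw [normEdge, normEdge, map_mul, map_mul, srcBar_pairHom, tgtBar_pairHom, ← h]
  have e₁ := gBar_mul C c (hch _) h1 hj
  have e₂ := gBar_mul C c (hch _) h1 ei.tgt_mem
  simp only [gBar] at e₁ e₂
  rw [← e₁, ← e₂, mul_assoc, mul_assoc, hst]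

/-- Edge sequences of the same class have the same normal form. -/
lemma normMor_eq_of_cls_eq {p q : NonIdMor (TotalQuiver EB C c)} (h : cls p = cls q) :
    normMor hch p = normMor hch q := by
  let ρ := quiverRep (normPrefunctor (EB := EB) C c hch) (normObj_bijective C c hch).1
  have hρ : ∀ p, ρ (QuiverAlgebra.of p) = followOp (normMor hch p) := quiverRep_of _ _
  -- The kernel is a two-sided ideal, so it suffices that both kinds of generators act as zero.
  have hle : idealN EB C c ≤ TwoSidedIdeal.ker ρ := by
    refine TwoSidedIdeal.span_le.mpr ?_
    rintro x (⟨e, e', hγ, hφ, rfl⟩ | ⟨ei, ej, ek, -, -, ⟨h, hγ⟩, hst, hφ, rfl⟩)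
    · rw [SetLike.mem_coe, TwoSidedIdeal.mem_ker, map_sub, sub_eq_zero, hρ, hρ,
        normMor_single, normMor_single, hγ, normEdge_eq_of_N₀ hch hγ hφ]
    · rw [SetLike.mem_coe, TwoSidedIdeal.mem_ker, map_sub, sub_eq_zero, map_mul, hρ, hρ, hρ,
        normMor_single, normMor_single, normMor_single, hγ, normEdge_eq_of_N₁ hch h hγ hφ,
        followOp_pairMor_mul h]
      exact normEdge_composable hch h hγ hst
  have h1 : QuiverAlgebra.of p - QuiverAlgebra.of q ∈ idealN EB C c :=
    (TwoSidedIdeal.rel_iff _ _ _).mp ((RingCon.eq _).mp h)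
  have h2 := (TwoSidedIdeal.mem_ker _).mp (hle h1)
  rw [map_sub, sub_eq_zero, hρ, hρ] at h2
  exact followOp_injective h2

end Normalization

namespace PSPath

variable {EB : Type*} [NormedAddCommGroup EB] [NormedSpace ℝ EB]
variable {B : Type*} [TopologicalSpace B] [ChartedSpace EB B]

/-- Constancy is a hypothesis here because the proof `h` of matching end points depends on `δ`,
which obstructs rewriting `δ` inside the concatenation. -/
lemma concat_of_eq_const {γ δ : PSPath EB B} {u : B} (h : γ.tgt = δ.src) (hδ : δ = const u) :
    γ.concat δ h = γ := by
  subst hδ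
  exact concat_const u γ h

lemma concat_of_const_eq {γ δ : PSPath EB B} {u : B} (h : γ.tgt = δ.src) (hγ : γ = const u) :
    γ.concat δ h = δ := by
  subst hγ
  exact const_concat u δ h

end PSPath

section Comparison

variable {G H J : Type*} [Group G] [Group H] [Group J]
variable {EB : Type*} [NormedAddCommGroup EB] [NormedSpace ℝ EB]
variable {B : Type*} [TopologicalSpace B] [ChartedSpace EB B] {ι : Type*}
variable {C : CrossedModule G H} {C' : CrossedModule H J} [C.TauSurj]
variable {U : ι → TopologicalSpace.Opens B} {c : GerbalCocycle C' U}
variable {ch : B → ι} (hch : ∀ u, u ∈ U (ch u))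

/-! ### The comparison functor -/

include hch in
/-- Source and target of a class of nonempty edge sequences are well defined. -/
lemma src_tgt_eq_of_cls_eq {p q : NonIdMor (TotalQuiver EB C c)} (h : cls p = cls q) :
    p.src = q.src ∧ p.tgt = q.tgt := by
  have := normMor_eq_of_cls_eq hch h
  exact ⟨(normObj_bijective (EB := EB) C c hch).1 (congrArg Quiver.Total.left this),
    (normObj_bijective (EB := EB) C c hch).1 (congrArg Quiver.Total.right this)⟩

lemma composePath_eq_of_cls_eq {x y : TotalQuiver EB C c} {p q : Quiver.Path x y}
    (hp : 0 < p.length) (hq : 0 < q.length) (h : cls ⟨p, hp⟩ = cls ⟨q, hq⟩) :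
    composePath ((normPrefunctor C c hch).mapPath p) =
      composePath ((normPrefunctor C c hch).mapPath q) := by
  have := normMor_eq_of_cls_eq hch h
  simpa [normMor, composite] using this

/-- The value of the comparison functor on a morphism. -/
def normHom {x y : TotalCat EB C c} (f : x ⟶ y) :
    (normObj C c ch hch x : PathCat EB B × GBar C C') ⟶ normObj C c ch hch y :=
  composePath ((normPrefunctor C c hch).mapPath f.2.choose)

lemma normHom_eq {x y : TotalCat EB C c} (f : x ⟶ y)
    (p : Quiver.Path (show TotalQuiver EB C c from x) (show TotalQuiver EB C c from y))
    (hp : 0 < p.length) (h : cls ⟨p, hp⟩ = f.1) :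
    normHom hch f = composePath ((normPrefunctor C c hch).mapPath p) :=
  composePath_eq_of_cls_eq hch f.2.choose_spec.choose hp
    (f.2.choose_spec.choose_spec.trans h.symm)

/-- The morphism of an edge between given objects. -/
def edgeHom (e : Edge EB C c) {x y : TotalCat EB C c} (hx : e.src = x) (hy : e.tgt = y) : x ⟶ y :=
  ⟨cls e.single, by subst hx hy; exact ⟨e.arrow.toPath, Nat.one_pos, rfl⟩⟩

lemma edgeMor_eq (e : Edge EB C c) {x y : TotalCat EB C c} (hx : e.src = x) (hy : e.tgt = y) :
    edgeMor e = ⟨x, y, edgeHom e hx hy⟩ := by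
  subst hx hy
  rfl

lemma normHom_edgeHom (e : Edge EB C c) {x y : TotalCat EB C c} (hx : e.src = x)
    (hy : e.tgt = y) :
    normHom hch (edgeHom e hx hy) = (normPrefunctor C c hch).map ⟨e, hx, hy⟩ := by
  subst hx hy
  exact (normHom_eq hch _ e.arrow.toPath Nat.one_pos rfl).trans (Category.id_comp _)

/-- The functor from the bundle category to the product of the path category and the categorical
group that reads objects and morphisms in the chosen charts around the end points. -/
def normFunctor : TotalCat EB C c ⥤ PathCat EB B × GBar C C' where
  obj := normObj C c ch hch
  map f := normHom hch f
  map_id x := by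
    obtain ⟨⟨i, ⟨u, hu⟩, g⟩, rfl⟩ := Quotient.exists_rep x
    -- The identity is itself the class of an edge, whose normal form is the value of `pairHom` on
    -- the diagonal times an identity.
    have h : 𝟙 (show TotalCat EB C c from pt C c i (⟨u, hu⟩, g)) =
        edgeHom (idEdge i {i} (Finset.mem_singleton_self i) u (mem_UI_singleton hu) g)
          (idEdge_src _ _ _ _ _ _) (idEdge_tgt _ _ _ _ _ _) := rfl
    refine (congrArg (normHom hch) h).trans ((normHom_edgeHom hch _ _ _).trans ?_)
    refine prodMor_ext rfl ?_
    change pairHom C C' (c.h (ch u) i u, c.h (ch u) i u) * idBar C C' g = idBar C C' _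
    rw [pairHom_diag, ← map_mul]
    rfl
  map_comp f g := by
    obtain ⟨_, p, hp, rfl⟩ := f
    obtain ⟨_, q, hq, rfl⟩ := g
    rw [normHom_eq hch _ p hp rfl, normHom_eq hch _ q hq rfl, normHom_eq hch _ (p.comp q)
      (by rw [Quiver.Path.length_comp]; omega) (cls_mul p q hp hq).symm,
      Prefunctor.mapPath_comp, composePath_comp]
    rfl

/-- The morphisms of the bundle category are obtained from edges by composition with edges. -/
lemma hom_induction {P : ∀ {x y : TotalCat EB C c}, (x ⟶ y) → Prop}
    (edge : ∀ (e : Edge EB C c) {x y : TotalCat EB C c} (hx : e.src = x) (hy : e.tgt = y),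
      P (edgeHom e hx hy))
    (comp : ∀ {x y z : TotalCat EB C c} (f : x ⟶ y) (e : Edge EB C c) (hy : e.src = y)
      (hz : e.tgt = z), P f → P (f ≫ edgeHom e hy hz))
    {x y : TotalCat EB C c} (f : x ⟶ y) : P f := by
  -- Induction on a representing sequence; the empty prefix has to be split off, since only nonempty
  -- sequences represent morphisms.
  have key : ∀ (x y : TotalQuiver EB C c) (p : Quiver.Path x y) (hp : 0 < p.length),
      P (x := x) (y := y) ⟨cls ⟨p, hp⟩, p, hp, rfl⟩ := by
    intro x y p hp
    induction p with
    | nil => exact absurd hp (lt_irrefl _)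
    | @cons y z q a ih =>
      obtain ⟨e, hy, hz⟩ := a
      by_cases hq : 0 < q.length
      · have h1 : cls ⟨q.cons ⟨e, hy, hz⟩, hp⟩ = cls ⟨q, hq⟩ * cls e.single := by
          subst hy hz
          exact (cls_mul q e.arrow.toPath hq Nat.one_pos).symm
        have h2 := comp (x := x) (y := y) (z := z) ⟨cls ⟨q, hq⟩, q, hq, rfl⟩ e hy hz (ih hq)
        convert h2 using 1
        exact Subtype.ext h1
      · cases q with
        | nil =>
          have h2 := edge e (x := x) (y := z) hy hz
          convert h2 using 1
          subst hy hz
          rfl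
        | cons q b => exact absurd (Nat.succ_pos _) hq
  obtain ⟨_, p, hp, rfl⟩ := f
  exact key x y p hp

lemma onMor_normFunctor_edgeMor (e : Edge EB C c) :
    onMor (normFunctor hch) (edgeMor e) =
      pairMor (pathMor e.γ) (barMor C C' (normEdge ch e)) := by
  refine Eq.trans ?_ (mk_eq_pairMor ((normPrefunctor C c hch).map e.arrow))
  rw [edgeMor_eq e rfl rfl, onMor]
  congr 1
  exact normHom_edgeHom hch e rfl rfl

/-- The path under a morphism. -/
def under {x y : TotalCat EB C c} (f : x ⟶ y) : PSPath EB B := ((normFunctor hch).map f).1.1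

lemma under_comp {x y z : TotalCat EB C c} (f : x ⟶ y) (g : y ⟶ z) :
    ∃ h, under hch (f ≫ g) = (under hch f).concat (under hch g) h :=
  ⟨((normFunctor hch).map f).1.2.2.trans ((normFunctor hch).map g).1.2.1.symm,
    congrArg (fun m => m.1.1) ((normFunctor hch).map_comp f g)⟩

lemma under_edgeHom (e : Edge EB C c) {x y : TotalCat EB C c} (hx : e.src = x)
    (hy : e.tgt = y) : under hch (edgeHom e hx hy) = e.γ :=
  congrArg (fun m => m.1.1) (normHom_edgeHom hch e hx hy)

/-! ### Edges -/

/-- An edge over a concatenation of two paths factors. -/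
lemma exists_edge_factor (e : Edge EB C c) {γ₁ γ₂ : PSPath EB B} {h : γ₁.tgt = γ₂.src}
    (hγ : e.γ = γ₁.concat γ₂ h) : ∃ e₁ e₂ : Edge EB C c, e₁.γ = γ₁ ∧ e₂.γ = γ₂ ∧
      e₁.src = e.src ∧ e₁.tgt = e₂.src ∧ e₂.tgt = e.tgt ∧
      cls e.single = cls e₁.single * cls e₂.single := by
  obtain ⟨i, I, hi, γ, hin, φ⟩ := e
  dsimp only at hγ
  subst hγ
  have hθ₁ : thetaBar C c i i γ₁ = 1 := thetaBar_self C c fun t => hin.of_concat_left t _ hi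
  have hθ₂ : thetaBar C c i i γ₂ = 1 := thetaBar_self C c fun t => hin.of_concat_right t _ hi
  -- The first edge carries all of `φ`; the second carries the identity at the target of `φ`.
  refine ⟨⟨i, I, hi, γ₁, hin.of_concat_left, φ⟩,
    ⟨i, I, hi, γ₂, hin.of_concat_right, idBar C C' (tgtBar C C' φ)⟩, rfl, rfl, ?_, ?_, ?_, ?_⟩
  · simp [Edge.src]
  · simp [Edge.src, Edge.tgt, h]
  · simp [Edge.tgt]
  · refine cls_eq_of_N₁ (fun _ h => h) (fun _ h => h) h rfl ?_ ?_
    · simp [hθ₁, hθ₂]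
    · simp [hθ₁, hθ₂, idBar_comp]

/-- Two consecutive edges inside the same `U_I` can be merged. -/
lemma exists_edge_merge {I : Finset ι} {i : ι} (e₁ e₂ : Edge EB C c)
    (h₁ : e₁.i = i) (hI₁ : e₁.I = I) (h₂ : e₂.i = i) (hI₂ : e₂.I = I) (h : e₁.tgt = e₂.src) :
    ∃ e : Edge EB C c, e.i = i ∧ e.I = I ∧ cls e.single = cls e₁.single * cls e₂.single := by
  obtain ⟨i₁, I₁, hi₁, γ₁, hin₁, φ₁⟩ := e₁
  obtain ⟨i₂, I₂, hi₂, γ₂, hin₂, φ₂⟩ := e₂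
  dsimp only at h₁ hI₁ h₂ hI₂
  subst h₁ hI₁ h₂ hI₂
  obtain ⟨hb, hg⟩ := Quotient.exact h
  dsimp only at hb hg
  -- Both edges use the same chart, so equality of the end points in the quotient is equality of
  -- coordinates, and `φ₁` and `φ₂` are composable as they stand.
  rw [gBar_self C c (show γ₁.tgt ∈ U i₂ from hin₁ _ _ hi₁), one_mul] at hg
  have hθ₁ : thetaBar C c i₂ i₂ γ₁ = 1 := thetaBar_self C c fun t => hin₁ t _ hi₁
  have hθ₂ : thetaBar C c i₂ i₂ γ₂ = 1 := thetaBar_self C c fun t => hin₂ t _ hi₁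
  refine ⟨⟨i₂, I₂, hi₁, γ₁.concat γ₂ hb.symm, PSPath.concat_inside _ hin₁ hin₂,
    compBar C C' φ₂ φ₁⟩, rfl, rfl, ?_⟩
  refine cls_eq_of_N₁ (fun _ h => h) (fun _ h => h) hb.symm rfl ?_ ?_
  · simp [hθ₁, hθ₂, hg]
  · simp [hθ₁, hθ₂]

/-- An edge over a path inside `U_I` can be expressed in any chart with index in `I`. -/
lemma exists_edge_rechart {I : Finset ι} {i : ι} (hi : i ∈ I) (e : Edge EB C c)
    (hγ : e.γ.Inside (UI U I)) :
    ∃ e' : Edge EB C c, e'.i = i ∧ e'.I = I ∧ cls e.single = cls e'.single :=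
  ⟨⟨i, I, hi, e.γ, hγ, thetaBar C c i e.i e.γ * e.φ⟩, rfl, rfl, cls_eq_of_N₀ rfl rfl⟩

include hch in
/-- A morphism over a path inside `U_I` is given by a single edge. -/
lemma exists_edgeHom_eq {I : Finset ι} {i : ι} (hi : i ∈ I) {x y : TotalCat EB C c}
    (f : x ⟶ y) (hin : (under hch f).Inside (UI U I)) :
    ∃ (e : Edge EB C c) (hx : e.src = x) (hy : e.tgt = y), e.i = i ∧ e.I = I ∧
      f = edgeHom e hx hy := by
  have rechart : ∀ (e : Edge EB C c) {x y : TotalCat EB C c} (hx : e.src = x) (hy : e.tgt = y),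
      (under hch (edgeHom e hx hy)).Inside (UI U I) → ∃ (e' : Edge EB C c) (hx' : e'.src = x)
        (hy' : e'.tgt = y), e'.i = i ∧ e'.I = I ∧ edgeHom e hx hy = edgeHom e' hx' hy' := by
    intro e x y hx hy hin
    rw [under_edgeHom] at hin
    obtain ⟨e', h1, h2, h3⟩ := exists_edge_rechart hi e hin
    obtain ⟨h4, h5⟩ := src_tgt_eq_of_cls_eq hch h3
    exact ⟨e', Eq.trans h4.symm hx, Eq.trans h5.symm hy, h1, h2, Subtype.ext h3⟩
  induction f using hom_induction with
  | edge e hx hy => exact rechart e hx hy hin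
  | comp f e hy hz ih =>
    obtain ⟨h3, h4⟩ := under_comp hch f (edgeHom e hy hz)
    rw [h4] at hin
    obtain ⟨e₁, hx₁, hy₁, hi₁, hI₁, rfl⟩ := ih hin.of_concat_left
    obtain ⟨e₂, hy₂, hz₂, hi₂, hI₂, he₂⟩ := rechart e hy hz hin.of_concat_right
    rw [he₂]
    obtain ⟨e₃, hi₃, hI₃, he₃⟩ := exists_edge_merge e₁ e₂ hi₁ hI₁ hi₂ hI₂ (hy₁.trans hy₂.symm)
    -- The merged edge is controlled only through its class. Its end points are recovered because
    -- source and target of a class are well defined.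
    obtain ⟨q, hq, hq'⟩ := (edgeHom e₁ hx₁ hy₁ ≫ edgeHom e₂ hy₂ hz₂).2
    obtain ⟨h5, h6⟩ := src_tgt_eq_of_cls_eq hch (he₃.trans hq'.symm)
    exact ⟨e₃, h5, h6, hi₃, hI₃, Subtype.ext he₃.symm⟩

/-! ### The comparison functor is fully faithful -/

/-- A morphism over a concatenation of two paths factors. -/
lemma exists_factor_of_under_eq {x y : TotalCat EB C c} (f : x ⟶ y) {γ₁ γ₂ : PSPath EB B}
    {h : γ₁.tgt = γ₂.src} (hγ : under hch f = γ₁.concat γ₂ h) :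
    ∃ (z : TotalCat EB C c) (f₁ : x ⟶ z) (f₂ : z ⟶ y), f = f₁ ≫ f₂ ∧ under hch f₁ = γ₁ ∧
      under hch f₂ = γ₂ := by
  have edge : ∀ (e : Edge EB C c) {x y : TotalCat EB C c} (hx : e.src = x) (hy : e.tgt = y)
      {γ₁ γ₂ : PSPath EB B} {h : γ₁.tgt = γ₂.src}, e.γ = γ₁.concat γ₂ h →
      ∃ (z : TotalCat EB C c) (f₁ : x ⟶ z) (f₂ : z ⟶ y),
        edgeHom e hx hy = f₁ ≫ f₂ ∧ under hch f₁ = γ₁ ∧ under hch f₂ = γ₂ := by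
    intro e x y hx hy γ₁ γ₂ h hγ
    obtain ⟨e₁, e₂, h1, h2, h3, h4, h5, h6⟩ := exists_edge_factor e hγ
    exact ⟨e₂.src, edgeHom e₁ (h3.trans hx) h4, edgeHom e₂ rfl (h5.trans hy), Subtype.ext h6,
      (under_edgeHom hch e₁ _ _).trans h1, (under_edgeHom hch e₂ _ _).trans h2⟩
  induction f using hom_induction generalizing γ₁ γ₂ with
  | edge e hx hy => exact edge e hx hy ((under_edgeHom hch e hx hy).symm.trans hγ)
  | comp f e hy hz ih =>
    obtain ⟨h3, h4⟩ := under_comp hch f (edgeHom e hy hz)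
    -- The cut between `γ₁` and `γ₂` falls either into the path under `f` or into the path of the
    -- last edge.
    rcases PSPath.exists_factor (h4.symm.trans hγ) with ⟨δ, k₁, k₂, l₁, l₂⟩ | ⟨δ, k₁, k₂, l₁, l₂⟩
    · obtain ⟨w, f₁, f₂, m₁, m₂, m₃⟩ := ih l₁
      refine ⟨w, f₁, f₂ ≫ edgeHom e hy hz, by rw [m₁, Category.assoc], m₂, ?_⟩
      obtain ⟨n₁, n₂⟩ := under_comp hch f₂ (edgeHom e hy hz)
      rw [n₂, l₂]
      congr 1
    · rw [under_edgeHom] at l₂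
      obtain ⟨w, f₁, f₂, m₁, m₂, m₃⟩ := edge e hy hz l₂
      refine ⟨w, f ≫ f₁, f₂, by rw [m₁, Category.assoc], ?_, m₃⟩
      obtain ⟨n₁, n₂⟩ := under_comp hch f f₁
      rw [n₂, l₁]
      congr 1

lemma Edge.ext_of_eq {e e' : Edge EB C c} (hi : e.i = e'.i) (hI : e.I = e'.I) (hγ : e.γ = e'.γ)
    (hφ : e.φ = e'.φ) : e = e' := by
  cases e
  cases e'
  subst hi hI hγ hφ
  rfl

lemma normHom_edgeHom_snd (e : Edge EB C c) {x y : TotalCat EB C c} (hx : e.src = x)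
    (hy : e.tgt = y) : ((normFunctor hch).map (edgeHom e hx hy)).2.1 = normEdge ch e :=
  congrArg (fun m => m.2.1) (normHom_edgeHom hch e hx hy)

/-- Both morphisms are single edges with chart `i` and index set `{i}`. Their normal forms contain
the same left factor from the change of charts, and cancelling it identifies the edges. -/
lemma eq_of_map_eq_of_inside {x y : TotalCat EB C c} (f g : x ⟶ y) {i : ι}
    (hin : (under hch f).Inside (U i))
    (h : (normFunctor hch).map f = (normFunctor hch).map g) : f = g := by
  have hin' : (under hch f).Inside (UI U {i}) := fun t => mem_UI_singleton (hin t)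
  have hu : under hch f = under hch g := by rw [under, under, h]
  obtain ⟨e, hx, hy, h1, h2, rfl⟩ := exists_edgeHom_eq hch (Finset.mem_singleton_self i) f hin'
  obtain ⟨e', hx', hy', h1', h2', rfl⟩ :=
    exists_edgeHom_eq hch (Finset.mem_singleton_self i) g (hu ▸ hin')
  rw [under_edgeHom, under_edgeHom] at hu
  have h3 := congrArg (fun m => m.2.1) h
  rw [normHom_edgeHom_snd, normHom_edgeHom_snd, normEdge, normEdge, hu, h1, h1'] at h3
  have : e = e' := Edge.ext_of_eq (h1.trans h1'.symm) (h2.trans h2'.symm) hu (mul_left_cancel h3)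
  subst this
  rfl

lemma exists_map_eq_of_inside {x y : TotalCat EB C c}
    (m : (normFunctor hch).obj x ⟶ (normFunctor hch).obj y) {i : ι} (hin : m.1.1.Inside (U i)) :
    ∃ f : x ⟶ y, (normFunctor hch).map f = m := by
  -- The group part is the solution `φ` of the equation `normEdge ch e = m.2.1`.
  let e : Edge EB C c := ⟨i, {i}, Finset.mem_singleton_self i, m.1.1,
    fun t => mem_UI_singleton (hin t),
    (pairHom C C' (c.h (ch m.1.1.src) i m.1.1.src, c.h (ch m.1.1.tgt) i m.1.1.tgt))⁻¹ * m.2.1⟩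
  have h0 : normEdge ch e = m.2.1 := mul_inv_cancel_left _ _
  have h1 : onMor (normFunctor hch) (edgeMor e) = ⟨_, _, m⟩ := by
    rw [onMor_normFunctor_edgeMor, mk_eq_pairMor m, h0]
  have hx : e.src = x :=
    (normObj_bijective (EB := EB) C c hch).1 (congrArg Quiver.Total.left h1)
  have hy : e.tgt = y :=
    (normObj_bijective (EB := EB) C c hch).1 (congrArg Quiver.Total.right h1)
  exact ⟨edgeHom e hx hy, prodMor_ext (under_edgeHom hch e hx hy)
    ((normHom_edgeHom_snd hch e hx hy).trans h0)⟩

lemma normFunctor_obj_surjective (q : PathCat EB B × GBar C C') :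
    ∃ z : TotalCat EB C c, (normFunctor hch).obj z = q := (normObj_bijective C c hch).2 q

lemma exists_hom_factor {a b : PathCat EB B × GBar C C'} (m : a ⟶ b) {γ₁ γ₂ : PSPath EB B}
    {h : γ₁.tgt = γ₂.src} (hm : m.1.1 = γ₁.concat γ₂ h) :
    ∃ (q : PathCat EB B × GBar C C') (m₁ : a ⟶ q) (m₂ : q ⟶ b),
      m = m₁ ≫ m₂ ∧ m₁.1.1 = γ₁ ∧ m₂.1.1 = γ₂ := by
  have hs := m.1.2.1
  have ht := m.1.2.2
  rw [hm] at hs ht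
  rw [PSPath.src_concat] at hs
  rw [PSPath.tgt_concat] at ht
  -- The whole group part is carried by the first factor, so the intermediate group coordinate is
  -- already `b.2`.
  refine ⟨(γ₁.tgt, b.2), Prod.mkHom ⟨γ₁, hs, rfl⟩ m.2, Prod.mkHom ⟨γ₂, h.symm, ht⟩ (𝟙 _), ?_,
    rfl, rfl⟩
  exact prodMor_ext hm (congrArg Subtype.val (Category.comp_id m.2)).symm

lemma exists_vertical_hom {a b : PathCat EB B × GBar C C'} (h : a.1 = b.1) (φ : a.2 ⟶ b.2) :
    ∃ n : a ⟶ b, n.1.1 = PSPath.const (show B from a.1) ∧ n.2 = φ :=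
  ⟨Prod.mkHom ⟨PSPath.const (show B from a.1), rfl, h⟩ φ, rfl, rfl⟩

/-- Local lifts exist by `exists_map_eq_of_inside`. For a concatenation, the intermediate object can
be lifted because the functor is surjective on objects, and the lifts of the two factors then
compose. -/
lemma normFunctor_full {x y : TotalCat EB C c}
    (m : (normFunctor hch).obj x ⟶ (normFunctor hch).obj y) :
    ∃ f : x ⟶ y, (normFunctor hch).map f = m := by
  have key : ∀ γ : PSPath EB B, ∀ (x y : TotalCat EB C c)
      (m : (normFunctor hch).obj x ⟶ (normFunctor hch).obj y), m.1.1 = γ →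
      ∃ f : x ⟶ y, (normFunctor hch).map f = m := by
    refine PSPath.induction_cover (fun u => ⟨ch u, hch u⟩) ?_ ?_
    · rintro γ i hγ x y m rfl
      exact exists_map_eq_of_inside hch m hγ
    · intro γ₁ γ₂ h ih₁ ih₂ x y m hm
      obtain ⟨q, m₁, m₂, rfl, h₁, h₂⟩ := exists_hom_factor m hm
      obtain ⟨z, rfl⟩ := normFunctor_obj_surjective (c := c) hch q
      obtain ⟨f₁, rfl⟩ := ih₁ _ _ m₁ h₁
      obtain ⟨f₂, rfl⟩ := ih₂ _ _ m₂ h₂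
      exact ⟨f₁ ≫ f₂, (normFunctor hch).map_comp f₁ f₂⟩
  exact key _ _ _ m rfl

/-- Factorizations of `f` and `g` over the same concatenation pass through objects `z` and `w` over
one point that may differ in the group coordinate. A morphism `η` from `z` to `w` over a constant
path corrects this. -/
lemma normFunctor_faithful {x y : TotalCat EB C c} {f g : x ⟶ y}
    (h : (normFunctor hch).map f = (normFunctor hch).map g) : f = g := by
  have key : ∀ γ : PSPath EB B, ∀ (x y : TotalCat EB C c) (f g : x ⟶ y), under hch f = γ →
      (normFunctor hch).map f = (normFunctor hch).map g → f = g := by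
    refine PSPath.induction_cover (fun u => ⟨ch u, hch u⟩) ?_ ?_
    · rintro γ i hγ x y f g rfl h
      exact eq_of_map_eq_of_inside hch f g hγ h
    · intro γ₁ γ₂ h ih₁ ih₂ x y f g hf hfg
      have hg : under hch g = γ₁.concat γ₂ h := by rw [← hf, under, under, hfg]
      obtain ⟨z, f₁, f₂, rfl, rfl, rfl⟩ := exists_factor_of_under_eq hch f hf
      obtain ⟨w, g₁, g₂, rfl, hg₁, hg₂⟩ := exists_factor_of_under_eq hch g hg
      -- The group part of `η` must be that of `f₁` inverted, followed by that of `g₁`. With it, `f₁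
      -- ≫ η = g₁` and `f₂ = η ≫ g₂`. Composition with `η` leaves the underlying paths unchanged, so
      -- both induction hypotheses apply.
      obtain ⟨ψ, hψ₁, hψ₂⟩ := exists_inverse_hom C C' ((normFunctor hch).map f₁).2
      have hzw : ((normFunctor hch).obj z).1 = ((normFunctor hch).obj w).1 :=
        ((normFunctor hch).map f₁).1.2.2.symm.trans
          ((congrArg PSPath.tgt hg₁.symm).trans ((normFunctor hch).map g₁).1.2.2)
      obtain ⟨n, hn₁, hn₂⟩ := exists_vertical_hom hzw (ψ ≫ ((normFunctor hch).map g₁).2)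
      obtain ⟨η, rfl⟩ := exists_map_eq_of_inside hch n (i := ch ((normFunctor hch).obj z).1)
        (by rw [hn₁]; exact fun _ => hch _)
      have h2 : ((normFunctor hch).map f₁).2 ≫ ((normFunctor hch).map f₂).2 =
          ((normFunctor hch).map g₁).2 ≫ ((normFunctor hch).map g₂).2 := by
        have := congrArg (fun m => m.2) hfg
        rwa [Functor.map_comp, Functor.map_comp] at this
      have hs : ∀ {a b d : PathCat EB B × GBar C C'} (f : a ⟶ b) (g : b ⟶ d),
          (f ≫ g).2 = f.2 ≫ g.2 := fun _ _ => rfl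
      have e₁ : f₁ ≫ η = g₁ := by
        obtain ⟨k, hk⟩ := under_comp hch f₁ η
        rw [PSPath.concat_of_eq_const k hn₁] at hk
        refine ih₁ _ _ _ _ hk (prodMor_ext (hk.trans hg₁.symm) (congrArg Subtype.val ?_))
        rw [Functor.map_comp, hs, hn₂, ← Category.assoc, hψ₁, Category.id_comp]
      have e₂ : f₂ = η ≫ g₂ := by
        obtain ⟨k, hk⟩ := under_comp hch η g₂
        rw [PSPath.concat_of_const_eq k hn₁] at hk
        refine ih₂ _ _ _ _ rfl (prodMor_ext (hg₂.symm.trans hk.symm) (congrArg Subtype.val ?_))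
        rw [Functor.map_comp, hs, hn₂, Category.assoc, ← h2, ← Category.assoc, hψ₂,
          Category.id_comp]
      rw [e₂, ← Category.assoc, e₁]
  exact key _ _ _ f g rfl h

end Comparison

section Bundle

variable {G H J : Type*} [Group G] [Group H] [Group J]
variable {EB : Type*} [NormedAddCommGroup EB] [NormedSpace ℝ EB]
variable {B : Type*} [TopologicalSpace B] [ChartedSpace EB B] {ι : Type*}
variable {C : CrossedModule G H} {C' : CrossedModule H J} [C.TauSurj]
variable {U : ι → TopologicalSpace.Opens B} {c : GerbalCocycle C' U}
variable {ch : B → ι} (hch : ∀ u, u ∈ U (ch u))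

/-! ### Projection and action -/

lemma onMor_normFunctor_bijective :
    Function.Bijective (onMor (normFunctor (EB := EB) (C := C) (c := c) hch)) := by
  constructor
  · rintro ⟨x, y, f⟩ ⟨x', y', g⟩ h
    have hx : x = x' := (normObj_bijective (EB := EB) C c hch).1 (congrArg Quiver.Total.left h)
    have hy : y = y' := (normObj_bijective (EB := EB) C c hch).1 (congrArg Quiver.Total.right h)
    subst hx hy
    simp only [onMor, Quiver.Total.mk.injEq, heq_eq_eq, true_and] at h
    rw [normFunctor_faithful hch h]
  · rintro ⟨a, b, m⟩
    obtain ⟨x, rfl⟩ := normFunctor_obj_surjective (c := c) hch a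
    obtain ⟨y, rfl⟩ := normFunctor_obj_surjective (c := c) hch b
    obtain ⟨f, rfl⟩ := normFunctor_full hch m
    exact ⟨⟨x, y, f⟩, rfl⟩

variable (EB C c)

/-- The inverse of the comparison functor. -/
def invFunctor : PathCat EB B × GBar C C' ⥤ TotalCat EB C c :=
  (exists_inverse_functor _ (onMor_normFunctor_bijective hch)).choose

variable {EB C c}

lemma norm_comp_inv : normFunctor hch ⋙ invFunctor EB C c hch = 𝟭 _ :=
  (exists_inverse_functor _ (onMor_normFunctor_bijective hch)).choose_spec.1

lemma inv_comp_norm : invFunctor EB C c hch ⋙ normFunctor hch = 𝟭 _ :=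
  (exists_inverse_functor _ (onMor_normFunctor_bijective hch)).choose_spec.2

lemma onMor_inv_norm (f : Mor (TotalCat EB C c)) :
    onMor (invFunctor EB C c hch) (onMor (normFunctor hch) f) = f :=
  congrArg (fun F => onMor F f) (norm_comp_inv hch)

lemma onMor_norm_inv (m : Mor (PathCat EB B × GBar C C')) :
    onMor (normFunctor hch) (onMor (invFunctor EB C c hch) m) = m :=
  congrArg (fun F => onMor F m) (inv_comp_norm hch)

lemma obj_inv_norm (x : TotalCat EB C c) :
    (invFunctor EB C c hch).obj ((normFunctor hch).obj x) = x :=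
  congrArg (fun F => F.obj x) (norm_comp_inv hch)

lemma obj_norm_inv (q : PathCat EB B × GBar C C') :
    (normFunctor hch).obj ((invFunctor EB C c hch).obj q) = q :=
  congrArg (fun F => F.obj q) (inv_comp_norm hch)

lemma onMor_inv_injective : Function.Injective (onMor (invFunctor EB C c hch)) :=
  Function.LeftInverse.injective (onMor_norm_inv hch)

lemma obj_inv_injective : Function.Injective (invFunctor EB C c hch).obj :=
  Function.LeftInverse.injective (obj_norm_inv hch)

lemma mor_eq_inv (f : Mor (TotalCat EB C c)) :
    ∃ a b, f = onMor (invFunctor EB C c hch) (pairMor a b) :=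
  ⟨onMor (CategoryTheory.Prod.fst _ _) (onMor (normFunctor hch) f),
    onMor (CategoryTheory.Prod.snd _ _) (onMor (normFunctor hch) f), (onMor_inv_norm hch f).symm⟩

lemma obj_eq_inv (x : TotalCat EB C c) : ∃ u a, x = (invFunctor EB C c hch).obj (u, a) :=
  ⟨((normFunctor hch).obj x).1, ((normFunctor hch).obj x).2, (obj_inv_norm hch x).symm⟩

lemma edgeMor_eq_inv (e : Edge EB C c) : edgeMor e =
    onMor (invFunctor EB C c hch) (pairMor (pathMor e.γ) (barMor C C' (normEdge ch e))) := by
  rw [← onMor_normFunctor_edgeMor hch e, onMor_inv_norm]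

lemma pt_eq_inv {i : ι} {u : B} (hu : u ∈ U i) (g : GBar C C') :
    (pt C c i (⟨u, hu⟩, g) : TotalObj C c) =
      (invFunctor EB C c hch).obj (u, gBar C c (ch u) i u * g) :=
  (obj_inv_norm hch (show TotalCat EB C c from pt C c i (⟨u, hu⟩, g))).symm

/-- The right multiplication action of the categorical group on the product of the path category
and the categorical group. -/
def mulAct (EB : Type*) [NormedAddCommGroup EB] [NormedSpace ℝ EB]
    (B : Type*) [TopologicalSpace B] [ChartedSpace EB B]
    (C : CrossedModule G H) (C' : CrossedModule H J) [C.TauSurj] :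
    (PathCat EB B × GBar C C') × GBar C C' ⥤ PathCat EB B × GBar C C' :=
  CategoryTheory.prod.associator _ _ _ ⋙ (𝟭 _).prod CategoricalGroup.mulFunctor

lemma onMor_mulAct (a : Mor (PathCat EB B)) (b ψ : Mor (GBar C C')) :
    onMor (mulAct EB B C C') (pairMor (pairMor a b) ψ) = pairMor a (b * ψ) := by
  rw [← CategoricalGroup.mulFunctor_mor b ψ]
  rfl

variable (EB C c)

/-- The projection of the bundle category. -/
def projFunctor : TotalCat EB C c ⥤ PathCat EB B :=
  normFunctor hch ⋙ CategoryTheory.Prod.fst _ _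

/-- The right action on the bundle category. -/
def actFunctor : TotalCat EB C c × GBar C C' ⥤ TotalCat EB C c :=
  (normFunctor hch).prod (𝟭 _) ⋙ mulAct EB B C C' ⋙ invFunctor EB C c hch

variable {EB C c}

lemma onMor_proj_inv (a : Mor (PathCat EB B)) (b : Mor (GBar C C')) :
    onMor (projFunctor EB C c hch) (onMor (invFunctor EB C c hch) (pairMor a b)) = a :=
  congrArg (onMor (CategoryTheory.Prod.fst _ _)) (onMor_norm_inv hch (pairMor a b))

lemma obj_proj_inv (u : PathCat EB B) (a : GBar C C') :
    (projFunctor EB C c hch).obj ((invFunctor EB C c hch).obj (u, a)) = u :=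
  congrArg Prod.fst (obj_norm_inv hch (u, a))

/-- In the product coordinates the action is right multiplication on the second factor; with this
and `onMor_proj_inv` the bundle axioms on morphisms become group axioms. -/
lemma onMor_act_inv (a : Mor (PathCat EB B)) (b ψ : Mor (GBar C C')) :
    onMor (actFunctor EB C c hch)
        (pairMor (onMor (invFunctor EB C c hch) (pairMor a b)) ψ) =
      onMor (invFunctor EB C c hch) (pairMor a (b * ψ)) := by
  have h : onMor (actFunctor EB C c hch)
      (pairMor (onMor (invFunctor EB C c hch) (pairMor a b)) ψ) =
      onMor (invFunctor EB C c hch) (onMor (mulAct EB B C C')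
        (pairMor (onMor (normFunctor hch) (onMor (invFunctor EB C c hch) (pairMor a b))) ψ)) := rfl
  rw [h, onMor_norm_inv, onMor_mulAct]

lemma obj_act_inv (u : PathCat EB B) (a b : GBar C C') :
    (actFunctor EB C c hch).obj ((invFunctor EB C c hch).obj (u, a), b) =
      (invFunctor EB C c hch).obj (u, a * b) := by
  have h : (actFunctor EB C c hch).obj ((invFunctor EB C c hch).obj (u, a), b) =
      (invFunctor EB C c hch).obj ((mulAct EB B C C').obj
        ((normFunctor hch).obj ((invFunctor EB C c hch).obj (u, a)), b)) := rfl
  rw [h, obj_norm_inv]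
  rfl

lemma isProjection_projFunctor : IsProjection (projFunctor EB C c hch) := by
  refine ⟨fun i p => rfl, fun e => ?_⟩
  rw [edgeMor_eq_inv hch, onMor_proj_inv]

/-- Changes of chart multiply on the left and the action multiplies on the right, so the action has
the same formula in every chart. -/
lemma isRightAction_actFunctor : IsRightAction (actFunctor EB C c hch) := by
  refine ⟨fun i p a => ?_, fun e ψ => ?_⟩
  · obtain ⟨⟨u, hu⟩, g⟩ := p
    rw [pt_eq_inv (EB := EB) hch hu g]
    refine (obj_act_inv hch _ _ _).trans ?_
    rw [mul_assoc]
    exact (pt_eq_inv hch hu _).symm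
  · rw [edgeMor_eq_inv hch, onMor_act_inv, edgeMor_eq_inv hch, ← barMor_mul]
    simp only [normEdge, mul_assoc]

lemma isCategoricalPrincipalBundle_projFunctor :
    IsCategoricalPrincipalBundle (projFunctor EB C c hch) (actFunctor EB C c hch) where
  surjective_obj u := ⟨_, obj_proj_inv hch u 1⟩
  surjective_mor a := ⟨_, onMor_proj_inv hch a 1⟩
  obj_one p := by
    obtain ⟨u, a, rfl⟩ := obj_eq_inv hch p
    rw [obj_act_inv, mul_one]
  obj_mul p a b := by
    obtain ⟨u, d, rfl⟩ := obj_eq_inv hch p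
    rw [obj_act_inv, obj_act_inv, obj_act_inv, mul_assoc]
  mor_one f := by
    obtain ⟨u, a, rfl⟩ := mor_eq_inv hch f
    rw [onMor_act_inv, mul_one]
  mor_mul f φ ψ := by
    obtain ⟨u, a, rfl⟩ := mor_eq_inv hch f
    rw [onMor_act_inv, onMor_act_inv, onMor_act_inv, mul_assoc]
  obj_free p a h := by
    obtain ⟨u, d, rfl⟩ := obj_eq_inv hch p
    rw [obj_act_inv] at h
    exact mul_eq_left.mp (congrArg Prod.snd (obj_inv_injective hch h))
  mor_free f φ h := by
    obtain ⟨u, a, rfl⟩ := mor_eq_inv hch f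
    rw [onMor_act_inv] at h
    exact mul_eq_left.mp (pairMor_injective (onMor_inv_injective hch h)).2
  obj_fibre p a := by
    obtain ⟨u, d, rfl⟩ := obj_eq_inv hch p
    rw [obj_act_inv, obj_proj_inv, obj_proj_inv]
  mor_fibre f φ := by
    obtain ⟨u, a, rfl⟩ := mor_eq_inv hch f
    rw [onMor_act_inv, onMor_proj_inv, onMor_proj_inv]

/-! ### Local triviality -/

variable (EB C c) in
/-- The trivialization over `U_I` given by a chart with index `i`, followed by the comparison
functor. -/
def chartFunctor (ch : B → ι) (I : Finset ι) (i : ι) :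
    (pathSub EB (UI U I)).Carrier × GBar C C' ⥤ PathCat EB B × GBar C C' where
  obj p := (p.1.1, gBar C c (ch p.1.1) i p.1.1 * p.2)
  map {p q} f := Prod.mkHom f.1.1
    ⟨pairHom C C' (c.h (ch p.1.1) i p.1.1, c.h (ch q.1.1) i q.1.1) * f.2.1, by
      rw [map_mul, f.2.2.1]
      rfl, by
      rw [map_mul, f.2.2.2, tgtBar_pairHom]
      rfl⟩
  map_id p := by
    refine prodMor_ext rfl ?_
    change pairHom C C' (c.h (ch p.1.1) i p.1.1, c.h (ch p.1.1) i p.1.1) * idBar C C' p.2 =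
      idBar C C' _
    rw [pairHom_diag, ← map_mul]
    rfl
  map_comp {p q r} f g := by
    refine prodMor_ext rfl ?_
    change pairHom C C' (c.h (ch p.1.1) i p.1.1, c.h (ch r.1.1) i r.1.1) *
      compBar C C' g.2.1 f.2.1 = compBar C C'
        (pairHom C C' (c.h (ch q.1.1) i q.1.1, c.h (ch r.1.1) i r.1.1) * g.2.1)
        (pairHom C C' (c.h (ch p.1.1) i p.1.1, c.h (ch q.1.1) i q.1.1) * f.2.1)
    rw [compBar_mul C C' _ _ (by simp), compBar_pairHom]

lemma onMor_chartFunctor {I : Finset ι} {i : ι} (hi : i ∈ I) (γ : PSPath EB B)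
    (hγ : γ.Inside (UI U I)) (φ : MorBar C C') :
    onMor (chartFunctor EB C c ch I i) (pairMor (insideMor γ hγ) (barMor C C' φ)) =
      pairMor (pathMor γ) (barMor C C' (normEdge ch (⟨i, I, hi, γ, hγ, φ⟩ : Edge EB C c))) :=
  mk_eq_pairMor _

lemma eq_pairMor_insideMor {S : Set B} (f : Mor ((pathSub EB S).Carrier × GBar C C')) :
    ∃ (γ : PSPath EB B) (hγ : γ.Inside S) (φ : MorBar C C'),
      f = pairMor (insideMor γ hγ) (barMor C C' φ) := by
  obtain ⟨⟨⟨a, ha⟩, a'⟩, ⟨⟨b, hb⟩, b'⟩, ⟨⟨⟨γ, h1, h2⟩, h⟩, ⟨φ, h3, h4⟩⟩⟩ := f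
  dsimp only at h1 h2 h3 h4
  subst h1 h2 h3 h4
  exact ⟨γ, h, φ, rfl⟩

/-- Over a fixed path inside `U_I`, the passage from the chart `i` to the chosen charts is left
multiplication by a fixed element of the morphism group, hence bijective. It therefore suffices to
treat total morphisms and to invoke `exists_inverse_functor`. -/
lemma isLocallyTrivial_projFunctor :
    IsLocallyTrivial (projFunctor EB C c hch) (actFunctor EB C c hch) := by
  intro I i hi
  let π := projFunctor EB C c hch
  let Φ₀ := chartFunctor EB C c ch I i ⋙ invFunctor EB C c hch
  have hπ : Φ₀ ⋙ π = CategoryTheory.Prod.fst _ _ ⋙ Subcat.incl _ := by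
    refine functor_eq_of_onMor fun f => ?_
    obtain ⟨γ, hγ, φ, rfl⟩ := eq_pairMor_insideMor f
    have h : onMor (Φ₀ ⋙ π) (pairMor (insideMor γ hγ) (barMor C C' φ)) =
      onMor π (onMor (invFunctor EB C c hch) (onMor (chartFunctor EB C c ch I i)
        (pairMor (insideMor γ hγ) (barMor C C' φ)))) := rfl
    rw [h, onMor_chartFunctor hi, onMor_proj_inv]
    rfl
  have hΦ₀ : ∀ (γ : PSPath EB B) (hγ : γ.Inside (UI U I)) (φ : MorBar C C'),
      onMor Φ₀ (pairMor (insideMor γ hγ) (barMor C C' φ)) = edgeMor ⟨i, I, hi, γ, hγ, φ⟩ := by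
    intro γ hγ φ
    rw [edgeMor_eq_inv hch, ← onMor_chartFunctor (ch := ch) hi γ hγ φ]
    rfl
  have hobj : ∀ p, (pathSub EB (UI U I)).obj ((Φ₀ ⋙ π).obj p) := by
    rw [hπ]
    exact fun p => p.1.2
  have hhom : ∀ {p q} (f : p ⟶ q), (pathSub EB (UI U I)).hom ((Φ₀ ⋙ π).map f) := by
    rw [hπ]
    exact fun f => f.1.2
  let Φ : _ ⥤ ((pathSub EB (UI U I)).comap π).Carrier := Subcat.lift _ Φ₀ hobj hhom
  have hincl : Φ ⋙ Subcat.incl _ = Φ₀ := rfl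
  have hbij : Function.Bijective (onMor Φ) := by
    constructor
    · intro f f' h
      obtain ⟨γ, hγ, φ, rfl⟩ := eq_pairMor_insideMor f
      obtain ⟨γ', hγ', φ', rfl⟩ := eq_pairMor_insideMor f'
      have h1 : onMor Φ₀ _ = onMor Φ₀ _ := congrArg (onMor (Subcat.incl _)) h
      rw [hΦ₀, hΦ₀, edgeMor_eq_inv hch, edgeMor_eq_inv hch] at h1
      obtain ⟨h2, h3⟩ := pairMor_injective (onMor_inv_injective hch h1)
      obtain rfl : γ = γ' := pathMor_injective h2
      have h4 := barMor_injective C C' h3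
      have h5 : φ = φ' := mul_left_cancel h4
      rw [h5]
    · intro f
      obtain ⟨a, b, hab⟩ := mor_eq_inv hch (onMor (Subcat.incl _) f)
      obtain ⟨γ, rfl⟩ := pathMor_surjective a
      obtain ⟨φ, rfl⟩ := barMor_surjective C C' b
      have h1 : onMor π (onMor (Subcat.incl _) f) = pathMor γ := by
        rw [hab, onMor_proj_inv]
      have hγ : γ.Inside (UI U I) := by
        have h2 := f.hom.2
        have h3 : (onMor π (onMor (Subcat.incl _) f)).hom.1 = γ :=
          congrArg (fun m : Mor (PathCat EB B) => m.hom.1) h1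
        rw [← h3]
        exact h2
      -- The preimage undoes the left factor that `normEdge` introduces.
      refine ⟨pairMor (insideMor γ hγ) (barMor C C' ((pairHom C C'
        (c.h (ch γ.src) i γ.src, c.h (ch γ.tgt) i γ.tgt))⁻¹ * φ)),
        Subcat.onMor_incl_injective _ ?_⟩
      have h2 : ∀ m, onMor (Subcat.incl _) (onMor Φ m) = onMor Φ₀ m := fun _ => rfl
      rw [h2, hΦ₀, hab, edgeMor_eq_inv hch, normEdge]
      simp only [mul_inv_cancel_left]
  obtain ⟨Ψ, h1, h2⟩ := exists_inverse_functor Φ hbij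
  refine ⟨Φ, Ψ, h1, h2, fun u hu g => (pt_eq_inv hch (hu i hi) g).symm, hΦ₀, ?_, ?_, ?_⟩
  · exact hπ
  · intro u g a
    change (invFunctor EB C c hch).obj (u.1, gBar C c (ch u.1) i u.1 * (g * a)) =
      (actFunctor EB C c hch).obj
        ((invFunctor EB C c hch).obj (u.1, gBar C c (ch u.1) i u.1 * g), a)
    rw [obj_act_inv, mul_assoc]
  · intro f φ ψ
    obtain ⟨γ, hγ, φ', hf⟩ := eq_pairMor_insideMor (pairMor f φ)
    obtain ⟨rfl, rfl⟩ := pairMor_injective hf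
    obtain ⟨ψ', rfl⟩ := barMor_surjective C C' ψ
    rw [hincl, ← barMor_mul, hΦ₀, hΦ₀]
    exact ((isRightAction_actFunctor hch).2 ⟨i, I, hi, γ, hγ, φ'⟩ ψ').symm

end Bundle

section Topology

variable {G H J : Type*} [Group G] [Group H] [Group J]
variable {B : Type*} [TopologicalSpace B] {ι : Type*}
variable {C : CrossedModule G H} {C' : CrossedModule H J} [C.TauSurj]
variable {U : ι → TopologicalSpace.Opens B} {c : GerbalCocycle C' U}
variable [TopologicalSpace G] [IsTopologicalGroup G]

/-! ### Topology of the object set -/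

instance : IsTopologicalGroup (GBar C C') :=
  inferInstanceAs (IsTopologicalGroup (G ⧸ tauJ C C'))

lemma continuous_toGBar : Continuous (toGBar C C') := QuotientGroup.continuous_mk

instance [SecondCountableTopology G] : SecondCountableTopology (GBar C C') :=
  inferInstanceAs (SecondCountableTopology (G ⧸ tauJ C C'))

lemma t2Space_GBar (h : IsClosed (tauJ C C' : Set G)) : T2Space (GBar C C') :=
  have : (tauJ C C').Normal := inferInstance
  have := QuotientGroup.instT3Space (tauJ C C') (hN := h)
  inferInstanceAs (T2Space (G ⧸ tauJ C C'))

variable (C c) in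
lemma pt_injective (i : ι) : Function.Injective (pt C c i) := by
  rintro ⟨⟨u, hu⟩, g⟩ ⟨⟨v, hv⟩, g'⟩ h
  obtain ⟨h1, h2⟩ := Quotient.exact h
  dsimp only at h1 h2
  subst h1
  rw [gBar_self C c hv, one_mul] at h2
  rw [h2]

/-- Two points in different charts agree if and only if they are related by the transition map. -/
lemma pt_eq_pt_iff {i k : ι} {u : B} {hu : u ∈ U i} {g : GBar C C'} {q : (U k) × GBar C C'} :
    pt C c i (⟨u, hu⟩, g) = pt C c k q ↔ (q.1 : B) = u ∧ q.2 = gBar C c k i u * g :=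
  ⟨fun h => Quotient.exact h, fun h => Quotient.sound h⟩

lemma exists_pt_eq (x : TotalObj C c) : ∃ i p, pt C c i p = x := by
  obtain ⟨⟨i, p⟩, rfl⟩ := Quotient.exists_rep x
  exact ⟨i, p, rfl⟩

/-- The base point of a point of the bundle. -/
def basePt (x : TotalObj C c) : B := Quotient.liftOn x (fun p => p.2.1.1) fun _ _ h => h.1.symm

@[simp] lemma basePt_pt (i : ι) (p : (U i) × GBar C C') : basePt (pt C c i p) = p.1 := rfl

lemma range_pt (i : ι) : Set.range (pt C c i) = basePt ⁻¹' (U i) := by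
  ext x
  constructor
  · rintro ⟨p, rfl⟩
    exact p.1.2
  · intro hx
    obtain ⟨k, ⟨⟨u, hu⟩, g⟩, rfl⟩ := exists_pt_eq x
    exact ⟨(⟨u, hx⟩, _), (pt_eq C c hu hx g).symm⟩

lemma continuous_pt (i : ι) : Continuous (pt C c i) :=
  (continuous_quotient_mk' (s := objSetoid C c)).comp continuous_sigmaMk

variable (hc : ∀ i k, ContinuousOn (fun u => gBar C c i k u) (U i ∩ U k : Set B))

include hc in
-- In the chart `k`, the image of an open set of the chart `i` is its preimage under the transition
-- map, which is continuous on the open overlap.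
lemma isOpenMap_pt (i : ι) : IsOpenMap (pt C c i) := by
  intro O hO
  have hq : IsOpen ((Quotient.mk (objSetoid C c)) ⁻¹' (pt C c i '' O)) ↔
      IsOpen (pt C c i '' O) := isQuotientMap_quotient_mk'.isOpen_preimage
  rw [← hq, isOpen_sigma_iff]
  intro k
  rw [isOpen_iff_mem_nhds]
  rintro ⟨⟨u, hu⟩, g⟩ ⟨⟨⟨v, hv⟩, g'⟩, hO', he⟩
  obtain ⟨h1, h2⟩ := pt_eq_pt_iff.mp he
  dsimp only at h1 h2
  subst h1
  have hg : g' = gBar C c i k u * g := by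
    rw [h2, ← mul_assoc, gBar_mul C c hv hu hv, gBar_self C c hv, one_mul]
  -- The transition map `T` makes sense only on this open set `V`; openness is obtained in `V` and
  -- carried over to the whole chart `k`.
  let V : Set ((U k) × GBar C C') := {p | (p.1 : B) ∈ U i}
  have hV : IsOpen V := (U i).2.preimage (continuous_subtype_val.comp continuous_fst)
  let T : V → (U i) × GBar C C' := fun p => (⟨p.1.1.1, p.2⟩, gBar C c i k p.1.1.1 * p.1.2)
  have hT : Continuous T := by
    refine Continuous.prodMk (Continuous.subtype_mk (continuous_subtype_val.comp
      (continuous_fst.comp continuous_subtype_val)) _) (Continuous.mul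
      (f := fun p : V => gBar C c i k p.1.1.1) (g := fun p : V => p.1.2) ?_
      (continuous_snd.comp continuous_subtype_val))
    exact (hc i k).comp_continuous (continuous_subtype_val.comp
      (continuous_fst.comp continuous_subtype_val)) fun p => ⟨p.2, p.1.1.2⟩
  have hm : (⟨(⟨u, hu⟩, g), hv⟩ : V) ∈ T ⁻¹' O := by
    change ((⟨u, hv⟩, gBar C c i k u * g) : (U i) × GBar C C') ∈ O
    rwa [← hg]
  have hopen := hV.isOpenMap_subtype_val _ (hO.preimage hT)
  refine Filter.mem_of_superset (hopen.mem_nhds ⟨_, hm, rfl⟩) ?_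
  rintro _ ⟨⟨⟨⟨w, hw⟩, a⟩, hwi⟩, hp, rfl⟩
  exact ⟨_, hp, (pt_eq C c hw hwi a).symm⟩

include hc in
lemma isOpenEmbedding_pt (i : ι) : Topology.IsOpenEmbedding (pt C c i) :=
  .of_continuous_injective_isOpenMap (continuous_pt i) (pt_injective C c i) (isOpenMap_pt hc i)

lemma continuous_basePt : Continuous (basePt : TotalObj C c → B) := by
  refine continuous_quot_lift _ ?_
  exact continuous_sigma fun i => continuous_subtype_val.comp continuous_fst

include hc in
-- Points over different base points are separated in `B`. Points over the same base point share a
-- chart, where the Hausdorff property of `Ḡ` separates them; that property comes from the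
-- closedness of `ττ'(J)`.
lemma t2Space_totalObj [T2Space B] (hJ : IsClosed (tauJ C C' : Set G)) :
    T2Space (TotalObj C c) := by
  have := t2Space_GBar (C := C) (C' := C') hJ
  refine ⟨fun x y hxy => ?_⟩
  by_cases hb : basePt x = basePt y
  · obtain ⟨i, p, rfl⟩ := exists_pt_eq x
    obtain ⟨q, rfl⟩ : y ∈ Set.range (pt C c i) := by
      rw [range_pt]
      rw [Set.mem_preimage, ← hb]
      exact p.1.2
    have hpq : p ≠ q := fun h => hxy (congrArg _ h)
    obtain ⟨O₁, O₂, h1, h2, h3, h4, h5⟩ := t2_separation hpq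
    exact ⟨_, _, isOpenMap_pt hc i _ h1, isOpenMap_pt hc i _ h2, ⟨p, h3, rfl⟩, ⟨q, h4, rfl⟩,
      (Set.disjoint_image_iff (pt_injective C c i)).mpr h5⟩
  · obtain ⟨O₁, O₂, h1, h2, h3, h4, h5⟩ := t2_separation hb
    exact ⟨_, _, h1.preimage continuous_basePt, h2.preimage continuous_basePt, h3, h4,
      h5.preimage _⟩

include hc in
-- By the Lindelöf property of `B`, countably many charts suffice, and each is an open second
-- countable piece.
lemma secondCountable_totalObj [SecondCountableTopology B] [SecondCountableTopology G]
    (hU : ∀ u : B, ∃ i, u ∈ U i) : SecondCountableTopology (TotalObj C c) := by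
  obtain ⟨T, hT, hcov⟩ := TopologicalSpace.isOpen_iUnion_countable (fun i => (U i : Set B))
    fun i => (U i).2
  have := hT.to_subtype
  have hsc : ∀ i : T, SecondCountableTopology (Set.range (pt C c i)) := fun i =>
    ((isOpenEmbedding_pt hc i).isEmbedding.toHomeomorph).symm.isEmbedding.secondCountableTopology
  refine TopologicalSpace.secondCountableTopology_of_countable_cover
    (U := fun i : T => Set.range (pt C c i)) (fun i => (isOpenEmbedding_pt hc i).isOpen_range) ?_
  refine Set.eq_univ_of_forall fun x => ?_
  have hx : basePt x ∈ ⋃ i, (U i : Set B) := Set.mem_iUnion.mpr (hU _)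
  rw [← hcov] at hx
  obtain ⟨i, hi, hxi⟩ := Set.mem_iUnion₂.mp hx
  exact Set.mem_iUnion.mpr ⟨⟨i, hi⟩, by rw [range_pt]; exact hxi⟩

variable {EB : Type*} [NormedAddCommGroup EB] [NormedSpace ℝ EB] [ChartedSpace EB B]

include hc in
lemma isTopologicalObjBundle [T2Space B] [SecondCountableTopology B] [SecondCountableTopology G]
    (hU : ∀ u : B, ∃ i, u ∈ U i) (hJ : IsClosed (tauJ C C' : Set G))
    {π : TotalCat EB C c ⥤ PathCat EB B} {act : TotalCat EB C c × GBar C C' ⥤ TotalCat EB C c}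
    (hπ : IsProjection π) (hact : IsRightAction act) : IsTopologicalObjBundle π act := by
  have hproj : objProj π = basePt := by
    funext x
    obtain ⟨i, p, rfl⟩ := exists_pt_eq x
    exact hπ.1 i p
  refine ⟨isOpenEmbedding_pt hc, fun i => by rw [hproj, range_pt], hproj ▸ continuous_basePt, ?_,
    t2Space_totalObj hc hJ, secondCountable_totalObj hc hU⟩
  rw [continuous_iff_continuousAt]
  rintro ⟨x, a⟩
  obtain ⟨i, p, rfl⟩ := exists_pt_eq x
  have hopen : Topology.IsOpenEmbedding (Prod.map (pt C c i) (id : GBar C C' → GBar C C')) :=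
    (isOpenEmbedding_pt hc i).prodMap .id
  -- Continuity is local, and in the chart `i` the action is right multiplication in `Ḡ`.
  refine (hopen.continuousAt_iff (g := objAct act) (x := (p, a))).mp ?_
  have hcomp : objAct act ∘ Prod.map (pt C c i) id = fun q => pt C c i (q.1.1, q.1.2 * q.2) :=
    funext fun q => hact.1 i q.1 q.2
  rw [hcomp]
  exact ((continuous_pt i).comp (by fun_prop)).continuousAt

end Topology

/-! ### Gluing manifolds along smooth transition maps -/

section Gluing

variable {𝕜 : Type*} [NontriviallyNormedField 𝕜] {E : Type*} [NormedAddCommGroup E]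
  [NormedSpace 𝕜 E] {HM : Type*} [TopologicalSpace HM] (I : ModelWithCorners 𝕜 E HM) (n : ℕ∞ω)
  {X : Type*} [TopologicalSpace X] {ι : Type*} {M : ι → Type*} [∀ i, TopologicalSpace (M i)]
  [∀ i, ChartedSpace HM (M i)] [∀ i, Nonempty (M i)] {f : ∀ i, M i → X}

/-- A chart of a member of a jointly surjective family of open embeddings, as a chart of the
codomain. -/
def pushChart (hf : ∀ i, Topology.IsOpenEmbedding (f i)) (i : ι)
    (a : OpenPartialHomeomorph (M i) HM) : OpenPartialHomeomorph X HM :=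
  ((hf i).toOpenPartialHomeomorph (f i)).symm ≫ₕ a

lemma mem_pushChart_source (hf : ∀ i, Topology.IsOpenEmbedding (f i)) {i : ι}
    {a : OpenPartialHomeomorph (M i) HM} {p : M i} :
    f i p ∈ (pushChart hf i a).source ↔ p ∈ a.source := by
  simp [pushChart, (hf i).toOpenPartialHomeomorph_left_inv]

lemma pushChart_apply (hf : ∀ i, Topology.IsOpenEmbedding (f i)) (i : ι)
    (a : OpenPartialHomeomorph (M i) HM) (p : M i) : pushChart hf i a (f i p) = a p := by
  simp [pushChart, (hf i).toOpenPartialHomeomorph_left_inv]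

lemma pushChart_symm_apply (hf : ∀ i, Topology.IsOpenEmbedding (f i)) (i : ι)
    (a : OpenPartialHomeomorph (M i) HM) (z : HM) :
    (pushChart hf i a).symm z = f i (a.symm z) := rfl

lemma pushChart_target (hf : ∀ i, Topology.IsOpenEmbedding (f i)) (i : ι)
    (a : OpenPartialHomeomorph (M i) HM) : (pushChart hf i a).target = a.target := by
  simp [pushChart]

/-- The charted space structure on the codomain of a jointly surjective family of open embeddings
of charted spaces. -/
abbrev gluedChartedSpace (hf : ∀ i, Topology.IsOpenEmbedding (f i))
    (hsurj : ∀ x, ∃ i p, f i p = x) : ChartedSpace HM X where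
  atlas := {e | ∃ i, ∃ a ∈ atlas HM (M i), e = pushChart hf i a}
  chartAt x := pushChart hf (hsurj x).choose (chartAt HM (hsurj x).choose_spec.choose)
  mem_chart_source x := by
    have h := (mem_pushChart_source hf).mpr (mem_chart_source HM (hsurj x).choose_spec.choose)
    rwa [(hsurj x).choose_spec.choose_spec] at h
  chart_mem_atlas x := ⟨(hsurj x).choose, _, chart_mem_atlas HM (hsurj x).choose_spec.choose, rfl⟩

/-- Near a point, a change of glued charts is `b ∘ T ∘ a.symm`. Only the germ of `T` matters, so `T`
may be an arbitrary total function that is smooth at the point and compatible with the embeddings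
near it. -/
lemma isManifold_glued [∀ i, IsManifold I n (M i)] (hf : ∀ i, Topology.IsOpenEmbedding (f i))
    (hsurj : ∀ x, ∃ i p, f i p = x)
    (htrans : ∀ i k p q, f i p = f k q → ∃ T : M i → M k, ContMDiffAt I I n T p ∧
      ∀ᶠ p' in nhds p, f k (T p') = f i p') :
    letI := gluedChartedSpace (HM := HM) hf hsurj
    IsManifold I n X := by
  let _ := gluedChartedSpace (HM := HM) hf hsurj
  refine isManifold_of_contDiffOn I n X ?_
  rintro _ _ ⟨i, a, ha, rfl⟩ ⟨k, b, hb, rfl⟩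
  have key : ContMDiffOn I I n ((pushChart hf i a).symm ≫ₕ pushChart hf k b)
      ((pushChart hf i a).symm ≫ₕ pushChart hf k b).source := by
    intro z hz
    obtain ⟨hz₁, hz₂⟩ := hz
    have hz₁ : z ∈ a.target := by rwa [← pushChart_target hf i a]
    have hz₂ : f i (a.symm z) ∈ (pushChart hf k b).source := hz₂
    have hr : f i (a.symm z) ∈ Set.range (f k) := by
      have := ((pushChart hf k b).left_inv hz₂)
      rw [pushChart_symm_apply] at this
      exact ⟨_, this⟩
    obtain ⟨q, hq⟩ := hr
    obtain ⟨T, hT, hT'⟩ := htrans i k _ q hq.symm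
    have hTq : T (a.symm z) = q := (hf k).injective (hT'.self_of_nhds.trans hq.symm)
    have hqb : q ∈ b.source := by
      rw [← hq] at hz₂
      exact (mem_pushChart_source hf).mp hz₂
    have h1 : ContMDiffAt I I n a.symm z := contMDiffAt_symm_of_mem_maximalAtlas
      (IsManifold.subset_maximalAtlas ha) hz₁
    have h2 : ContMDiffAt I I n b (T (a.symm z)) := contMDiffAt_of_mem_maximalAtlas
      (IsManifold.subset_maximalAtlas hb) (hTq ▸ hqb)
    have h3 : ContMDiffAt I I n (b ∘ T ∘ a.symm) z := h2.comp z (hT.comp z h1)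
    refine (h3.congr_of_eventuallyEq ?_).contMDiffWithinAt
    filter_upwards [h1.continuousAt.eventually hT'] with w hw
    change pushChart hf k b (f i (a.symm w)) = b (T (a.symm w))
    rw [← hw, pushChart_apply]
  -- What remains is the passage from maps on the model space to maps on the vector space, by
  -- composition with `I` and its inverse.
  rw [← contMDiffOn_iff_contDiffOn]
  exact I.contMDiff.comp_contMDiffOn (key.comp (I.contMDiffOn_symm.mono Set.inter_subset_right)
    Set.inter_subset_left)

/-- A chart, as a partial diffeomorphism to the model space. -/
def partialDiffeomorphOfChart {N : Type*} [TopologicalSpace N] [ChartedSpace HM N]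
    [IsManifold I n N] (e : OpenPartialHomeomorph N HM) (he : e ∈ IsManifold.maximalAtlas I n N) :
    PartialDiffeomorph I I N HM n where
  toPartialEquiv := e.toPartialEquiv
  open_source := e.open_source
  open_target := e.open_target
  contMDiffOn_toFun := contMDiffOn_of_mem_maximalAtlas he
  contMDiffOn_invFun := contMDiffOn_symm_of_mem_maximalAtlas he

/-- Near `p`, the map `f i` is a chart of `M i` followed by the inverse of the glued chart built
from it; both are local diffeomorphisms. -/
lemma isLocalDiffeomorph_glued [∀ i, IsManifold I n (M i)]
    (hf : ∀ i, Topology.IsOpenEmbedding (f i)) (hsurj : ∀ x, ∃ i p, f i p = x)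
    (hX : letI := gluedChartedSpace (HM := HM) hf hsurj; IsManifold I n X) (i : ι) :
    letI := gluedChartedSpace (HM := HM) hf hsurj
    IsLocalDiffeomorph I I n (f i) := by
  let _ := gluedChartedSpace (HM := HM) hf hsurj
  intro p
  let a := chartAt HM p
  let A := partialDiffeomorphOfChart I n a (IsManifold.chart_mem_maximalAtlas p)
  have hmem : pushChart hf i a ∈ atlas HM X := ⟨i, a, chart_mem_atlas HM p, rfl⟩
  let A' := partialDiffeomorphOfChart I n (pushChart hf i a)
    (IsManifold.subset_maximalAtlas hmem)
  refine ⟨A.trans A'.symm, ⟨mem_chart_source HM p, ?_⟩, fun q hq => ?_⟩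
  · change a p ∈ (pushChart hf i a).target
    rw [pushChart_target]
    exact mem_chart_target HM p
  · change f i q = f i (a.symm (a q))
    rw [a.left_inv hq.1]

end Gluing

/-! ### The smooth structure on the object set -/

section Smooth

variable {𝕜 : Type*} [NontriviallyNormedField 𝕜] {E F F' : Type*} [NormedAddCommGroup E]
  [NormedSpace 𝕜 E] [NormedAddCommGroup F] [NormedSpace 𝕜 F] [NormedAddCommGroup F']
  [NormedSpace 𝕜 F']
  {H₁ H₂ H₃ : Type*} [TopologicalSpace H₁] [TopologicalSpace H₂] [TopologicalSpace H₃]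
  {I₁ : ModelWithCorners 𝕜 E H₁} {I₂ : ModelWithCorners 𝕜 F H₂} {I₃ : ModelWithCorners 𝕜 F' H₃}
  {M N P : Type*} [TopologicalSpace M] [ChartedSpace H₁ M] [TopologicalSpace N]
  [ChartedSpace H₂ N] [TopologicalSpace P] [ChartedSpace H₃ P] {n : ℕ∞ω}

lemma exists_local_section {f : M → N} {p : M} (hf : IsLocalDiffeomorphAt I₁ I₂ n f p) :
    ∃ s : N → M, ContMDiffAt I₂ I₁ n s (f p) ∧ s (f p) = p ∧ ∀ᶠ x in nhds (f p), f (s x) = x := by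
  obtain ⟨Φ, hp, hΦ⟩ := hf
  have hp' : f p ∈ Φ.target := by
    rw [hΦ hp]
    exact Φ.map_source hp
  refine ⟨Φ.invFun, Φ.contMDiffOn_invFun.contMDiffAt (Φ.open_target.mem_nhds hp'), ?_, ?_⟩
  · rw [hΦ hp]
    exact Φ.left_inv hp
  · filter_upwards [Φ.open_target.mem_nhds hp'] with x hx
    exact (hΦ (Φ.map_target hx)).trans (Φ.right_inv hx)

lemma contMDiffAt_of_comp_localDiffeomorph {f : M → N} {p : M} {g : N → P}
    (hf : IsLocalDiffeomorphAt I₁ I₂ n f p) (hg : ContMDiffAt I₁ I₃ n (g ∘ f) p) :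
    ContMDiffAt I₂ I₃ n g (f p) := by
  obtain ⟨s, h1, h2, h3⟩ := exists_local_section hf
  refine (ContMDiffAt.comp (f p) (h2 ▸ hg) h1).congr_of_eventuallyEq ?_
  filter_upwards [h3] with x hx
  simp [hx]

end Smooth

section SmoothBundle

variable {G H J : Type*} [Group G] [Group H] [Group J]
variable {B : Type*} [TopologicalSpace B] {ι : Type*}
variable {C : CrossedModule G H} {C' : CrossedModule H J} [C.TauSurj]
variable {U : ι → TopologicalSpace.Opens B} {c : GerbalCocycle C' U}
variable [TopologicalSpace G] [IsTopologicalGroup G]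
variable {EB : Type*} [NormedAddCommGroup EB] [NormedSpace ℝ EB] [ChartedSpace EB B]
  [IsManifold 𝓘(ℝ, EB) ∞ B]
variable {EK : Type*} [NormedAddCommGroup EK] [NormedSpace ℝ EK]
  [ChartedSpace EK (GBar C C')] [LieGroup 𝓘(ℝ, EK) ∞ (GBar C C')]

lemma exists_smooth_transition
    (hs : ∀ i k, ContMDiffOn 𝓘(ℝ, EB) 𝓘(ℝ, EK) ∞ (fun u => gBar C c i k u) (U i ∩ U k : Set B))
    (i k : ι) (p : (U i) × GBar C C') (q : (U k) × GBar C C') (h : pt C c i p = pt C c k q) :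
    ∃ T : (U i) × GBar C C' → (U k) × GBar C C',
      ContMDiffAt (𝓘(ℝ, EB).prod 𝓘(ℝ, EK)) (𝓘(ℝ, EB).prod 𝓘(ℝ, EK)) ∞ T p ∧
      ∀ᶠ p' in nhds p, pt C c k (T p') = pt C c i p' := by
  classical
  obtain ⟨⟨u, hu⟩, g⟩ := p
  obtain ⟨h1, h2⟩ := pt_eq_pt_iff.mp h
  have huk : u ∈ U k := h1 ▸ q.1.2
  -- The transition has to be a total function. Outside `U k` it takes the default value `u`, which
  -- does not affect its germ at the given point.
  let T₁ : (U i) × GBar C C' → U k := fun p' =>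
    if h' : (p'.1 : B) ∈ U k then ⟨p'.1, h'⟩ else ⟨u, huk⟩
  have hev : ∀ᶠ p' : (U i) × GBar C C' in nhds (⟨u, hu⟩, g), (p'.1 : B) ∈ U k :=
    (continuous_subtype_val.comp continuous_fst).continuousAt.eventually ((U k).2.mem_nhds huk)
  have hval : ContMDiff (𝓘(ℝ, EB).prod 𝓘(ℝ, EK)) 𝓘(ℝ, EB) ∞
      (fun p' : (U i) × GBar C C' => (p'.1 : B)) := contMDiff_subtype_val.comp contMDiff_fst
  refine ⟨fun p' => (T₁ p', gBar C c k i p'.1 * p'.2), ContMDiffAt.prodMk ?_ ?_, ?_⟩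
  · rw [← ContMDiffAt.subtypeVal_comp_iff]
    refine hval.contMDiffAt.congr_of_eventuallyEq ?_
    filter_upwards [hev] with p' hp'
    simp [T₁, hp']
  · have h3 : ContMDiffAt 𝓘(ℝ, EB) 𝓘(ℝ, EK) ∞ (fun u => gBar C c k i u) u :=
      (hs k i).contMDiffAt (((U k).2.inter (U i).2).mem_nhds ⟨huk, hu⟩)
    exact ContMDiffAt.mul (h3.comp (⟨u, hu⟩, g) hval.contMDiffAt) contMDiffAt_snd
  · filter_upwards [hev] with p' hp'
    have h4 : T₁ p' = ⟨p'.1, hp'⟩ := dif_pos hp'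
    rw [h4]
    exact (pt_eq C c p'.1.2 hp' p'.2).symm

lemma exists_smooth_structure
    (hc : ∀ i k, ContinuousOn (fun u => gBar C c i k u) (U i ∩ U k : Set B))
    (hs : ∀ i k, ContMDiffOn 𝓘(ℝ, EB) 𝓘(ℝ, EK) ∞ (fun u => gBar C c i k u) (U i ∩ U k : Set B)) :
    ∃ _ : ChartedSpace (ModelProd EB EK) (TotalObj C c),
      IsManifold (𝓘(ℝ, EB).prod 𝓘(ℝ, EK)) ∞ (TotalObj C c) ∧
      ∀ i, IsLocalDiffeomorph (𝓘(ℝ, EB).prod 𝓘(ℝ, EK)) (𝓘(ℝ, EB).prod 𝓘(ℝ, EK)) ∞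
        (pt C c i) := by
  -- Inverting an open embedding as a partial homeomorphism requires a nonempty domain. Indices with
  -- empty `U i` contribute no points, and the assertion about them is vacuous.
  let ι' := {i : ι // Nonempty ((U i) × GBar C C')}
  have : ∀ i : ι', Nonempty ((U i.1) × GBar C C') := fun i => i.2
  have hf : ∀ i : ι', Topology.IsOpenEmbedding (pt C c i.1) := fun i => isOpenEmbedding_pt hc i.1
  have hsurj : ∀ x, ∃ (i : ι') (p : (U i.1) × GBar C C'), pt C c i.1 p = x := fun x => by
    obtain ⟨i, p, rfl⟩ := exists_pt_eq x
    exact ⟨⟨i, ⟨p⟩⟩, p, rfl⟩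
  have hM := isManifold_glued (𝓘(ℝ, EB).prod 𝓘(ℝ, EK)) ∞ hf hsurj
    fun i k p q h => exists_smooth_transition hs i.1 k.1 p q h
  refine ⟨gluedChartedSpace hf hsurj, hM, fun i p => ?_⟩
  exact isLocalDiffeomorph_glued (𝓘(ℝ, EB).prod 𝓘(ℝ, EK)) ∞ hf hsurj hM ⟨i, ⟨p⟩⟩ p

lemma exists_smooth_bundle
    (hc : ∀ i k, ContinuousOn (fun u => gBar C c i k u) (U i ∩ U k : Set B))
    (hs : ∀ i k, ContMDiffOn 𝓘(ℝ, EB) 𝓘(ℝ, EK) ∞ (fun u => gBar C c i k u) (U i ∩ U k : Set B))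
    {π : TotalCat EB C c ⥤ PathCat EB B} {act : TotalCat EB C c × GBar C C' ⥤ TotalCat EB C c}
    (hπ : IsProjection π) (hact : IsRightAction act) :
    ∃ _ : ChartedSpace (ModelProd EB EK) (TotalObj C c),
      IsManifold (𝓘(ℝ, EB).prod 𝓘(ℝ, EK)) ∞ (TotalObj C c) ∧
      (∀ i, IsLocalDiffeomorph (𝓘(ℝ, EB).prod 𝓘(ℝ, EK)) (𝓘(ℝ, EB).prod 𝓘(ℝ, EK)) ∞
        (pt C c i)) ∧
      ContMDiff (𝓘(ℝ, EB).prod 𝓘(ℝ, EK)) 𝓘(ℝ, EB) ∞ (objProj π) ∧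
      ContMDiff ((𝓘(ℝ, EB).prod 𝓘(ℝ, EK)).prod 𝓘(ℝ, EK)) (𝓘(ℝ, EB).prod 𝓘(ℝ, EK)) ∞
        (objAct act) := by
  obtain ⟨_, hM, hloc⟩ := exists_smooth_structure hc hs
  refine ⟨_, hM, hloc, fun x => ?_, fun x => ?_⟩
  · obtain ⟨i, p, rfl⟩ := exists_pt_eq x
    refine contMDiffAt_of_comp_localDiffeomorph (hloc i p) ?_
    have h : objProj π ∘ pt C c i = fun p => (p.1 : B) := funext fun p => hπ.1 i p
    rw [h]
    exact (contMDiff_subtype_val.comp contMDiff_fst).contMDiffAt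
  · obtain ⟨x, a⟩ := x
    obtain ⟨i, p, rfl⟩ := exists_pt_eq x
    -- With a smooth local inverse `s` of the chart map, the action is near `(pt C c i p, a)` the
    -- composite of `s`, right multiplication in `Ḡ` and the chart map.
    obtain ⟨s, h1, h2, h3⟩ := exists_local_section (hloc i p)
    have h4 : ContMDiffAt ((𝓘(ℝ, EB).prod 𝓘(ℝ, EK)).prod 𝓘(ℝ, EK)) (𝓘(ℝ, EB).prod 𝓘(ℝ, EK)) ∞
        (fun y : TotalObj C c × GBar C C' => s y.1) (pt C c i p, a) :=
      ContMDiffAt.comp (pt C c i p, a) h1 contMDiffAt_fst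
    have h5 : ContMDiffAt ((𝓘(ℝ, EB).prod 𝓘(ℝ, EK)).prod 𝓘(ℝ, EK)) (𝓘(ℝ, EB).prod 𝓘(ℝ, EK)) ∞
        (fun y : TotalObj C c × GBar C C' => ((s y.1).1, (s y.1).2 * y.2)) (pt C c i p, a) :=
      ContMDiffAt.prodMk (contMDiffAt_fst.comp _ h4)
        (ContMDiffAt.mul (contMDiffAt_snd.comp _ h4) contMDiffAt_snd)
    have h6 : ContMDiffAt ((𝓘(ℝ, EB).prod 𝓘(ℝ, EK)).prod 𝓘(ℝ, EK)) (𝓘(ℝ, EB).prod 𝓘(ℝ, EK)) ∞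
        (fun y : TotalObj C c × GBar C C' => pt C c i ((s y.1).1, (s y.1).2 * y.2))
        (pt C c i p, a) :=
      ContMDiffAt.comp (g := pt C c i) (pt C c i p, a) (hloc i _).contMDiffAt h5
    refine h6.congr_of_eventuallyEq ?_
    filter_upwards [continuousAt_fst.eventually h3] with y hy
    have h7 := hact.1 i (s y.1) y.2
    rw [hy] at h7
    exact h7

end SmoothBundle

/-! ### The theorem for surjective `τ` and the reduction of the general case -/

section Main

variable {G H J : Type*} [Group G] [Group H] [Group J]
variable {EB : Type*} [NormedAddCommGroup EB] [NormedSpace ℝ EB]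
variable {B : Type*} [TopologicalSpace B] [ChartedSpace EB B] {ι : Type*}
variable {C : CrossedModule G H} {C' : CrossedModule H J} [C.TauSurj]
variable {U : ι → TopologicalSpace.Opens B} {c : GerbalCocycle C' U}
variable [TopologicalSpace G] [IsTopologicalGroup G] [SecondCountableTopology G]
variable {EH EJ EK : Type*} [NormedAddCommGroup EH] [NormedSpace ℝ EH]
  [NormedAddCommGroup EJ] [NormedSpace ℝ EJ] [NormedAddCommGroup EK] [NormedSpace ℝ EK]
  [TopologicalSpace H] [ChartedSpace EH H] [TopologicalSpace J] [ChartedSpace EJ J]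

lemma hasPrincipalBundle [T2Space B] [SecondCountableTopology B] [IsManifold 𝓘(ℝ, EB) ∞ B]
    (hτ : Continuous C.τ) (hJ : IsClosed (tauJ C C' : Set G))
    (hU : ∀ u : B, ∃ i, u ∈ U i) (hc : c.Smooth EB EH EJ) :
    HasPrincipalBundle EB C c EH EK := by
  choose ch hch using hU
  have hcont : ∀ i k, ContinuousOn (fun u => gBar C c i k u) (U i ∩ U k : Set B) := fun i k =>
    (continuous_toGBar.comp hτ).comp_continuousOn (hc.smooth_h i k).continuousOn
  refine ⟨fun p q h => src_tgt_eq_of_cls_eq hch h, projFunctor EB C c hch, actFunctor EB C c hch,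
    isProjection_projFunctor hch, isRightAction_actFunctor hch,
    isCategoricalPrincipalBundle_projFunctor hch, isLocallyTrivial_projFunctor hch,
    isTopologicalObjBundle hcont (fun u => ⟨ch u, hch u⟩) hJ (isProjection_projFunctor hch)
      (isRightAction_actFunctor hch), ?_⟩
  intro _ _ hH
  -- Smoothness of the transition functions of `Ḡ` is smoothness of `h ↦ [τ(h)]` composed with that
  -- of the `h_{ik}`.
  exact exists_smooth_bundle hcont (fun i k => hH.comp_contMDiffOn (hc.smooth_h i k))
    (isProjection_projFunctor hch) (isRightAction_actFunctor hch)

end Main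

lemma mem_tauJ_restrict {G H J : Type*} [Group G] [Group H] [Group J]
    {C : CrossedModule G H} {C' : CrossedModule H J} {g : C.τ.range} :
    g ∈ tauJ C.restrict C' ↔ (g : G) ∈ tauJ C C' :=
  exists_congr fun _ => Subtype.ext_iff

end CatBundle

theorem mainTheorem1
    {EB EG EH EJ EK : Type*}
    [NormedAddCommGroup EB] [NormedSpace ℝ EB] [NormedAddCommGroup EG] [NormedSpace ℝ EG]
    [NormedAddCommGroup EH] [NormedSpace ℝ EH] [NormedAddCommGroup EJ] [NormedSpace ℝ EJ]
    [NormedAddCommGroup EK] [NormedSpace ℝ EK]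
    {B : Type*} [TopologicalSpace B] [T2Space B] [SecondCountableTopology B]
    [ChartedSpace EB B] [IsManifold 𝓘(ℝ, EB) ∞ B]
    {G : Type*} [Group G] [TopologicalSpace G] [T2Space G] [SecondCountableTopology G]
    [ChartedSpace EG G] [LieGroup 𝓘(ℝ, EG) ∞ G]
    {H : Type*} [Group H] [TopologicalSpace H] [T2Space H] [SecondCountableTopology H]
    [ChartedSpace EH H] [LieGroup 𝓘(ℝ, EH) ∞ H]
    {J : Type*} [Group J] [TopologicalSpace J] [T2Space J] [SecondCountableTopology J]
    [ChartedSpace EJ J] [LieGroup 𝓘(ℝ, EJ) ∞ J]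
    (C : CatBundle.CrossedModule G H) (C' : CatBundle.CrossedModule H J)
    (hC : C.IsLie EG EH) (hC' : C'.IsLie EH EJ)
    (hτ : IsClosed (C.τ.range : Set G)) (hτ' : IsClosed (C'.τ.range : Set H))
    (hττ' : IsClosed (CatBundle.tauJ C C' : Set G))
    {ι : Type*} (U : ι → TopologicalSpace.Opens B) (hU : ∀ u : B, ∃ i, u ∈ U i)
    (c : CatBundle.GerbalCocycle C' U) (hc : c.Smooth EB EH EJ) :
    (∀ [C.TauSurj], CatBundle.HasPrincipalBundle EB C c EH EK) ∧
      CatBundle.HasPrincipalBundle EB C.restrict c EH EK := by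
  have := topologicalGroup_of_lieGroup 𝓘(ℝ, EG) ∞ (G := G)
  have hcont : Continuous C.τ := hC.smooth_τ.continuous
  have : SecondCountableTopology C.τ.range :=
    (Topology.IsEmbedding.subtypeVal (p := (· ∈ C.τ.range))).secondCountableTopology
  -- The second assertion is the same lemma for the restricted crossed module. On `τ(H)` it uses
  -- only the subspace topology and the closedness of `ττ'(J)` there, which is inherited from `G`.
  refine ⟨CatBundle.hasPrincipalBundle hcont hττ' hU hc, CatBundle.hasPrincipalBundle
    (hcont.subtype_mk _) ?_ hU hc⟩
  have h : (CatBundle.tauJ C.restrict C' : Set C.τ.range) =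
      Subtype.val ⁻¹' (CatBundle.tauJ C C' : Set G) :=
    Set.ext fun _ => CatBundle.mem_tauJ_restrict
  rw [h]
  exact hττ'.preimage continuous_subtype_val
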